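/- **Setting.** Let $d\in\{2,3\}$, $T>0$, let $\Omega^f,\Omega^s\subset\mathbb R^d$ be disjoint polytopal domains (bounded, equal to the interior of their closure), $\Gamma=\overline{\Omega^f}\cap\overline{\Omega^s}$, $\Gamma^i=\partial\Omega^i\setminus\Gamma$ for $i\in\{f,s\}$, and $\Omega=\operatorname{int}(\overline{\Omega^f}\cup\overline{\Omega^s})$. With real constants $\rho^f,\rho^s,\mu^f,\mu^s,\lambda^s$, $D(w)=\tfrac12(\nabla w+(\nabla w)^T)$, $\sigma^f=-p^fI+2\mu^fD(u^f)$ and $\sigma^s=\lambda^s(\nabla\cdot\eta^s)I+2\mu^sD(\eta^s)$, the FSI model on $[0,T]$ is $$\rho^f\partial_tu^f-\nabla\cdot\sigma^f=f^f,\quad \nabla\cdot u^f=0\ \text{ in }\Omega^f,\qquad \rho^s\partial_tu^s-\nabla\cdot\sigma^s=f^s,\quad \partial_t\eta^s-u^s=0\ \text{ in }\Omega^s,$$ $$u^f=u^s,\quad \sigma^fn^f+\sigma^sn^s=0\ \text{ on }\Gamma,\qquad u^f=0\ \text{ on }\Gamma^f,\quad \eta^s=0\ \text{ on }\Gamma^s,$$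 with given initial values of $u^f,u^s,\eta^s$. Here $n^f,n^s$ are the unit normals pointing out of $\Omega^f,\Omega^s$. Spatial derivatives are weak derivatives, boundary values are traces, the equations hold a.e. in space for every $t\in[0,T]$, $\partial_tu^f$ and $\partial_tu^s$ are strong derivatives (one-sided at $t=0,T$) of curves in $L^2(\Omega^f)^d$ and $L^2(\Omega^s)^d$, and $\partial_t\eta^s$ is the strong derivative of a curve in $H^1(\Omega^s)^d$. Let $u,\rho,f$ be the global fields equal to $u^i,\rho^i,f^i$ on $\Omega^i$. Let $\mathcal T_h=\mathcal T_h^f\cup\mathcal T_h^s$ be a conforming simplicial triangulation of $\Omega$ fitted to the interface, so that $\mathcal T_h^i$ triangulates $\Omega^i$ and $\Gamma$ is a union of facets. Let $h$ be the maximal element diameter, $\mathcal E_h$ and $\mathcal E_h^s$ the sets of facets of the elements of $\mathcal T_h$ and $\mathcal T_h^s$. On $\partial K$, $n$ is the outward unit normal, and $\mathsf{tang}(w)=w-(w\cdot n)n$. For $r\ge0$ let * $V_{h,0}^r$ be the space of $v\in H(\mathrm{div};\Omega)$ with $v|_K\in\mathcal P^r(K)^d$ for all $K\in\mathcal T_h$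 and $v\cdot n=0$ on all facets lying on $\Gamma^f$ or $\Gamma^s$; * $\widehat V_{h,0}^r$ be the space of $\hat v\in L^2(\mathcal E_h)^d$ with $\hat v|_F\in\mathcal P^r(F)^d$ and $\hat v\cdot n|_F=0$ for all $F\in\mathcal E_h$, and $\mathsf{tang}(\hat v)=0$ on all facets lying on $\Gamma^f$ or $\Gamma^s$; * $Q_h^{r,f}=\{q\in L^2(\Omega^f): q|_K\in\mathcal P^r(K)\ \forall K\in\mathcal T_h^f\}$; * $V_{h,0}^{r,s}$ and $\widehat V_{h,0}^{r,s}$ be the restrictions of $V_{h,0}^r$ to $\mathcal T_h^s$ and of $\widehat V_{h,0}^r$ to $\mathcal E_h^s$. For $k\ge1$, $\alpha>0$ and $i\in\{f,s\}$ let $$A_h^i((v,\hat v),(w,\hat w))=\sum_{K\in\mathcal T_h^i}\Big[\int_KD(v):D(w)-\int_{\partial K}D(v)n\cdot\mathsf{tang}(w-\hat w)-\int_{\partial K}D(w)n\cdot\mathsf{tang}(v-\hat v)+\int_{\partial K}\tfrac{\alpha k^2}{h}\,\Pi_h(\mathsf{tang}(v-\hat v))\cdot\Pi_h(\mathsf{tang}(w-\hat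 w))\Big],$$ where $\Pi_h$ is, facet by facet, the $L^2(F)$-projection onto the fields in $\mathcal P^{k-1}(F)^d$ with zero normal component. Write $(\cdot,\cdot)$, $(\cdot,\cdot)_f$, $(\cdot,\cdot)_s$, $\langle\cdot,\cdot\rangle_s$ for the $L^2$ inner products on $\Omega$, $\Omega^f$, $\Omega^s$, $\mathcal E_h^s$. **Lemma 2.1 (Galerkin-orthogonality for the semi-discrete scheme).** Let $(u,p^f,\eta^s)$ be a solution of the FSI model with $u(t)\in H^2(\Omega)^d$, $p^f(t)\in H^1(\Omega^f)$ and $\eta^s(t)\in H^2(\Omega^s)^d$ for all $t\in[0,T]$, and let $\hat u=u|_{\mathcal E_h}$, $\hat\eta^s=\eta^s|_{\mathcal E_h^s}$ be the traces on the mesh skeletons. Then, for every $t\in[0,T]$, the derivatives $\partial_tu$, $\partial_t\eta^s$, $\partial_t\hat\eta^s$ exist in $L^2(\Omega)^d$, $L^2(\Omega^s)^d$, $L^2(\mathcal E_h^s)^d$, and $$(\rho\,\partial_tu,v_h)+2\mu^fA_h^f((u,\hat u),(v_h,\hat v_h))-(p^f,\nabla\cdot v_h)_f-(\nabla\cdot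 u,q_h^f)_f+2\mu^sA_h^s((\eta^s,\hat\eta^s),(v_h,\hat v_h))+\lambda^s(\nabla\cdot\eta^s,\nabla\cdot v_h)_s=(f,v_h),$$ $$(\partial_t\eta^s-u,\xi_h^s)_s=0,\qquad\langle\partial_t\hat\eta^s-\hat u,\hat\xi_h^s\rangle_s=0$$ for all $(v_h,\hat v_h,q_h^f,\xi_h^s,\hat\xi_h^s)\in V_{h,0}^k\times\widehat V_{h,0}^{k-1}\times Q_h^{k-1,f}\times V_{h,0}^{k,s}\times\widehat V_{h,0}^{k-1,s}$. -/

import Mathlib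

open MeasureTheory Set Filter Topology
open scoped ContDiff RealInnerProductSpace

namespace FSI

noncomputable section

/-- The ambient Euclidean space `ℝᵈ`. -/
abbrev E (d : ℕ) : Type := EuclideanSpace ℝ (Fin d)

/-! ### Sobolev spaces and weak derivatives on an open set -/

/-- The classical partial derivative `∂ᵢ φ`. -/
def partialDeriv {d : ℕ} (i : Fin d) (φ : E d → ℝ) (x : E d) : ℝ :=
  fderiv ℝ φ x (EuclideanSpace.single i (1 : ℝ))

/-- Test functions: `φ ∈ C_c^∞(U)`. -/
def IsTest {d : ℕ} (U : Set (E d)) (φ : E d → ℝ) : Prop :=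
  ContDiff ℝ ∞ φ ∧ HasCompactSupport φ ∧ tsupport φ ⊆ U

/-- `g ∈ L²(U)` is the weak partial derivative `∂ᵢ f` on `U`. -/
def IsWeakPartial {d : ℕ} (U : Set (E d)) (i : Fin d) (f g : E d → ℝ) : Prop :=
  MemLp g 2 (volume.restrict U) ∧
    ∀ φ, IsTest U φ → ∫ x in U, f x * partialDeriv i φ x = - ∫ x in U, g x * φ x

/-- `f ∈ H¹(U)`. -/
def MemH1 {d : ℕ} (U : Set (E d)) (f : E d → ℝ) : Prop :=
  MemLp f 2 (volume.restrict U) ∧ ∀ i, ∃ g, IsWeakPartial U i f g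

/-- `f ∈ H²(U)`. -/
def MemH2 {d : ℕ} (U : Set (E d)) (f : E d → ℝ) : Prop :=
  MemH1 U f ∧ ∀ i, ∃ g, IsWeakPartial U i f g ∧ MemH1 U g

open Classical in
/-- The weak partial derivative `∂ᵢ f ∈ L²(U)` (zero if there is none). -/
def weakPartial {d : ℕ} (U : Set (E d)) (i : Fin d) (f : E d → ℝ) : E d → ℝ :=
  if h : ∃ g, IsWeakPartial U i f g then h.choose else 0

/-- `g ∈ L²(U)` is the weak divergence of the vector field `w` on `U`. -/
def IsWeakDiv {d : ℕ} (U : Set (E d)) (w : E d → E d) (g : E d → ℝ) : Prop :=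
  MemLp g 2 (volume.restrict U) ∧
    ∀ φ, IsTest U φ → ∫ x in U, ∑ i, w x i * partialDeriv i φ x = - ∫ x in U, g x * φ x

/-- `w ∈ H(div; U)`. -/
def MemHDiv {d : ℕ} (U : Set (E d)) (w : E d → E d) : Prop :=
  MemLp w 2 (volume.restrict U) ∧ ∃ g, IsWeakDiv U w g

open Classical in
/-- The weak divergence `∇ · w ∈ L²(U)` (zero if there is none). -/
def weakDiv {d : ℕ} (U : Set (E d)) (w : E d → E d) : E d → ℝ :=
  if h : ∃ g, IsWeakDiv U w g then h.choose else 0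

/-- Entry `(i, j)` of the symmetric gradient `D(w) = (∇w + (∇w)ᵀ) / 2` on `U`. -/
def symGrad {d : ℕ} (U : Set (E d)) (w : E d → E d) (i j : Fin d) (x : E d) : ℝ :=
  (weakPartial U j (fun y => w y i) x + weakPartial U i (fun y => w y j) x) / 2

/-- The fluid stress `σᶠ(u, p) = -p I + 2 μᶠ D(u)`. -/
def fluidStress {d : ℕ} (U : Set (E d)) (μf : ℝ) (u : E d → E d) (p : E d → ℝ)
    (i j : Fin d) (x : E d) : ℝ :=
  (if i = j then - p x else 0) + 2 * μf * symGrad U u i j x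

/-- The Cauchy stress `σˢ(η) = λˢ (∇ · η) I + 2 μˢ D(η)`. -/
def solidStress {d : ℕ} (U : Set (E d)) (μs lam : ℝ) (η : E d → E d)
    (i j : Fin d) (x : E d) : ℝ :=
  (if i = j then lam * weakDiv U η x else 0) + 2 * μs * symGrad U η i j x

/-- Row-wise divergence of a matrix field on `U`. -/
def rowDiv {d : ℕ} (U : Set (E d)) (σ : Fin d → Fin d → E d → ℝ) (i : Fin d) (x : E d) : ℝ :=
  ∑ j, weakPartial U j (σ i j) x

/-! ### Time derivatives -/

/-- At time `t` the curve `f : [0, T] → L²(μ)` has the (strong) derivative `g ∈ L²(μ)`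
(one-sided at the end points). -/
def HasL2TimeDeriv {d : ℕ} {V : Type*} [NormedAddCommGroup V] [NormedSpace ℝ V]
    (μ : Measure (E d)) (T : ℝ) (f : ℝ → E d → V) (g : E d → V) (t : ℝ) : Prop :=
  MemLp g 2 μ ∧
    Tendsto (fun s => eLpNorm (fun x => (s - t)⁻¹ • (f s x - f t x) - g x) 2 μ)
      (𝓝[Icc 0 T \ {t}] t) (𝓝 0)

/-- At time `t` the curve `f : [0, T] → H¹(U)ᵈ` has the (strong) derivative `g ∈ H¹(U)ᵈ`. -/
def HasH1TimeDeriv {d : ℕ} (U : Set (E d)) (T : ℝ) (f : ℝ → E d → E d) (g : E d → E d)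
    (t : ℝ) : Prop :=
  (∀ i, MemH1 U (fun x => g x i)) ∧
  HasL2TimeDeriv (volume.restrict U) T f g t ∧
  ∀ i j, HasL2TimeDeriv (volume.restrict U) T (fun s => weakPartial U j (fun x => f s x i))
    (weakPartial U j (fun x => g x i)) t

/-! ### Simplices, facets, normals and traces.
A simplex and its facets are given by their finite sets of vertices. -/

/-- `K` is the vertex set of a nondegenerate `d`-simplex in `ℝᵈ`. -/
def IsSimplex {d : ℕ} (K : Finset (E d)) : Prop :=
  K.card = d + 1 ∧ AffineIndependent ℝ (fun x : K => (x : E d))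

/-- The facets of the simplex `K`. -/
def facets {d : ℕ} (K : Finset (E d)) : Finset (Finset (E d)) := K.powersetCard d

/-- The closed simplex spanned by a finite set of vertices. -/
def hull {d : ℕ} (K : Finset (E d)) : Set (E d) := convexHull ℝ (K : Set (E d))

/-- The open simplex. -/
def openHull {d : ℕ} (K : Finset (E d)) : Set (E d) := interior (hull K)

/-- Surface measure (`(d-1)`-dimensional, Euclidean normalization) on the facet `F`. -/
def surf {d : ℕ} (F : Finset (E d)) : Measure (E d) :=
  (Measure.euclideanHausdorffMeasure (d - 1)).restrict (hull F)

/-- The outward unit normal of the simplex `K` on its facet `F`: the vector from the centroid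
of `K` to the centroid of `F`, projected to the orthogonal complement of the direction of `F`
and normalized. -/
def outwardNormal {d : ℕ} (K F : Finset (E d)) : E d :=
  let w := (vectorSpan ℝ (F : Set (E d)))ᗮ.starProjection
    (F.centroid ℝ id - K.centroid ℝ id)
  ‖w‖⁻¹ • w

/-- The tangential component `w - (w · n) n`. -/
def tang {d : ℕ} (n w : E d) : E d := w - (inner ℝ w n) • n

/-- `g ∈ L²(F)` is the trace on the facet `F` of `f ∈ H¹(K)`: there are functions smooth up to
the boundary which converge to `f` in `H¹(K)` and whose restrictions to `F` converge to `g`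
in `L²(F)`. -/
def IsTrace {d : ℕ} (K F : Finset (E d)) (f g : E d → ℝ) : Prop :=
  MemLp g 2 (surf F) ∧
  ∃ φ : ℕ → E d → ℝ, (∀ m, ContDiff ℝ ∞ (φ m)) ∧
    Tendsto (fun m => eLpNorm (fun x => φ m x - f x) 2 (volume.restrict (openHull K)))
      atTop (𝓝 0) ∧
    (∀ i, Tendsto (fun m => eLpNorm
        (fun x => partialDeriv i (φ m) x - weakPartial (openHull K) i f x) 2
        (volume.restrict (openHull K))) atTop (𝓝 0)) ∧
    Tendsto (fun m => eLpNorm (fun x => φ m x - g x) 2 (surf F)) atTop (𝓝 0)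

open Classical in
/-- The trace operator from `H¹(K)` to `L²(F)` (zero outside `H¹(K)`). -/
def trace {d : ℕ} (K F : Finset (E d)) (f : E d → ℝ) : E d → ℝ :=
  if h : MemH1 (openHull K) f ∧ ∃ g, IsTrace K F f g then h.2.choose else 0

/-- Componentwise trace of a vector field. -/
def traceVec {d : ℕ} (K F : Finset (E d)) (w : E d → E d) (x : E d) : E d :=
  WithLp.toLp 2 (fun i => trace K F (fun y => w y i) x)

/-- The trace of `σ n` on the facet `F` of `K`, with `n` outward for `K`. -/
def traceNormal {d : ℕ} (K F : Finset (E d)) (σ : Fin d → Fin d → E d → ℝ) (x : E d) : E d :=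
  WithLp.toLp 2 (fun i => ∑ j, trace K F (σ i j) x * outwardNormal K F j)

/-! ### The model problem -/

/-- The field equal to `a` on `Ωf` and to `b` elsewhere (in particular on `Ωs`). -/
def glue {d : ℕ} {V : Type*} (Ωf : Set (E d)) (a b : E d → V) (x : E d) : V :=
  open Classical in if x ∈ Ωf then a x else b x

/-- The interface `Γ`. -/
def interface {d : ℕ} (Ωf Ωs : Set (E d)) : Set (E d) := closure Ωf ∩ closure Ωs

/-- The domain `Ω` with `Ω̄ = Ω̄ᶠ ∪ Ω̄ˢ`. -/
def wholeDomain {d : ℕ} (Ωf Ωs : Set (E d)) : Set (E d) := interior (closure Ωf ∪ closure Ωs)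

/-- `w` is zero on the part `S` of the boundary of `U`, in the sense of traces: its trace is
zero on each facet contained in `S̄` of each simplex contained in `Ū`. -/
def ZeroTraceOn {d : ℕ} (U S : Set (E d)) (w : E d → E d) : Prop :=
  ∀ K F : Finset (E d), IsSimplex K → F ∈ facets K → hull K ⊆ closure U → hull F ⊆ closure S →
    ∀ᵐ x ∂(surf F), traceVec K F w x = 0

/-- `(uᶠ, uˢ, pᶠ, ηˢ)` solves the linear fluid-structure interaction model on `[0, T]`. -/
structure IsFSISolution {d : ℕ} (Ωf Ωs : Set (E d)) (T ρf ρs μf μs lam : ℝ)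
    (ff fs : ℝ → E d → E d) (u0f u0s η0 : E d → E d)
    (uf us : ℝ → E d → E d) (pf : ℝ → E d → ℝ) (ηs : ℝ → E d → E d) : Prop where
  /-- `ρᶠ ∂ₜ uᶠ - ∇ · σᶠ(uᶠ, pᶠ) = fᶠ` in `Ωᶠ`. -/
  fluid_momentum : ∀ t ∈ Icc 0 T, ∃ w, HasL2TimeDeriv (volume.restrict Ωf) T uf w t ∧
    ∀ i, ∀ᵐ x ∂(volume.restrict Ωf),
      ρf * w x i - rowDiv Ωf (fluidStress Ωf μf (uf t) (pf t)) i x = ff t x i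
  /-- `∇ · uᶠ = 0` in `Ωᶠ`. -/
  fluid_div : ∀ t ∈ Icc 0 T, ∀ᵐ x ∂(volume.restrict Ωf), weakDiv Ωf (uf t) x = 0
  /-- `ρˢ ∂ₜ uˢ - ∇ · σˢ(ηˢ) = fˢ` in `Ωˢ`. -/
  solid_momentum : ∀ t ∈ Icc 0 T, ∃ w, HasL2TimeDeriv (volume.restrict Ωs) T us w t ∧
    ∀ i, ∀ᵐ x ∂(volume.restrict Ωs),
      ρs * w x i - rowDiv Ωs (solidStress Ωs μs lam (ηs t)) i x = fs t x i
  /-- `∂ₜ ηˢ - uˢ = 0` in `Ωˢ`. -/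
  solid_velocity : ∀ t ∈ Icc 0 T, ∃ w, HasH1TimeDeriv Ωs T ηs w t ∧
    ∀ᵐ x ∂(volume.restrict Ωs), w x - us t x = 0
  /-- `uᶠ = uˢ` on `Γ`. -/
  kinematic : ∀ t ∈ Icc 0 T, ∀ Kf Ks F : Finset (E d), IsSimplex Kf → IsSimplex Ks →
    F ∈ facets Kf → F ∈ facets Ks → hull Kf ⊆ closure Ωf → hull Ks ⊆ closure Ωs →
    ∀ᵐ x ∂(surf F), traceVec Kf F (uf t) x = traceVec Ks F (us t) x
  /-- `σᶠ nᶠ + σˢ nˢ = 0` on `Γ`. -/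
  dynamic : ∀ t ∈ Icc 0 T, ∀ Kf Ks F : Finset (E d), IsSimplex Kf → IsSimplex Ks →
    F ∈ facets Kf → F ∈ facets Ks → hull Kf ⊆ closure Ωf → hull Ks ⊆ closure Ωs →
    ∀ᵐ x ∂(surf F), traceNormal Kf F (fluidStress Ωf μf (uf t) (pf t)) x
      + traceNormal Ks F (solidStress Ωs μs lam (ηs t)) x = 0
  /-- `uᶠ = 0` on `Γᶠ = ∂Ωᶠ \ Γ`. -/
  fluid_boundary : ∀ t ∈ Icc 0 T, ZeroTraceOn Ωf (frontier Ωf \ interface Ωf Ωs) (uf t)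
  /-- `ηˢ = 0` on `Γˢ = ∂Ωˢ \ Γ`. -/
  solid_boundary : ∀ t ∈ Icc 0 T, ZeroTraceOn Ωs (frontier Ωs \ interface Ωf Ωs) (ηs t)
  init_uf : ∀ᵐ x ∂(volume.restrict Ωf), uf 0 x = u0f x
  init_us : ∀ᵐ x ∂(volume.restrict Ωs), us 0 x = u0s x
  init_ηs : ∀ᵐ x ∂(volume.restrict Ωs), ηs 0 x = η0 x

/-! ### The mesh and the finite element spaces -/

open Classical in
/-- The set of facets of the elements in `Th`. -/
def meshFacets {d : ℕ} (Th : Finset (Finset (E d))) : Finset (Finset (E d)) :=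
  Th.biUnion facets

open Classical in
/-- All elements of the mesh. -/
def allElems {d : ℕ} (Tf Ts : Finset (Finset (E d))) : Finset (Finset (E d)) := Tf ∪ Ts

/-- `Ωf` and `Ωs` are disjoint polytopes, and `Tf ∪ Ts` is an interface-fitted conforming
simplicial triangulation of `Ω`, the elements in `Tf` being those in `Ωf` and the elements in
`Ts` those in `Ωs`. -/
structure IsFittedMesh {d : ℕ} (Ωf Ωs : Set (E d)) (Tf Ts : Finset (Finset (E d))) : Prop where
  /-- A polytope is the interior of its closure. -/
  regular_f : interior (closure Ωf) = Ωf
  regular_s : interior (closure Ωs) = Ωs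
  disjoint_domains : Disjoint Ωf Ωs
  simplex : ∀ K ∈ allElems Tf Ts, IsSimplex K
  /-- Two elements meet in the simplex spanned by their common vertices. -/
  conforming : ∀ K ∈ allElems Tf Ts, ∀ K' ∈ allElems Tf Ts,
    hull K ∩ hull K' = convexHull ℝ ((K : Set (E d)) ∩ (K' : Set (E d)))
  closure_f : closure Ωf = ⋃ K ∈ Tf, hull K
  closure_s : closure Ωs = ⋃ K ∈ Ts, hull K
  /-- The interface is the union of element facets. -/
  interface_facets : ∃ G ⊆ meshFacets (allElems Tf Ts), interface Ωf Ωs = ⋃ F ∈ G, hull F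

/-- The mesh size `h`: the maximum diameter of the elements. -/
def meshSize {d : ℕ} (Tf Ts : Finset (Finset (E d))) : ℝ :=
  sSup ((fun K => Metric.diam (hull K)) '' (allElems Tf Ts : Set (Finset (E d))))

/-- The facets of the mesh lying on the exterior boundary `Γᶠ` or `Γˢ`. -/
def OnExterior {d : ℕ} (Ωf Ωs : Set (E d)) (F : Finset (E d)) : Prop :=
  hull F ⊆ closure (frontier Ωf \ interface Ωf Ωs) ∨
    hull F ⊆ closure (frontier Ωs \ interface Ωf Ωs)

/-- `q` agrees `μ`-almost everywhere with a polynomial of degree at most `r`. -/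
def IsPolyOn {d : ℕ} (μ : Measure (E d)) (r : ℕ) (q : E d → ℝ) : Prop :=
  ∃ P : MvPolynomial (Fin d) ℝ, P.totalDegree ≤ r ∧
    ∀ᵐ x ∂μ, q x = MvPolynomial.eval (fun i => x i) P

/-- `v ∈ V_h^r`. -/
def MemV {d : ℕ} (Ωf Ωs : Set (E d)) (Tf Ts : Finset (Finset (E d))) (r : ℕ)
    (v : E d → E d) : Prop :=
  MemHDiv (wholeDomain Ωf Ωs) v ∧
    ∀ K ∈ allElems Tf Ts, ∀ i, IsPolyOn (volume.restrict (hull K)) r (fun x => v x i)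

/-- `v ∈ V_{h,0}^r`. -/
def MemV0 {d : ℕ} (Ωf Ωs : Set (E d)) (Tf Ts : Finset (Finset (E d))) (r : ℕ)
    (v : E d → E d) : Prop :=
  MemV Ωf Ωs Tf Ts r v ∧
    ∀ K ∈ allElems Tf Ts, ∀ F ∈ facets K, OnExterior Ωf Ωs F →
      ∀ᵐ x ∂(surf F), inner ℝ (traceVec K F v x) (outwardNormal K F) = 0

/-- `v ∈ V_{h,0}^{r,s}`: restrictions of functions in `V_{h,0}^r` to the structure elements. -/
def MemV0s {d : ℕ} (Ωf Ωs : Set (E d)) (Tf Ts : Finset (Finset (E d))) (r : ℕ)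
    (v : E d → E d) : Prop :=
  ∃ w, MemV0 Ωf Ωs Tf Ts r w ∧ ∀ K ∈ Ts, ∀ᵐ x ∂(volume.restrict (hull K)), v x = w x

/-- On the facet `F`, `q` is a polynomial vector field of degree at most `r` with zero normal
component. -/
def IsFacetPoly {d : ℕ} (F : Finset (E d)) (r : ℕ) (q : E d → E d) : Prop :=
  (∀ i, IsPolyOn (surf F) r (fun x => q x i)) ∧
    ∀ᵐ x ∂(surf F), ∀ n ∈ (vectorSpan ℝ (F : Set (E d)))ᗮ, inner ℝ (q x) n = 0

/-- `v̂ ∈ V̂_h^r`; functions on the skeleton are families indexed by the facets. -/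
def MemVhat {d : ℕ} (Tf Ts : Finset (Finset (E d))) (r : ℕ)
    (v : Finset (E d) → E d → E d) : Prop :=
  ∀ F ∈ meshFacets (allElems Tf Ts), IsFacetPoly F r (v F)

/-- `v̂ ∈ V̂_{h,0}^r`. -/
def MemVhat0 {d : ℕ} (Ωf Ωs : Set (E d)) (Tf Ts : Finset (Finset (E d))) (r : ℕ)
    (v : Finset (E d) → E d → E d) : Prop :=
  MemVhat Tf Ts r v ∧
    ∀ K ∈ allElems Tf Ts, ∀ F ∈ facets K, OnExterior Ωf Ωs F →
      ∀ᵐ x ∂(surf F), tang (outwardNormal K F) (v F x) = 0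

/-- `v̂ ∈ V̂_{h,0}^{r,s}`: restrictions to the structure skeleton. -/
def MemVhat0s {d : ℕ} (Ωf Ωs : Set (E d)) (Tf Ts : Finset (Finset (E d))) (r : ℕ)
    (v : Finset (E d) → E d → E d) : Prop :=
  ∃ w, MemVhat0 Ωf Ωs Tf Ts r w ∧ ∀ F ∈ meshFacets Ts, ∀ᵐ x ∂(surf F), v F x = w F x

/-- `q ∈ Q_h^{r,f}`. -/
def MemQf {d : ℕ} (Tf : Finset (Finset (E d))) (r : ℕ) (q : E d → ℝ) : Prop :=
  ∀ K ∈ Tf, IsPolyOn (volume.restrict (hull K)) r q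

/-! ### The semi-discrete scheme -/

/-- `p` is the `L²(F)`-projection of `g` onto the tangential polynomial fields of degree at most
`m` on `F`. -/
def IsFacetProj {d : ℕ} (F : Finset (E d)) (m : ℕ) (g p : E d → E d) : Prop :=
  IsFacetPoly F m p ∧ ∀ q, IsFacetPoly F m q → ∫ x, inner ℝ (g x - p x) (q x) ∂(surf F) = 0

open Classical in
/-- The projection `Π_h`, facet by facet. -/
def facetProj {d : ℕ} (F : Finset (E d)) (m : ℕ) (g : E d → E d) : E d → E d :=
  if h : ∃ p, IsFacetProj F m g p then h.choose else 0

/-- `tang(w - ŵ)` on the facet `F`, seen from the element `K`. -/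
def tangJump {d : ℕ} (K F : Finset (E d)) (w : E d → E d) (what : Finset (E d) → E d → E d)
    (x : E d) : E d :=
  tang (outwardNormal K F) (traceVec K F w x - what F x)

/-- The symmetric interior penalty HDG form with projected jumps over the elements in `Th`,
with polynomial degree `k`, mesh size `h` and stabilization parameter `α`. -/
def hdgForm {d : ℕ} (Th : Finset (Finset (E d))) (k : ℕ) (α h : ℝ)
    (v : E d → E d) (vhat : Finset (E d) → E d → E d)
    (w : E d → E d) (what : Finset (E d) → E d → E d) : ℝ :=
  ∑ K ∈ Th,
    ((∫ x in openHull K, ∑ i, ∑ j, symGrad (openHull K) v i j x * symGrad (openHull K) w i j x)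
      - (∑ F ∈ facets K, ∫ x, inner ℝ (traceNormal K F (symGrad (openHull K) v) x)
          (tangJump K F w what x) ∂(surf F))
      - (∑ F ∈ facets K, ∫ x, inner ℝ (traceNormal K F (symGrad (openHull K) w) x)
          (tangJump K F v vhat x) ∂(surf F))
      + (∑ F ∈ facets K, ∫ x, α * (k : ℝ) ^ 2 / h *
          inner ℝ (facetProj F (k - 1) (tangJump K F v vhat) x)
            (facetProj F (k - 1) (tangJump K F w what) x) ∂(surf F)))

/-- The functions `(u, û, p, η, η̂)` of time satisfy, at time `t`, the three equations of the
semi-discrete HDG scheme for all discrete test functions; the time derivatives of `u`, `η` and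
`η̂` are those of curves in `L²(Ω)`, `L²(Ωs)` and `L²` of the structure skeleton. -/
def SemiDiscreteEqns {d : ℕ} (Ωf Ωs : Set (E d)) (Tf Ts : Finset (Finset (E d)))
    (k : ℕ) (α T ρf ρs μf μs lam : ℝ) (ff fs : ℝ → E d → E d)
    (u : ℝ → E d → E d) (uhat : ℝ → Finset (E d) → E d → E d) (p : ℝ → E d → ℝ)
    (η : ℝ → E d → E d) (ηhat : ℝ → Finset (E d) → E d → E d) (t : ℝ) : Prop :=
  ∃ (ut ηt : E d → E d) (ηhatt : Finset (E d) → E d → E d),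
    HasL2TimeDeriv (volume.restrict (wholeDomain Ωf Ωs)) T u ut t ∧
    HasL2TimeDeriv (volume.restrict Ωs) T η ηt t ∧
    (∀ F ∈ meshFacets Ts, HasL2TimeDeriv (surf F) T (fun s => ηhat s F) (ηhatt F) t) ∧
    (∀ v vhat q, MemV0 Ωf Ωs Tf Ts k v → MemVhat0 Ωf Ωs Tf Ts (k - 1) vhat →
      MemQf Tf (k - 1) q →
      (∫ x in wholeDomain Ωf Ωs, glue Ωf (fun _ => ρf) (fun _ => ρs) x * inner ℝ (ut x) (v x))
        + 2 * μf * hdgForm Tf k α (meshSize Tf Ts) (u t) (uhat t) v vhat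
        - (∫ x in Ωf, p t x * weakDiv Ωf v x)
        - (∫ x in Ωf, weakDiv Ωf (u t) x * q x)
        + 2 * μs * hdgForm Ts k α (meshSize Tf Ts) (η t) (ηhat t) v vhat
        + lam * (∫ x in Ωs, weakDiv Ωs (η t) x * weakDiv Ωs v x)
      = ∫ x in wholeDomain Ωf Ωs, inner ℝ (glue Ωf (ff t) (fs t) x) (v x)) ∧
    (∀ ξ, MemV0s Ωf Ωs Tf Ts k ξ → ∫ x in Ωs, inner ℝ (ηt x - u t x) (ξ x) = 0) ∧
    (∀ ξhat, MemVhat0s Ωf Ωs Tf Ts (k - 1) ξhat →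
      ∑ F ∈ meshFacets Ts, ∫ x, inner ℝ (ηhatt F x - uhat t F x) (ξhat F x) ∂(surf F) = 0)

open Classical in
/-- The trace of `w` on the skeleton of `Th`: on each facet `F`, the trace from an element
having `F` as a facet (for `H¹` fields it does not depend on the element). -/
def skeletonTrace {d : ℕ} (Th : Finset (Finset (E d))) (w : E d → E d)
    (F : Finset (E d)) : E d → E d :=
  if h : ∃ K ∈ Th, F ∈ facets K then traceVec h.choose F w else 0

end

end FSI

/-! Both momentum equations are tested with v and integrated by parts on every element K. The stress
has the form σ = q I + c S, where S is the symmetric gradient, with q = -p and c = 2μᶠ in the fluid,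
q = λˢ ∇·η and c = 2μˢ in the solid. Since S is symmetric, σ : ∇v = c S : D(v) + q ∇·v, and the
boundary term is ∫ σn · v. The trace of v is split into tang(v - v̂) and the field (v·n)n +
tang(v̂). Against the tangential jump the normal vector q n is invisible, so c Sn · tang(v - v̂)
remains, which is the consistency term of the HDG form (`element_integration_by_parts`). The
symmetrizing and stabilizing terms vanish, because û and η̂ are the traces of u and η
(`hdgForm_eq_of_jump_eq_zero`).

What is left over is the sum over all elements and facets of ∫ σn · ((v·n)n + tang(v̂)), and it
vanishes facet by facet (`IsFittedMesh.sum_skeleton_eq_zero`). The second factor is the same from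
both sides, because v in H(div) has continuous normal component and v̂ is single-valued. The first
changes sign: inside a subdomain because σ is in H¹ and the normals are opposite, on Γ by the
dynamic coupling condition. A facet of only one element lies on the exterior boundary, where the
second factor is zero.

The equations ∇·u = 0 and ∂ₜη = u hold almost everywhere and need no integration by parts. The
equation for ∂ₜη̂ holds because the trace is linear and bounded from H¹(K) to L²(F), so that it
commutes with the strong time derivative.

Most of the work supplies the analysis on simplices. Slicing K parallel to a facet F gives cone
coordinates with the opposite vertex a as apex, and with them the divergence theorem for φ(x)(x -
a). Differences of two such fields give the theorem for constant directions, and the choice φ² gives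
the trace inequality. Contraction and mollification make smooth functions dense in H¹(K), so traces
exist and Green's formula extends to H¹. Testing near a common facet then shows that H(div) fields
have no normal jump and H¹ functions no jump at all. -/

namespace FSI

noncomputable section

variable {d : ℕ} {K K' F : Finset (E d)}

/-! ### Barycentric coordinates of a simplex -/

/-- The vertices of a simplex as an affine basis. -/
def IsSimplex.basis (hK : IsSimplex K) : AffineBasis K ℝ (E d) where
  toFun := fun x => x
  ind' := hK.2
  tot' := by
    rw [hK.2.affineSpan_eq_top_iff_card_eq_finrank_add_one]
    simp [hK.1]

open Classical in
/-- The barycentric coordinate of the simplex `K` at the vertex `a`. -/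
def IsSimplex.coord (hK : IsSimplex K) (a : E d) : E d →ᵃ[ℝ] ℝ :=
  if h : a ∈ K then hK.basis.coord ⟨a, h⟩ else 0

theorem IsSimplex.coord_coe (hK : IsSimplex K) (a : K) : hK.coord a = hK.basis.coord a := by
  simp [IsSimplex.coord]

theorem IsSimplex.coord_self (hK : IsSimplex K) {a : E d} (ha : a ∈ K) : hK.coord a a = 1 := by
  rw [hK.coord_coe ⟨a, ha⟩]
  exact hK.basis.coord_apply_eq ⟨a, ha⟩

theorem IsSimplex.coord_of_ne (hK : IsSimplex K) {a b : E d} (hb : b ∈ K) (hab : a ≠ b) :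
    hK.coord a b = 0 := by
  by_cases ha : a ∈ K
  · rw [hK.coord_coe ⟨a, ha⟩]
    refine hK.basis.coord_apply_ne (i := ⟨a, ha⟩) (j := ⟨b, hb⟩) ?_
    simpa using hab
  · simp [IsSimplex.coord, ha]

theorem IsSimplex.sum_coord (hK : IsSimplex K) (x : E d) : ∑ a ∈ K, hK.coord a x = 1 := by
  rw [← Finset.sum_coe_sort K]
  simp only [hK.coord_coe]
  exact hK.basis.sum_coord_apply_eq_one x

theorem IsSimplex.sum_coord_smul (hK : IsSimplex K) (x : E d) :
    ∑ a ∈ K, hK.coord a x • a = x := by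
  rw [← Finset.sum_coe_sort K (fun a => hK.coord a x • a)]
  simp only [hK.coord_coe]
  exact hK.basis.linear_combination_coord_eq_self x

theorem affineMap_apply_sum (g : E d →ᵃ[ℝ] ℝ) (s : Finset (E d)) (w : E d → ℝ)
    (hw : ∑ a ∈ s, w a = 1) : g (∑ a ∈ s, w a • a) = ∑ a ∈ s, w a * g a := by
  have h : ∀ x, g x = g.linear x + g 0 := fun x => by
    have := g.map_vadd 0 x
    simpa using this
  rw [h, map_sum, Finset.sum_congr rfl fun a _ => congrArg (w a * ·) (h a)]
  simp only [map_smul, smul_eq_mul, mul_add, Finset.sum_add_distrib]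
  rw [← Finset.sum_mul, hw, one_mul]

/-- An affine function is determined by its values at the vertices. Distances to facets and
coordinates of adjacent simplices are compared in this way. -/
theorem IsSimplex.affineMap_apply (hK : IsSimplex K) (g : E d →ᵃ[ℝ] ℝ) (x : E d) :
    g x = ∑ a ∈ K, hK.coord a x * g a := by
  rw [← affineMap_apply_sum g K _ (hK.sum_coord x), hK.sum_coord_smul]

theorem IsSimplex.continuous_coord (hK : IsSimplex K) (a : E d) : Continuous (hK.coord a) :=
  (hK.coord a).continuous_of_finiteDimensional

theorem IsSimplex.range_basis (hK : IsSimplex K) : range hK.basis = (K : Set (E d)) := by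
  ext x
  simp only [mem_range, Finset.mem_coe]
  exact ⟨fun ⟨y, hy⟩ => hy ▸ y.2, fun hx => ⟨⟨x, hx⟩, rfl⟩⟩

theorem IsSimplex.mem_hull_iff (hK : IsSimplex K) {x : E d} :
    x ∈ hull K ↔ ∀ a ∈ K, 0 ≤ hK.coord a x := by
  rw [hull, ← hK.range_basis, hK.basis.convexHull_eq_nonneg_coord]
  simp only [mem_ofPred_eq, Subtype.forall]
  exact forall₂_congr fun a ha => by rw [hK.coord_coe ⟨a, ha⟩]

theorem IsSimplex.mem_openHull_iff (hK : IsSimplex K) {x : E d} :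
    x ∈ openHull K ↔ ∀ a ∈ K, 0 < hK.coord a x := by
  rw [openHull, hull, ← hK.range_basis, hK.basis.interior_convexHull]
  simp only [mem_ofPred_eq, Subtype.forall]
  exact forall₂_congr fun a ha => by rw [hK.coord_coe ⟨a, ha⟩]

/-- Faces are cut out by the vanishing of the coordinates at the missing vertices: the remaining
coordinates still sum to one and write x as a convex combination. Combined with conformity of the
mesh this decides which elements can share a point. -/
theorem IsSimplex.mem_convexHull_iff (hK : IsSimplex K) {S : Set (E d)} (hS : S ⊆ K) {x : E d} :
    x ∈ convexHull ℝ S ↔ x ∈ hull K ∧ ∀ a ∈ K, a ∉ S → hK.coord a x = 0 := by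
  constructor
  · intro hx
    refine ⟨convexHull_mono hS hx, fun a _ haS => ?_⟩
    have : convexHull ℝ S ⊆ (hK.coord a) ⁻¹' {0} := by
      refine convexHull_min (fun b hb => hK.coord_of_ne (hS hb) ?_)
        ((convex_singleton 0).affine_preimage _)
      rintro rfl
      exact haS hb
    exact this hx
  · rintro ⟨hx, h0⟩
    classical
    have h1 := hK.sum_coord x
    have h2 := hK.sum_coord_smul x
    rw [← Finset.sum_filter_of_ne (p := fun a => a ∈ S)
      (fun a ha hne => by_contra fun h => hne (h0 a ha h))] at h1
    rw [← Finset.sum_filter_of_ne (p := fun a => a ∈ S)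
      (fun a ha hne => by_contra fun h => hne (by rw [h0 a ha h, zero_smul]))] at h2
    rw [← h2]
    refine (convex_convexHull ℝ S).sum_mem (fun a ha => ?_) h1 fun a ha => ?_
    · exact hK.mem_hull_iff.1 hx a (Finset.mem_filter.1 ha).1
    · exact subset_convexHull ℝ S (Finset.mem_filter.1 ha).2

theorem isCompact_hull (K : Finset (E d)) : IsCompact (hull K) :=
  K.finite_toSet.isCompact_convexHull (𝕜 := ℝ)

theorem isClosed_hull (K : Finset (E d)) : IsClosed (hull K) := (isCompact_hull K).isClosed

theorem convex_hull (K : Finset (E d)) : Convex ℝ (hull K) := convex_convexHull ℝ _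

theorem isOpen_openHull (K : Finset (E d)) : IsOpen (openHull K) := isOpen_interior

theorem openHull_subset_hull (K : Finset (E d)) : openHull K ⊆ hull K := interior_subset

/-- The frontier of a convex set is a null set, so volume integrals do not distinguish open from
closed simplices. -/
theorem openHull_ae_eq_hull (K : Finset (E d)) : openHull K =ᵐ[volume] hull K :=
  interior_ae_eq_of_null_frontier ((convex_hull K).addHaar_frontier _)

theorem restrict_openHull (K : Finset (E d)) :
    volume.restrict (openHull K) = volume.restrict (hull K) :=
  Measure.restrict_congr_set (openHull_ae_eq_hull K)

instance isFiniteMeasure_restrict_hull (K : Finset (E d)) :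
    IsFiniteMeasure (volume.restrict (hull K)) :=
  ⟨by simpa using (isCompact_hull K).measure_lt_top⟩

instance isFiniteMeasure_restrict_openHull (K : Finset (E d)) :
    IsFiniteMeasure (volume.restrict (openHull K)) := by
  rw [restrict_openHull]
  infer_instance

theorem IsSimplex.nonempty (hK : IsSimplex K) : K.Nonempty :=
  Finset.card_pos.1 (by rw [hK.1]; omega)

theorem IsSimplex.openHull_nonempty (hK : IsSimplex K) : (openHull K).Nonempty := by
  have := hK.basis.centroid_mem_interior_convexHull
  rw [hK.range_basis] at this
  exact ⟨_, this⟩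

/-! ### Facets and their outward normals -/

theorem IsSimplex.exists_opposite (hK : IsSimplex K) (hF : F ∈ facets K) :
    ∃ a ∈ K, a ∉ F ∧ F ⊆ K ∧ ∀ b ∈ K, b ≠ a → b ∈ F := by
  classical
  obtain ⟨hFK, hc⟩ := Finset.mem_powersetCard.1 hF
  have h1 : (K \ F).card = 1 := by
    rw [Finset.card_sdiff_of_subset hFK, hc, hK.1]; omega
  obtain ⟨a, ha⟩ := Finset.card_eq_one.1 h1
  have ha' : a ∈ K \ F := by simp [ha]
  refine ⟨a, (Finset.mem_sdiff.1 ha').1, (Finset.mem_sdiff.1 ha').2, hFK, fun b hb hba => ?_⟩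
  by_contra hbF
  have : b ∈ K \ F := Finset.mem_sdiff.2 ⟨hb, hbF⟩
  rw [ha] at this
  exact hba (Finset.mem_singleton.1 this)

/-- `a` is the vertex of the simplex `K` opposite to the facet `F`. -/
structure IsOpposite (K F : Finset (E d)) (a : E d) : Prop where
  mem : a ∈ K
  notMem : a ∉ F
  subset : F ⊆ K
  mem_of_ne : ∀ b ∈ K, b ≠ a → b ∈ F

theorem IsSimplex.exists_isOpposite (hK : IsSimplex K) (hF : F ∈ facets K) :
    ∃ a, IsOpposite K F a := by
  obtain ⟨a, h1, h2, h3, h4⟩ := hK.exists_opposite hF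
  exact ⟨a, h1, h2, h3, h4⟩

theorem IsOpposite.ne_of_mem {a b : E d} (h : IsOpposite K F a) (hb : b ∈ F) : a ≠ b := by
  rintro rfl
  exact h.notMem hb

theorem IsOpposite.mem_hull_iff {a x : E d} (h : IsOpposite K F a) (hK : IsSimplex K) :
    x ∈ hull F ↔ x ∈ hull K ∧ hK.coord a x = 0 := by
  rw [hull, hK.mem_convexHull_iff (Finset.coe_subset.2 h.subset)]
  refine and_congr_right fun _ => ⟨fun h0 => h0 a h.mem h.notMem, fun h0 b hb hbF => ?_⟩
  by_cases hba : b = a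
  · rwa [hba]
  · exact absurd (h.mem_of_ne b hb hba) hbF

theorem facets_card_pos (hd : 0 < d) (hF : F ∈ facets K) : F.Nonempty :=
  Finset.card_pos.1 (by rw [(Finset.mem_powersetCard.1 hF).2]; exact hd)

theorem sum_eq_insert {a : E d} {M : Type*} [AddCommMonoid M] (h : IsOpposite K F a)
    (f : E d → M) : ∑ b ∈ K, f b = f a + ∑ b ∈ F, f b := by
  classical
  have : K = insert a F := by
    ext b
    rw [Finset.mem_insert]
    constructor
    · intro hb
      by_cases hba : b = a
      · exact Or.inl hba
      · exact Or.inr (h.mem_of_ne b hb hba)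
    · rintro (rfl | hb)
      · exact h.mem
      · exact h.subset hb
  rw [this, Finset.sum_insert h.notMem]

theorem centroid_eq_smul_sum {s : Finset (E d)} (hs : s.Nonempty) :
    s.centroid ℝ id = (s.card : ℝ)⁻¹ • ∑ b ∈ s, b := by
  have h : (s.card : ℝ) ≠ 0 := by exact_mod_cast (Finset.card_pos.2 hs).ne'
  rw [Finset.centroid_def, Finset.affineCombination_eq_linear_combination _ _ _
    (Finset.sum_centroidWeights_eq_one_of_cast_card_ne_zero s h)]
  simp [Finset.centroidWeights_apply, Finset.smul_sum]

/-- The centroid of K is the weighted mean (d c + a)/(d + 1) of the centroid c of F and the opposite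
vertex a. The vector that defines the outward normal is thus a positive multiple of c - a. -/
theorem centroid_facet_sub_centroid (hd : 0 < d) (hK : IsSimplex K) (hF : F ∈ facets K) {a : E d}
    (ha : IsOpposite K F a) :
    F.centroid ℝ id - K.centroid ℝ id = ((d : ℝ) + 1)⁻¹ • (F.centroid ℝ id - a) := by
  have hFc : F.card = d := (Finset.mem_powersetCard.1 hF).2
  have hd' : (d : ℝ) ≠ 0 := by positivity
  have hd1 : (d : ℝ) + 1 ≠ 0 := by positivity
  rw [centroid_eq_smul_sum hK.nonempty, centroid_eq_smul_sum (facets_card_pos hd hF),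
    sum_eq_insert ha (fun b => b), hK.1, hFc]
  push_cast
  match_scalars <;> field_simp
  ring

/-- The distance of the vertex opposite to the facet `F` to the plane of `F`. -/
theorem exists_height (hd : 0 < d) (hK : IsSimplex K) (hF : F ∈ facets K) {a : E d}
    (ha : IsOpposite K F a) :
    ∃ h : ℝ, 0 < h ∧ ‖outwardNormal K F‖ = 1 ∧
      ∀ b ∈ F, ⟪outwardNormal K F, b - a⟫ = h := by
  set V := (vectorSpan ℝ (F : Set (E d))) with hV
  set c := F.centroid ℝ id with hc
  set w := Vᗮ.starProjection (c - a) with hw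
  have hFne := facets_card_pos hd hF
  have hsub : ∀ b ∈ F, c - b ∈ V := fun b hb => by
    have h0 : (F.card : ℝ) ≠ 0 := by exact_mod_cast (Finset.card_pos.2 hFne).ne'
    have h1 : c - b = (F.card : ℝ)⁻¹ • ∑ b' ∈ F, (b' - b) := by
      rw [hc, centroid_eq_smul_sum hFne, Finset.sum_sub_distrib, Finset.sum_const, smul_sub,
        ← Nat.cast_smul_eq_nsmul ℝ, smul_smul, inv_mul_cancel₀ h0, one_smul]
    rw [h1]
    exact V.smul_mem _ (V.sum_mem fun b' hb' => vsub_mem_vectorSpan ℝ hb' hb)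
  -- If w = 0, then c - a, and with it b - a for b ∈ F, lies in the direction of F. The linear part
  -- of the coordinate at a vanishes there, yet this coordinate is 1 at a and 0 at b.
  have hw0 : w ≠ 0 := by
    intro h0
    have h1 : c - a ∈ V := by
      have := Submodule.starProjection_orthogonal_val (K := V) (c - a)
      rw [← hw, h0, eq_comm, sub_eq_zero] at this
      rw [this]
      exact Submodule.starProjection_apply_mem _ _
    have h2 : V ≤ LinearMap.ker (hK.coord a).linear := by
      rw [hV, vectorSpan_def, Submodule.span_le]
      rintro _ ⟨x, hx, y, hy, rfl⟩
      rw [SetLike.mem_coe, LinearMap.mem_ker]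
      refine ((hK.coord a).linearMap_vsub x y).trans ?_
      rw [hK.coord_of_ne (ha.subset hx) (ha.ne_of_mem hx),
        hK.coord_of_ne (ha.subset hy) (ha.ne_of_mem hy), vsub_self]
    obtain ⟨b, hb⟩ := hFne
    have h3 := sub_mem h1 (hsub b hb)
    have h4 := h2 h3
    rw [sub_sub_sub_cancel_left, LinearMap.mem_ker, ← vsub_eq_sub, AffineMap.linearMap_vsub,
      hK.coord_self ha.mem, hK.coord_of_ne (ha.subset hb) (ha.ne_of_mem hb)] at h4
    norm_num at h4
  have hw' : Vᗮ.starProjection (c - K.centroid ℝ id) = ((d : ℝ) + 1)⁻¹ • w := by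
    rw [hc, centroid_facet_sub_centroid hd hK hF ha, map_smul]
  have hn : outwardNormal K F = ‖w‖⁻¹ • w := by
    change ‖Vᗮ.starProjection (c - K.centroid ℝ id)‖⁻¹ • Vᗮ.starProjection (c - K.centroid ℝ id) = _
    rw [hw', norm_smul, smul_smul, mul_inv, norm_inv, inv_inv, mul_right_comm,
      Real.norm_of_nonneg (by positivity), mul_inv_cancel₀ (by positivity), one_mul]
  have hwn : 0 < ‖w‖ := norm_pos_iff.2 hw0
  -- The height is the length of the part w of c - a orthogonal to F; replacing c by another point
  -- of F does not change this part.
  refine ⟨‖w‖, hwn, ?_, fun b hb => ?_⟩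
  · rw [hn, norm_smul, norm_inv, norm_norm, inv_mul_cancel₀ hwn.ne']
  · have hwV : w ∈ Vᗮ := Submodule.starProjection_apply_mem _ _
    have h1 : ⟪w, c - b⟫ = 0 := by
      rw [real_inner_comm]
      exact hwV _ (hsub b hb)
    have h2 : ⟪w, c - a⟫ = ‖w‖ ^ 2 := by
      have : (c - a) - w ∈ V := by
        rw [hw, Submodule.starProjection_orthogonal_val]
        simpa using Submodule.starProjection_apply_mem V (c - a)
      have h3 : ⟪w, (c - a) - w⟫ = 0 := by
        rw [real_inner_comm]
        exact hwV _ this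
      rw [inner_sub_right, real_inner_self_eq_norm_sq] at h3
      linarith
    have h3 : b - a = (c - a) - (c - b) := by abel
    rw [hn, inner_smul_left, h3, inner_sub_right, h1, h2]
    simp
    field_simp

/-- The affine function `x ↦ ⟪n, x - a⟫`. -/
def innerAffine (n a : E d) : E d →ᵃ[ℝ] ℝ :=
  (innerSL ℝ n).toLinearMap.toAffineMap - AffineMap.const ℝ (E d) ⟪n, a⟫

theorem innerAffine_apply (n a x : E d) : innerAffine n a x = ⟪n, x - a⟫ := by
  simp [innerAffine, inner_sub_right]

/-- Both sides are affine in x, are 0 at a and equal h at the vertices of F. -/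
theorem inner_outwardNormal_sub (hK : IsSimplex K) {a : E d}
    (ha : IsOpposite K F a) {h : ℝ} {n : E d} (hn : ∀ b ∈ F, ⟪n, b - a⟫ = h) (x : E d) :
    ⟪n, x - a⟫ = h * (1 - hK.coord a x) := by
  have h1 := hK.affineMap_apply (innerAffine n a) x
  simp only [innerAffine_apply] at h1
  rw [h1, ← hK.sum_coord x, sum_eq_insert ha, sum_eq_insert ha]
  simp only [sub_self, inner_zero_right, mul_zero, zero_add, add_sub_cancel_left]
  rw [Finset.mul_sum]
  exact Finset.sum_congr rfl fun b hb => by rw [hn b hb, mul_comm]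

end

end FSI

namespace FSI

noncomputable section

variable {d : ℕ} {K K' F : Finset (E d)}

/-! ### Integration over a simplex in cone coordinates -/

/-- The point at parameter `s` on the segment from `a` to `y`. -/
def conePoint (a : E d) (s : ℝ) (y : E d) : E d := AffineMap.lineMap a y s

theorem conePoint_eq (a : E d) (s : ℝ) (y : E d) : conePoint a s y = a + s • (y - a) := by
  simp [conePoint, AffineMap.lineMap_apply, add_comm]

theorem continuous_conePoint (a : E d) : Continuous (fun p : ℝ × E d => conePoint a p.1 p.2) := by
  simp only [conePoint_eq]
  fun_prop

theorem IsSimplex.coord_conePoint (hK : IsSimplex K) (a b : E d) (s : ℝ) (y : E d) :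
    hK.coord b (conePoint a s y) = (1 - s) * hK.coord b a + s * hK.coord b y := by
  rw [conePoint, AffineMap.apply_lineMap, AffineMap.lineMap_apply_ring]

theorem conePoint_mem_hull {a : E d} (ha : IsOpposite K F a) {s : ℝ}
    (hs : s ∈ Icc (0 : ℝ) 1) {y : E d} (hy : y ∈ hull F) : conePoint a s y ∈ hull K := by
  rw [conePoint_eq]
  have h1 : a ∈ hull K := subset_convexHull ℝ _ ha.mem
  have h2 : y ∈ hull K := convexHull_mono (Finset.coe_subset.2 ha.subset) hy
  exact (convex_hull K).add_smul_sub_mem h1 h2 hs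

/-- The slices of K parallel to F are scaled copies of F with centre a, which is what makes cone
coordinates work. -/
theorem level_eq_image {a : E d} (ha : IsOpposite K F a) (hK : IsSimplex K) {s : ℝ}
    (hs : s ∈ Ioc (0 : ℝ) 1) :
    {z | z ∈ hull K ∧ hK.coord a z = 1 - s} = AffineMap.homothety a s '' hull F := by
  have hs0 : s ≠ 0 := hs.1.ne'
  ext z
  simp only [mem_ofPred_eq, mem_image, AffineMap.homothety_eq_lineMap]
  constructor
  · rintro ⟨hz, hc⟩
    -- The inverse homothety brings the coordinate at a to 0 and divides the other ones by s > 0, so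
    -- it maps z into F.
    refine ⟨conePoint a s⁻¹ z, ?_, ?_⟩
    · rw [ha.mem_hull_iff hK, hK.mem_hull_iff]
      have h0 : hK.coord a (conePoint a s⁻¹ z) = 0 := by
        rw [hK.coord_conePoint, hK.coord_self ha.mem, hc]
        field_simp
        ring
      refine ⟨fun b hb => ?_, h0⟩
      by_cases hba : b = a
      · rw [hba, h0]
      · rw [hK.coord_conePoint, hK.coord_of_ne ha.mem hba, mul_zero, zero_add]
        exact mul_nonneg (inv_nonneg.2 hs.1.le) (hK.mem_hull_iff.1 hz b hb)
    · change conePoint a s _ = z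
      rw [conePoint_eq, conePoint_eq, add_sub_cancel_left, smul_smul, mul_inv_cancel₀ hs0, one_smul,
        add_sub_cancel]
  · rintro ⟨y, hy, rfl⟩
    change conePoint a s y ∈ _ ∧ hK.coord a (conePoint a s y) = _
    refine ⟨conePoint_mem_hull ha ⟨hs.1.le, hs.2⟩ hy, ?_⟩
    rw [hK.coord_conePoint, hK.coord_self ha.mem, ((ha.mem_hull_iff hK).1 hy).2]
    ring

theorem measurableSet_hull (F : Finset (E d)) : MeasurableSet (hull F) :=
  (isClosed_hull F).measurableSet

/-- A homothety of ratio s multiplies (d-1)-dimensional measure by |s| ^ (d - 1), the source of the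
weight in cone coordinates. -/
theorem surf_preimage_conePoint (a : E d) {s : ℝ} (hs : s ≠ 0) {t : Set (E d)}
    (ht : MeasurableSet t) :
    (Measure.euclideanHausdorffMeasure (d - 1) : Measure (E d))
      (t ∩ AffineMap.homothety a s '' hull F) =
      ENNReal.ofReal (|s| ^ (d - 1)) * surf F (conePoint a s ⁻¹' t) := by
  have h1 : t ∩ AffineMap.homothety a s '' hull F =
      AffineMap.homothety a s '' (conePoint a s ⁻¹' t ∩ hull F) := by
    ext z
    simp only [mem_inter_iff, mem_image, mem_preimage, AffineMap.homothety_eq_lineMap, conePoint]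
    constructor
    · rintro ⟨h, y, hy, rfl⟩
      exact ⟨y, ⟨h, hy⟩, rfl⟩
    · rintro ⟨y, ⟨h, hy⟩, rfl⟩
      exact ⟨h, y, hy, rfl⟩
  have h2 : MeasurableSet (conePoint a s ⁻¹' t) :=
    ((continuous_conePoint a).comp (Continuous.prodMk_right s)).measurable ht
  rw [h1, euclideanHausdorffMeasure_homothety_image _ _ hs, surf, Measure.restrict_apply h2,
    ENNReal.smul_def, smul_eq_mul]
  congr 1
  rw [ENNReal.ofReal, Real.toNNReal_pow (abs_nonneg s), ← Real.norm_eq_abs]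
  norm_cast
  rw [norm_toNNReal]

/-- Translates the hyperplanes orthogonal to h • n of the slicing formula into level sets of a
barycentric coordinate. -/
theorem mem_level_iff {a : E d} (ha : IsOpposite K F a) (hK : IsSimplex K) {n : E d} {h : ℝ}
    (hh : 0 < h) (hn1 : ‖n‖ = 1) (hn : ∀ b ∈ F, ⟪n, b - a⟫ = h) (s : ℝ) (z : E d) :
    z ∈ AffineSubspace.mk' (s • (h • n) +ᵥ a) (Submodule.span ℝ {h • n})ᗮ ↔
      hK.coord a z = 1 - s := by
  rw [AffineSubspace.mem_mk', Submodule.mem_orthogonal_singleton_iff_inner_right, vadd_eq_add,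
    vsub_eq_sub, ← sub_sub, sub_right_comm, inner_sub_right, inner_smul_left,
    inner_outwardNormal_sub hK ha hn, inner_smul_right, inner_smul_left, inner_smul_right,
    real_inner_self_eq_norm_sq, hn1]
  simp only [conj_trivial]
  constructor
  · intro h0
    have : h * h * (1 - hK.coord a z - s) = 0 := by linarith
    have := (mul_eq_zero.1 this).resolve_left (by positivity)
    linarith
  · intro h0
    rw [h0]
    ring

/-- Fubini along the normal direction: the slice at parameter s is the copy of F of ratio s, and
stepping by h • n contributes the factor h. -/
theorem volume_inter_hull (hK : IsSimplex K) {a : E d}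
    (ha : IsOpposite K F a) {n : E d} {h : ℝ} (hh : 0 < h) (hn1 : ‖n‖ = 1)
    (hn : ∀ b ∈ F, ⟪n, b - a⟫ = h) {t : Set (E d)} (ht : MeasurableSet t) :
    volume (t ∩ hull K) = ENNReal.ofReal h * ∫⁻ s in Ioc (0 : ℝ) 1,
      ENNReal.ofReal (s ^ (d - 1)) * surf F (conePoint a s ⁻¹' t) := by
  have hv : h • n ≠ 0 := by
    intro h0
    have := congrArg norm h0
    rw [norm_smul, hn1, norm_zero, mul_one, Real.norm_of_nonneg hh.le] at this
    exact hh.ne' this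
  have h1 := EuclideanGeometry.euclideanHausdorffMeasure_eq_lintegral a hv
    (ht.inter (measurableSet_hull K))
  rw [InnerProductSpace.euclideanHausdorffMeasure_eq_volume, finrank_euclideanSpace_fin] at h1
  rw [h1]
  congr 1
  · rw [← ofReal_norm, norm_smul, hn1, mul_one, Real.norm_of_nonneg hh.le]
  · rw [← lintegral_indicator measurableSet_Ioc]
    refine lintegral_congr_ae ?_
    -- The slice s = 0 is the apex, where the homothety is not invertible; this single parameter is
    -- discarded as a null set.
    filter_upwards [compl_mem_ae_iff.2 (measure_singleton (0 : ℝ))] with s hs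
    have hset : t ∩ hull K ∩ (AffineSubspace.mk' (s • (h • n) +ᵥ a)
        (Submodule.span ℝ {h • n})ᗮ : Set (E d)) =
        t ∩ {z | z ∈ hull K ∧ hK.coord a z = 1 - s} := by
      ext z
      simp only [mem_inter_iff, SetLike.mem_coe, mem_level_iff ha hK hh hn1 hn, mem_ofPred_eq,
        and_assoc]
    rw [hset]
    by_cases hs1 : s ∈ Ioc (0 : ℝ) 1
    · rw [indicator_of_mem hs1, level_eq_image ha hK hs1, surf_preimage_conePoint a hs ht,
        abs_of_pos hs1.1]
    -- On K the coordinate at a has values in [0, 1], so there is no slice for the other parameters.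
    · rw [indicator_of_notMem hs1]
      have : {z | z ∈ hull K ∧ hK.coord a z = 1 - s} = ∅ := by
        ext z
        simp only [mem_ofPred_eq, mem_empty_iff_false, iff_false, not_and]
        intro hz hc
        have h0 := hK.mem_hull_iff.1 hz a ha.mem
        have h2 : hK.coord a z ≤ 1 := by
          rw [← hK.sum_coord z]
          exact Finset.single_le_sum (f := fun b => hK.coord b z)
            (fun b hb => hK.mem_hull_iff.1 hz b hb) ha.mem
        have hs' : s ≠ 0 := hs
        apply hs1
        exact ⟨lt_of_le_of_ne (by linarith) hs'.symm, by linarith⟩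
      rw [this, inter_empty, measure_empty]

/-- For sets that are cones over a part of the facet, volume and surface measure differ by a
positive finite factor. Finiteness and nullity on the facet are thus read off from volume. -/
theorem exists_eq_mul_of_eq_lintegral_cone {c : ENNReal} {m : ℕ} {A : ENNReal} {h : ℝ} (hh : 0 < h)
    (hc : c = ENNReal.ofReal h * ∫⁻ s in Ioc (0 : ℝ) 1, ENNReal.ofReal (s ^ m) * A) :
    ∃ r : ENNReal, r ≠ 0 ∧ r ≠ ⊤ ∧ c = r * A := by
  have hm : Measurable fun s : ℝ => ENNReal.ofReal (s ^ m) := by fun_prop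
  rw [lintegral_mul_const _ hm, ← mul_assoc] at hc
  refine ⟨_, ?_, ?_, hc⟩
  · refine mul_ne_zero (by simpa using hh) ?_
    rw [← ofReal_integral_eq_lintegral_ofReal, ← intervalIntegral.integral_of_le zero_le_one,
      integral_pow]
    · simp only [one_pow, ne_eq, Nat.add_eq_zero_iff, one_ne_zero, and_false, not_false_eq_true,
        zero_pow, sub_zero, ENNReal.ofReal_eq_zero, not_le]
      positivity
    · exact (Continuous.integrableOn_Icc (by fun_prop)).mono_set Ioc_subset_Icc_self
    · filter_upwards [ae_restrict_mem measurableSet_Ioc] with s hs using pow_nonneg hs.1.le m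
  · refine ENNReal.mul_ne_top ENNReal.ofReal_ne_top ?_
    have : (∫⁻ s in Ioc (0 : ℝ) 1, ENNReal.ofReal (s ^ m)) ≤ ∫⁻ s in Ioc (0 : ℝ) 1, 1 := by
      refine setLIntegral_mono measurable_const fun s hs => ?_
      rw [ENNReal.ofReal_le_one]
      exact pow_le_one₀ hs.1.le hs.2
    refine ne_top_of_le_ne_top ?_ this
    simp

theorem surf_lt_top (hd : 0 < d) (hK : IsSimplex K) (hF : F ∈ facets K) : surf F univ < ⊤ := by
  obtain ⟨a, ha⟩ := hK.exists_isOpposite hF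
  obtain ⟨h, hh, hn1, hn⟩ := exists_height hd hK hF ha
  have h1 := volume_inter_hull hK ha hh hn1 hn MeasurableSet.univ
  simp only [preimage_univ, univ_inter] at h1
  obtain ⟨r, hr0, -, hr⟩ := exists_eq_mul_of_eq_lintegral_cone hh h1
  have h2 := (isCompact_hull K).measure_lt_top (μ := volume)
  rw [hr] at h2
  by_contra h3
  rw [not_lt, top_le_iff] at h3
  rw [h3, ENNReal.mul_top hr0] at h2
  exact lt_irrefl _ h2

theorem isFiniteMeasure_surf (hd : 0 < d) (hK : IsSimplex K) (hF : F ∈ facets K) :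
    IsFiniteMeasure (surf F) := ⟨surf_lt_top hd hK hF⟩

theorem IsSimplex.volume_coord_eq_zero (hK : IsSimplex K) {f : E d} (hf : f ∈ K) :
    volume {x | hK.coord f x = 0} = 0 := by
  have h1 : {x | hK.coord f x = 0} =
      (((AffineSubspace.mk' (0:ℝ) ⊥).comap (hK.coord f) : AffineSubspace ℝ (E d)) :
        Set (E d)) := by
    ext x
    simp
  rw [h1]
  refine Measure.addHaar_affineSubspace _ _ fun htop => ?_
  have : f ∈ (AffineSubspace.mk' (0:ℝ) ⊥).comap (hK.coord f) := by rw [htop]; trivial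
  simp [hK.coord_self hf] at this

/-- Almost all points of a facet have positive barycentric coordinates. -/
theorem ae_surf_coord_pos (hd : 0 < d) (hK : IsSimplex K) (hF : F ∈ facets K) :
    ∀ᵐ x ∂(surf F), ∀ f ∈ F, 0 < hK.coord f x := by
  obtain ⟨a, ha⟩ := hK.exists_isOpposite hF
  obtain ⟨h, hh, hn1, hn⟩ := exists_height hd hK hF ha
  rw [Finset.eventually_all]
  intro f hf
  have haf := ha.ne_of_mem hf
  set t : Set (E d) := {x | hK.coord f x = 0} with ht
  have htm : MeasurableSet t :=
    (isClosed_eq (hK.continuous_coord f) continuous_const).measurableSet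
  have h1 := volume_inter_hull hK ha hh hn1 hn htm
  have h2 : volume (t ∩ hull K) = 0 :=
    measure_mono_null inter_subset_left (hK.volume_coord_eq_zero (ha.subset hf))
  -- The coordinate at f vanishes at the apex a, so its zero set is a cone with apex a. As a
  -- hyperplane it has volume zero, which forces its part in F to be a surface null set.
  have h3 : ∀ s ∈ Ioc (0 : ℝ) 1, conePoint a s ⁻¹' t = t := fun s hs => by
    ext y
    simp only [ht, mem_preimage, mem_ofPred_eq, hK.coord_conePoint,
      hK.coord_of_ne ha.mem haf.symm, mul_zero, zero_add, mul_eq_zero, hs.1.ne', false_or]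
  rw [setLIntegral_congr_fun (g := fun s => ENNReal.ofReal (s ^ (d - 1)) * surf F t)
    measurableSet_Ioc (fun s hs => by simp only [h3 s hs])] at h1
  obtain ⟨r, hr0, -, hr⟩ := exists_eq_mul_of_eq_lintegral_cone hh h1
  rw [h2, eq_comm, mul_eq_zero] at hr
  have h4 : surf F t = 0 := hr.resolve_left hr0
  have h5 : ∀ᵐ x ∂(surf F), x ∈ hull F := ae_restrict_mem (measurableSet_hull F)
  filter_upwards [compl_mem_ae_iff.2 h4, h5] with x hx hxF
  have hxK : x ∈ hull K := ((ha.mem_hull_iff hK).1 hxF).1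
  exact lt_of_le_of_ne (hK.mem_hull_iff.1 hxK f (ha.subset hf)) (fun h0 => hx h0.symm)

/-- The weight of the parameter in cone coordinates. -/
def coneWeight (d : ℕ) (h : ℝ) : Measure ℝ :=
  (volume.restrict (Ioc (0 : ℝ) 1)).withDensity fun s => ENNReal.ofReal (h * s ^ (d - 1))

instance (d : ℕ) (h : ℝ) : SFinite (coneWeight d h) := by
  unfold coneWeight
  infer_instance

/-- The slicing formula read as an identity of measures, so that integrals over K become iterated
integrals over the rays from a and over F. -/
theorem restrict_hull_eq_map (hd : 0 < d) (hK : IsSimplex K) (hF : F ∈ facets K) {a : E d}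
    (ha : IsOpposite K F a) {n : E d} {h : ℝ} (hh : 0 < h) (hn1 : ‖n‖ = 1)
    (hn : ∀ b ∈ F, ⟪n, b - a⟫ = h) :
    volume.restrict (hull K) =
      ((coneWeight d h).prod (surf F)).map (fun p : ℝ × E d => conePoint a p.1 p.2) := by
  have := isFiniteMeasure_surf hd hK hF
  have hmeas := (continuous_conePoint a).measurable
  ext t ht
  rw [Measure.restrict_apply ht, Measure.map_apply hmeas ht, Measure.prod_apply (hmeas ht),
    volume_inter_hull hK ha hh hn1 hn ht, coneWeight, lintegral_withDensity_eq_lintegral_mul _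
      (by fun_prop) (measurable_measure_prodMk_left (hmeas ht)),
    ← lintegral_const_mul']
  · refine setLIntegral_congr_fun measurableSet_Ioc fun s hs => ?_
    simp only [Pi.mul_apply]
    rw [ENNReal.ofReal_mul hh.le, mul_assoc]
    rfl
  · exact ENNReal.ofReal_ne_top

end

end FSI

namespace FSI

noncomputable section

variable {d : ℕ} {K K' F : Finset (E d)}

/-! ### The divergence theorem on a simplex -/

theorem integral_coneWeight {h : ℝ} (hh : 0 < h) (g : ℝ → ℝ) :
    ∫ s, g s ∂(coneWeight d h) = ∫ s in (0 : ℝ)..1, h * s ^ (d - 1) * g s := by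
  rw [coneWeight, integral_withDensity_eq_integral_toReal_smul (by fun_prop) (by simp),
    intervalIntegral.integral_of_le zero_le_one]
  refine setIntegral_congr_fun measurableSet_Ioc fun s hs => ?_
  simp only [smul_eq_mul]
  rw [ENNReal.toReal_ofReal (mul_nonneg hh.le (pow_nonneg hs.1.le _))]

/-- The integrand is the derivative of h s^d φ(a + s(y - a)). By the fundamental theorem of calculus
only the value at s = 1 counts, since s^d vanishes at 0 for d > 0. -/
theorem integral_cone_line (hd : 0 < d) {φ : E d → ℝ} (hφ : ContDiff ℝ 1 φ) (a y : E d) (h : ℝ) :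
    ∫ s in (0 : ℝ)..1, h * s ^ (d - 1) *
      (d * φ (conePoint a s y) + fderiv ℝ φ (conePoint a s y) (conePoint a s y - a)) =
      h * φ y := by
  have hd' : ∀ s : ℝ, HasDerivAt (fun s => h * (s ^ d * φ (conePoint a s y)))
      (h * s ^ (d - 1) *
        (d * φ (conePoint a s y) + fderiv ℝ φ (conePoint a s y) (conePoint a s y - a))) s := by
    intro s
    have h1 : HasDerivAt (fun s => conePoint a s y) (y - a) s := by
      simp only [conePoint_eq]
      simpa using ((hasDerivAt_id s).smul_const (y - a)).const_add a
    have h2 : HasDerivAt (fun s => φ (conePoint a s y))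
        (fderiv ℝ φ (conePoint a s y) (y - a)) s :=
      ((hφ.differentiable one_ne_zero) _).hasFDerivAt.comp_hasDerivAt s h1
    have h3 := ((hasDerivAt_pow d s).mul h2).const_mul h
    have h4 : conePoint a s y - a = s • (y - a) := by rw [conePoint_eq]; simp
    have h5 : s ^ d = s ^ (d - 1) * s := by rw [← pow_succ, Nat.sub_add_cancel hd]
    refine h3.congr_deriv ?_
    rw [h4, map_smul, smul_eq_mul, h5]
    ring
  rw [intervalIntegral.integral_eq_sub_of_hasDerivAt (fun s _ => hd' s)]
  · simp [conePoint_eq, hd.ne']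
  · have hc : Continuous fun s : ℝ => conePoint a s y := by
      simp only [conePoint_eq]; fun_prop
    have hf := hφ.continuous_fderiv one_ne_zero
    have hφc := hφ.continuous
    refine Continuous.intervalIntegrable ?_ _ _
    have h4 : Continuous fun s : ℝ => fderiv ℝ φ (conePoint a s y) (conePoint a s y - a) :=
      (hf.comp hc).clm_apply (hc.sub continuous_const)
    have h5 : Continuous fun s : ℝ => φ (conePoint a s y) := hφc.comp hc
    fun_prop

theorem integrableOn_hull {g : E d → ℝ} (hg : Continuous g) (K : Finset (E d)) :
    IntegrableOn g (hull K) := hg.continuousOn.integrableOn_compact (isCompact_hull K)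

/-- The divergence theorem for the radial field `(x - a) φ` on a simplex with vertex `a`. -/
theorem integral_radial (hd : 0 < d) (hK : IsSimplex K) (hF : F ∈ facets K) {a : E d}
    (ha : IsOpposite K F a) {h : ℝ} (hh : 0 < h) (hn1 : ‖outwardNormal K F‖ = 1)
    (hn : ∀ b ∈ F, ⟪outwardNormal K F, b - a⟫ = h) {φ : E d → ℝ} (hφ : ContDiff ℝ 1 φ) :
    ∫ x in hull K, (d * φ x + fderiv ℝ φ x (x - a)) = h * ∫ x, φ x ∂(surf F) := by
  have := isFiniteMeasure_surf hd hK hF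
  have hmeas := (continuous_conePoint a).measurable
  have hc : Continuous fun x => d * φ x + fderiv ℝ φ x (x - a) := by
    have h1 := hφ.continuous
    have h2 : Continuous fun x => fderiv ℝ φ x (x - a) :=
      (hφ.continuous_fderiv one_ne_zero).clm_apply (continuous_id.sub continuous_const)
    fun_prop
  have hi := integrableOn_hull hc K
  rw [IntegrableOn, restrict_hull_eq_map hd hK hF ha hh hn1 hn,
    integrable_map_measure hc.aestronglyMeasurable hmeas.aemeasurable, Function.comp_def] at hi
  rw [restrict_hull_eq_map hd hK hF ha hh hn1 hn,
    integral_map hmeas.aemeasurable hc.aestronglyMeasurable, integral_prod_symm _ hi,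
    ← integral_const_mul]
  refine integral_congr_ae (Eventually.of_forall fun y => ?_)
  simp only
  rw [integral_coneWeight hh, integral_cone_line hd hφ]

theorem isOpposite_erase [DecidableEq (E d)] {b : E d} (hb : b ∈ K) :
    IsOpposite K (K.erase b) b :=
  ⟨hb, Finset.notMem_erase b K, Finset.erase_subset b K,
    fun _ hc hcb => Finset.mem_erase.2 ⟨hcb, hc⟩⟩

theorem erase_mem_facets [DecidableEq (E d)] (hK : IsSimplex K) {b : E d} (hb : b ∈ K) :
    K.erase b ∈ facets K := by
  rw [facets, Finset.mem_powersetCard]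
  exact ⟨Finset.erase_subset b K, by rw [Finset.card_erase_of_mem hb, hK.1]; simp⟩

/-- The radial fields with apexes c and b differ by the constant field b - c, since (x - c) - (x -
b) = b - c. Subtracting the two radial formulas gives the divergence theorem in this direction. -/
theorem integral_fderiv_sub_vertices (hd : 0 < d) (hK : IsSimplex K) {φ : E d → ℝ}
    (hφ : ContDiff ℝ 1 φ) {b c : E d} (hb : b ∈ K) (hc : c ∈ K) :
    ∫ x in hull K, fderiv ℝ φ x (b - c) =
      ∑ F ∈ facets K, ⟪outwardNormal K F, b - c⟫ * ∫ x, φ x ∂(surf F) := by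
  classical
  by_cases hbc : b = c
  · simp [hbc]
  have ob := isOpposite_erase hb
  have oc := isOpposite_erase hc
  have fb := erase_mem_facets hK hb
  have fc := erase_mem_facets hK hc
  obtain ⟨h, hh, hn1, hn⟩ := exists_height hd hK fb ob
  obtain ⟨h', hh', hn1', hn'⟩ := exists_height hd hK fc oc
  have hne : K.erase b ≠ K.erase c := by
    intro h0
    have : b ∈ K.erase c := Finset.mem_erase.2 ⟨hbc, hb⟩
    rw [← h0] at this
    exact Finset.notMem_erase b K this
  have hcont : ∀ a : E d, Continuous fun x => d * φ x + fderiv ℝ φ x (x - a) := fun a => by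
    have h1 := hφ.continuous
    have h2 : Continuous fun x => fderiv ℝ φ x (x - a) :=
      (hφ.continuous_fderiv one_ne_zero).clm_apply (continuous_id.sub continuous_const)
    fun_prop
  -- Only the facets opposite to b and to c contribute: any other facet contains both vertices, and
  -- its normal is orthogonal to b - c.
  rw [Finset.sum_eq_add (K.erase b) (K.erase c) hne]
  · rw [← neg_sub c b, inner_neg_right, hn c (Finset.mem_erase.2 ⟨Ne.symm hbc, hc⟩), neg_sub,
      hn' b (Finset.mem_erase.2 ⟨hbc, hb⟩), neg_mul,
      ← integral_radial hd hK fb ob hh hn1 hn hφ, ← integral_radial hd hK fc oc hh' hn1' hn' hφ,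
      neg_add_eq_sub,
      ← integral_sub (integrableOn_hull (hcont c) K) (integrableOn_hull (hcont b) K)]
    refine integral_congr_ae (Eventually.of_forall fun x => ?_)
    simp only
    rw [add_sub_add_left_eq_sub, ← map_sub, sub_sub_sub_cancel_left]
  · intro F hF hFbc
    have hmem : ∀ e ∈ K, F ≠ K.erase e → e ∈ F := by
      intro e he hne
      by_contra heF
      apply hne
      obtain ⟨hFK, hFc⟩ := Finset.mem_powersetCard.1 hF
      refine Finset.eq_of_subset_of_card_le (fun y hy => Finset.mem_erase.2 ⟨?_, hFK hy⟩) ?_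
      · rintro rfl
        exact heF hy
      · rw [Finset.card_erase_of_mem he, hK.1, hFc]
        simp
    obtain ⟨a, ha⟩ := hK.exists_isOpposite hF
    obtain ⟨h0, -, -, h2⟩ := exists_height hd hK hF ha
    have : b - c = (b - a) - (c - a) := by abel
    rw [this, inner_sub_right, h2 b (hmem b hb hFbc.1), h2 c (hmem c hc hFbc.2), sub_self, zero_mul]
  · exact fun h0 => absurd fb h0
  · exact fun h0 => absurd fc h0

/-- The divergence theorem on a simplex. -/
theorem integral_fderiv_hull (hd : 0 < d) (hK : IsSimplex K) {φ : E d → ℝ}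
    (hφ : ContDiff ℝ 1 φ) (w : E d) :
    ∫ x in hull K, fderiv ℝ φ x w =
      ∑ F ∈ facets K, ⟪outwardNormal K F, w⟫ * ∫ x, φ x ∂(surf F) := by
  have htop : vectorSpan ℝ (K : Set (E d)) = ⊤ := by
    have h1 := hK.basis.tot
    rw [hK.range_basis] at h1
    exact AffineSubspace.vectorSpan_eq_top_of_affineSpan_eq_top ℝ (E d) (E d) h1
  have hint : ∀ w : E d, IntegrableOn (fun x => fderiv ℝ φ x w) (hull K) := fun w =>
    integrableOn_hull ((hφ.continuous_fderiv one_ne_zero).clm_apply continuous_const) K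
  -- Both sides are linear in w, and the differences of vertices span the whole space.
  have hw : w ∈ Submodule.span ℝ ((K : Set (E d)) -ᵥ (K : Set (E d))) := by
    rw [← vectorSpan_def, htop]
    trivial
  induction hw using Submodule.span_induction with
  | mem v hv =>
    obtain ⟨b, hb, c, hc, rfl⟩ := hv
    exact integral_fderiv_sub_vertices hd hK hφ hb hc
  | zero => simp
  | add u v _ _ hu hv =>
    simp only [map_add, inner_add_right, add_mul, Finset.sum_add_distrib]
    rw [integral_add (hint u) (hint v), hu, hv]
  | smul r u _ hu =>
    simp only [map_smul, smul_eq_mul, inner_smul_right, mul_assoc]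
    rw [integral_const_mul, hu, Finset.mul_sum]

/-- The divergence theorem on an open simplex, for partial derivatives. -/
theorem integral_partialDeriv (hd : 0 < d) (hK : IsSimplex K) {φ : E d → ℝ}
    (hφ : ContDiff ℝ 1 φ) (i : Fin d) :
    ∫ x in openHull K, partialDeriv i φ x =
      ∑ F ∈ facets K, outwardNormal K F i * ∫ x, φ x ∂(surf F) := by
  rw [restrict_openHull]
  refine (integral_fderiv_hull hd hK hφ _).trans (Finset.sum_congr rfl fun F _ => ?_)
  rw [EuclideanSpace.inner_single_right]
  simp

/-- The trace inequality for functions that are smooth up to the boundary. -/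
theorem exists_trace_bound_smooth (hd : 0 < d) (hK : IsSimplex K) (hF : F ∈ facets K) :
    ∃ C : ℝ, 0 ≤ C ∧ ∀ φ : E d → ℝ, ContDiff ℝ ∞ φ →
      ∫ x, φ x ^ 2 ∂(surf F) ≤ C * ((∫ x in openHull K, φ x ^ 2) +
        ∑ i, ∫ x in openHull K, partialDeriv i φ x ^ 2) := by
  obtain ⟨a, ha⟩ := hK.exists_isOpposite hF
  obtain ⟨h, hh, hn1, hn⟩ := exists_height hd hK hF ha
  obtain ⟨R, hR⟩ := (isCompact_hull K).isBounded.subset_closedBall a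
  have hR0 : 0 ≤ R := dist_nonneg.trans (hR (subset_convexHull ℝ _ ha.mem))
  -- The radial formula is applied to φ². With |x - a| ≤ R on K, each of the d terms 2φ (x - a)ᵢ ∂ᵢφ
  -- is at most R φ² + R (∂ᵢφ)²; the term d φ² comes from the divergence of x - a.
  refine ⟨h⁻¹ * (d + d * R + R), by positivity, fun φ hφ => ?_⟩
  have hφ1 : ContDiff ℝ 1 φ := hφ.of_le (by norm_cast)
  have hsq : ContDiff ℝ 1 fun x => φ x ^ 2 := hφ1.pow 2
  have key := integral_radial hd hK hF ha hh hn1 hn hsq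
  have hder : ∀ x w, fderiv ℝ (fun x => φ x ^ 2) x w = 2 * φ x * fderiv ℝ φ x w := fun x w => by
    rw [fderiv_fun_pow 2 (hφ1.differentiable one_ne_zero x)]
    simp
  have hcp : ∀ i, Continuous fun x => partialDeriv i φ x := fun i =>
    (hφ1.continuous_fderiv one_ne_zero).clm_apply continuous_const
  have hcφ := hφ.continuous
  have hexp : ∀ x w, fderiv ℝ φ x w = ∑ i, w i * partialDeriv i φ x := fun x w => by
    conv_lhs => rw [← (EuclideanSpace.basisFun (Fin d) ℝ).sum_repr w]
    simp [partialDeriv, EuclideanSpace.basisFun_apply]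
  have hle : ∫ x in hull K, (d * φ x ^ 2 + fderiv ℝ (fun x => φ x ^ 2) x (x - a)) ≤
      ∫ x in hull K, ((d + d * R) * φ x ^ 2 + R * ∑ i, partialDeriv i φ x ^ 2) := by
    refine setIntegral_mono_on (integrableOn_hull ?_ K) (integrableOn_hull ?_ K)
      (measurableSet_hull K) fun x hx => ?_
    · have h2 : Continuous fun x => fderiv ℝ (fun x => φ x ^ 2) x (x - a) :=
        (hsq.continuous_fderiv one_ne_zero).clm_apply (continuous_id.sub continuous_const)
      fun_prop
    · have := continuous_finsetSum Finset.univ fun i _ => (hcp i).pow 2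
      fun_prop
    · have hxa : ∀ i, |(x - a) i| ≤ R := fun i => by
        have h1 := EuclideanSpace.norm_eq (x - a) ▸ (mem_closedBall_iff_norm.1 (hR hx))
        exact (PiLp.norm_apply_le (x - a) i).trans (mem_closedBall_iff_norm.1 (hR hx))
      have h3 : ∀ i, 2 * φ x * ((x - a) i * partialDeriv i φ x) ≤
          R * φ x ^ 2 + R * partialDeriv i φ x ^ 2 := fun i => by
        have h4 : 2 * φ x * ((x - a) i * partialDeriv i φ x) ≤
            |(x - a) i| * (φ x ^ 2 + partialDeriv i φ x ^ 2) := by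
          rcases abs_cases ((x - a) i) with ⟨h5, h6⟩ | ⟨h5, h6⟩ <;> rw [h5]
          · nlinarith [mul_nonneg h6 (sq_nonneg (φ x - partialDeriv i φ x))]
          · nlinarith [mul_nonneg (neg_nonneg.2 h6.le) (sq_nonneg (φ x + partialDeriv i φ x))]
        refine h4.trans ?_
        rw [← mul_add]
        exact mul_le_mul_of_nonneg_right (hxa i) (by positivity)
      rw [hder, hexp]
      have h5 := Finset.sum_le_sum fun i (_ : i ∈ Finset.univ) => h3 i
      rw [Finset.sum_add_distrib, Finset.sum_const, Finset.card_univ, Fintype.card_fin,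
        ← Finset.mul_sum, ← Finset.mul_sum, nsmul_eq_mul] at h5
      linarith
  rw [key] at hle
  have hsplit : ∫ x in hull K, ((d + d * R) * φ x ^ 2 + R * ∑ i, partialDeriv i φ x ^ 2) =
      (d + d * R) * (∫ x in openHull K, φ x ^ 2) +
        R * ∑ i, ∫ x in openHull K, partialDeriv i φ x ^ 2 := by
    rw [restrict_openHull, integral_add, integral_const_mul, integral_const_mul,
      integral_finsetSum]
    · exact fun i _ => integrableOn_hull ((hcp i).pow 2) K
    · exact integrableOn_hull (by fun_prop) K
    · have := continuous_finsetSum Finset.univ fun i _ => (hcp i).pow 2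
      exact integrableOn_hull (by fun_prop) K
  rw [hsplit] at hle
  have hA : 0 ≤ ∫ x in openHull K, φ x ^ 2 := integral_nonneg fun x => sq_nonneg _
  have hB : 0 ≤ ∑ i, ∫ x in openHull K, partialDeriv i φ x ^ 2 :=
    Finset.sum_nonneg fun i _ => integral_nonneg fun x => sq_nonneg _
  rw [mul_assoc, ← mul_le_mul_iff_right₀ hh, ← mul_assoc, mul_inv_cancel₀ hh.ne', one_mul]
  refine hle.trans ?_
  have hdR : 0 ≤ (d : ℝ) + d * R := by positivity
  nlinarith [mul_nonneg hR0 hA, mul_nonneg hdR hB]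

end

end FSI

namespace FSI

noncomputable section

variable {d : ℕ} {K K' F : Finset (E d)} {U V : Set (E d)} {i : Fin d} {f f' g g' : E d → ℝ}

/-! ### Calculus of weak derivatives -/

theorem continuous_partialDeriv {n : WithTop ℕ∞} {φ : E d → ℝ} (hφ : ContDiff ℝ n φ) (hn : n ≠ 0)
    (i : Fin d) : Continuous (partialDeriv i φ) :=
  (hφ.continuous_fderiv hn).clm_apply continuous_const

theorem partialDeriv_mul {φ ψ : E d → ℝ} {x : E d} (hφ : DifferentiableAt ℝ φ x)
    (hψ : DifferentiableAt ℝ ψ x) :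
    partialDeriv i (fun x => φ x * ψ x) x =
      partialDeriv i φ x * ψ x + φ x * partialDeriv i ψ x := by
  rw [partialDeriv, fderiv_fun_mul hφ hψ]
  simp [partialDeriv]
  ring

theorem IsTest.continuous {φ : E d → ℝ} (h : IsTest U φ) : Continuous φ := h.1.continuous

theorem IsTest.continuous_partialDeriv {φ : E d → ℝ} (h : IsTest U φ) (i : Fin d) :
    Continuous (partialDeriv i φ) := FSI.continuous_partialDeriv h.1 (by simp) i

theorem IsTest.mono {φ : E d → ℝ} (h : IsTest V φ) (hVU : V ⊆ U) : IsTest U φ :=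
  ⟨h.1, h.2.1, h.2.2.trans hVU⟩

theorem IsTest.eq_zero {φ : E d → ℝ} (h : IsTest U φ) {x : E d} (hx : x ∉ U) : φ x = 0 :=
  image_eq_zero_of_notMem_tsupport fun h' => hx (h.2.2 h')

theorem IsTest.partialDeriv_hasCompactSupport {φ : E d → ℝ} (h : IsTest U φ) (i : Fin d) :
    HasCompactSupport (partialDeriv i φ) :=
  (h.2.1.fderiv ℝ).comp_left (g := fun L : E d →L[ℝ] ℝ => L (EuclideanSpace.single i 1)) (by simp)

theorem IsTest.partialDeriv_eq_zero {φ : E d → ℝ} (h : IsTest U φ) (i : Fin d) {x : E d}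
    (hx : x ∉ U) : partialDeriv i φ x = 0 := by
  have : fderiv ℝ φ x = 0 :=
    image_eq_zero_of_notMem_tsupport fun h' => hx (h.2.2 (tsupport_fderiv_subset ℝ h'))
  rw [partialDeriv, this]
  rfl

theorem IsTest.memLp {φ : E d → ℝ} (h : IsTest U φ) (μ : Measure (E d))
    [IsFiniteMeasureOnCompacts μ] : MemLp φ 2 μ := h.continuous.memLp_of_hasCompactSupport h.2.1

theorem IsTest.memLp_partialDeriv {φ : E d → ℝ} (h : IsTest U φ) (i : Fin d) (μ : Measure (E d))
    [IsFiniteMeasureOnCompacts μ] : MemLp (partialDeriv i φ) 2 μ :=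
  (h.continuous_partialDeriv i).memLp_of_hasCompactSupport (h.partialDeriv_hasCompactSupport i)

theorem MemLp.integrable_mul_two {μ : Measure (E d)} (hf : MemLp f 2 μ) (hg : MemLp g 2 μ) :
    Integrable (fun x => f x * g x) μ := MemLp.integrable_mul hf hg

/-- The fundamental lemma of the calculus of variations. It makes weak derivatives and divergences
unique almost everywhere, which is all that can be used about representatives obtained by choice. -/
theorem ae_eq_of_forall_test (hU : IsOpen U) (hf : MemLp f 2 (volume.restrict U))
    (hg : MemLp g 2 (volume.restrict U))
    (h : ∀ φ, IsTest U φ → ∫ x in U, f x * φ x = ∫ x in U, g x * φ x) :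
    f =ᵐ[volume.restrict U] g := by
  have hfg := hf.sub hg
  have hloc : LocallyIntegrableOn (fun x => f x - g x) U volume := by
    have h0 := hfg.locallyIntegrable (by norm_num)
    rw [locallyIntegrableOn_iff hU.isLocallyClosed]
    intro k hkU hk
    have h1 := h0.integrableOn_isCompact hk
    rwa [IntegrableOn, Measure.restrict_restrict_of_subset hkU] at h1
  have h1 := hU.ae_eq_zero_of_integral_contDiff_smul_eq_zero hloc fun φ h1 h2 h3 => by
    have ht : IsTest U φ := ⟨h1, h2, h3⟩
    rw [← setIntegral_eq_integral_of_forall_compl_eq_zero (s := U)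
      (fun x hx => by rw [ht.eq_zero hx, zero_smul])]
    have h4 := h φ ht
    rw [← sub_eq_zero, ← integral_sub (MemLp.integrable_mul_two hf (ht.memLp _))
      (MemLp.integrable_mul_two hg (ht.memLp _))] at h4
    rw [← h4]
    refine integral_congr_ae (Eventually.of_forall fun x => ?_)
    simp only [smul_eq_mul]
    ring
  filter_upwards [(ae_restrict_iff' hU.measurableSet).2 h1] with x hx
  linarith

theorem IsWeakPartial.ae_unique (hU : IsOpen U) (h : IsWeakPartial U i f g)
    (h' : IsWeakPartial U i f g') : g =ᵐ[volume.restrict U] g' :=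
  ae_eq_of_forall_test hU h.1 h'.1 fun φ hφ => by
    rw [← neg_inj, ← h.2 φ hφ, ← h'.2 φ hφ]

theorem IsWeakPartial.congr (h : IsWeakPartial U i f g) (hf : f =ᵐ[volume.restrict U] f')
    (hg : g =ᵐ[volume.restrict U] g') : IsWeakPartial U i f' g' := by
  refine ⟨h.1.ae_eq hg, fun φ hφ => ?_⟩
  exact (integral_congr_ae (hf.mul (ae_eq_refl (partialDeriv i φ)))).symm.trans
    ((h.2 φ hφ).trans (congrArg Neg.neg (integral_congr_ae (hg.mul (ae_eq_refl φ)))))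

/-- A test function on V is one on U, and all integrands vanish outside V. -/
theorem IsWeakPartial.mono (h : IsWeakPartial U i f g) (hVU : V ⊆ U) :
    IsWeakPartial V i f g := by
  refine ⟨h.1.mono_measure (Measure.restrict_mono hVU le_rfl), fun φ hφ => ?_⟩
  have key : ∀ u v : E d → ℝ, (∀ x ∉ V, v x = 0) →
      ∫ x in V, u x * v x = ∫ x in U, u x * v x := fun u v hv => by
    rw [setIntegral_eq_integral_of_forall_compl_eq_zero (fun x hx => by rw [hv x hx, mul_zero]),
      setIntegral_eq_integral_of_forall_compl_eq_zero
        (fun x hx => by rw [hv x (fun h' => hx (hVU h')), mul_zero])]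
  rw [key f _ (fun x hx => hφ.partialDeriv_eq_zero i hx), key g _ (fun x hx => hφ.eq_zero hx)]
  exact h.2 φ (hφ.mono hVU)

theorem IsWeakPartial.add (hf : MemLp f 2 (volume.restrict U))
    (hf' : MemLp f' 2 (volume.restrict U)) (h : IsWeakPartial U i f g)
    (h' : IsWeakPartial U i f' g') :
    IsWeakPartial U i (fun x => f x + f' x) (fun x => g x + g' x) := by
  refine ⟨h.1.add h'.1, fun φ hφ => ?_⟩
  simp only [add_mul]
  rw [integral_add (MemLp.integrable_mul_two hf (hφ.memLp_partialDeriv i _))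
    (MemLp.integrable_mul_two hf' (hφ.memLp_partialDeriv i _)),
    integral_add (MemLp.integrable_mul_two h.1 (hφ.memLp _))
      (MemLp.integrable_mul_two h'.1 (hφ.memLp _)), h.2 φ hφ, h'.2 φ hφ, neg_add]

theorem IsWeakPartial.const_mul (h : IsWeakPartial U i f g) (c : ℝ) :
    IsWeakPartial U i (fun x => c * f x) (fun x => c * g x) := by
  refine ⟨h.1.const_mul c, fun φ hφ => ?_⟩
  simp only [mul_assoc]
  rw [integral_const_mul, integral_const_mul, h.2 φ hφ, mul_neg]

theorem isWeakPartial_zero (U : Set (E d)) (i : Fin d) :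
    IsWeakPartial U i (fun _ => 0) (fun _ => 0) := by
  refine ⟨MemLp.zero', fun φ _ => by simp⟩

theorem weakPartial_spec (h : ∃ g, IsWeakPartial U i f g) :
    IsWeakPartial U i f (weakPartial U i f) := by
  rw [weakPartial, dif_pos h]
  exact h.choose_spec

theorem IsWeakPartial.weakPartial_ae_eq (hU : IsOpen U) (h : IsWeakPartial U i f g) :
    weakPartial U i f =ᵐ[volume.restrict U] g :=
  IsWeakPartial.ae_unique hU (weakPartial_spec ⟨g, h⟩) h

theorem MemH1.memLp (h : MemH1 U f) : MemLp f 2 (volume.restrict U) := h.1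

theorem MemH1.isWeakPartial (h : MemH1 U f) (i : Fin d) :
    IsWeakPartial U i f (weakPartial U i f) := weakPartial_spec (h.2 i)

theorem MemH1.memLp_weakPartial (h : MemH1 U f) (i : Fin d) :
    MemLp (weakPartial U i f) 2 (volume.restrict U) := (h.isWeakPartial i).1

theorem MemH1.congr (h : MemH1 U f) (hf : f =ᵐ[volume.restrict U] f') : MemH1 U f' :=
  ⟨h.1.ae_eq hf, fun i => ⟨_, (h.isWeakPartial i).congr hf (ae_eq_refl _)⟩⟩

theorem MemH1.mono (h : MemH1 U f) (hVU : V ⊆ U) : MemH1 V f :=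
  ⟨h.1.mono_measure (Measure.restrict_mono hVU le_rfl),
    fun i => ⟨_, (h.isWeakPartial i).mono hVU⟩⟩

theorem MemH1.add (h : MemH1 U f) (h' : MemH1 U f') : MemH1 U (fun x => f x + f' x) :=
  ⟨h.1.add h'.1, fun i => ⟨_, IsWeakPartial.add h.1 h'.1 (h.isWeakPartial i) (h'.isWeakPartial i)⟩⟩

theorem MemH1.const_mul (h : MemH1 U f) (c : ℝ) : MemH1 U (fun x => c * f x) :=
  ⟨h.1.const_mul c, fun i => ⟨_, (h.isWeakPartial i).const_mul c⟩⟩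

theorem memH1_zero (U : Set (E d)) : MemH1 U (fun _ => 0) :=
  ⟨MemLp.zero', fun i => ⟨_, isWeakPartial_zero U i⟩⟩

theorem MemH1.sub (h : MemH1 U f) (h' : MemH1 U f') : MemH1 U (fun x => f x - f' x) := by
  have := h.add (h'.const_mul (-1))
  simpa [sub_eq_add_neg] using this

theorem MemH1.finset_sum {ι : Type*} (s : Finset ι) {f : ι → E d → ℝ}
    (h : ∀ j ∈ s, MemH1 U (f j)) : MemH1 U (fun x => ∑ j ∈ s, f j x) := by
  classical
  induction s using Finset.induction_on with
  | empty => simpa using memH1_zero U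
  | insert j s hj ih =>
    simp only [Finset.sum_insert hj]
    exact (h j (Finset.mem_insert_self j s)).add
      (ih fun l hl => h l (Finset.mem_insert_of_mem hl))

/-- The representatives chosen on V and on U are not related by definition; only uniqueness
identifies them. This links the derivatives on a subdomain to those on its elements. -/
theorem weakPartial_mono (hV : IsOpen V) (h : MemH1 U f) (hVU : V ⊆ U) (i : Fin d) :
    weakPartial V i f =ᵐ[volume.restrict V] weakPartial U i f :=
  IsWeakPartial.weakPartial_ae_eq hV ((h.isWeakPartial i).mono hVU)

theorem weakPartial_congr (hU : IsOpen U) (h : MemH1 U f) (hf : f =ᵐ[volume.restrict U] f')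
    (i : Fin d) : weakPartial U i f' =ᵐ[volume.restrict U] weakPartial U i f :=
  IsWeakPartial.weakPartial_ae_eq hU ((h.isWeakPartial i).congr hf (ae_eq_refl _))

theorem weakPartial_const_mul (hU : IsOpen U) (h : MemH1 U f) (c : ℝ) (i : Fin d) :
    weakPartial U i (fun x => c * f x) =ᵐ[volume.restrict U] fun x => c * weakPartial U i f x :=
  IsWeakPartial.weakPartial_ae_eq hU ((h.isWeakPartial i).const_mul c)

theorem weakPartial_sub (hU : IsOpen U) (h : MemH1 U f) (h' : MemH1 U f') (i : Fin d) :
    weakPartial U i (fun x => f x - f' x) =ᵐ[volume.restrict U]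
      fun x => weakPartial U i f x - weakPartial U i f' x := by
  have h1 := IsWeakPartial.weakPartial_ae_eq hU (IsWeakPartial.add h.1 (h'.const_mul (-1)).1
    (h.isWeakPartial i) ((h'.isWeakPartial i).const_mul (-1)))
  simpa [sub_eq_add_neg] using h1

theorem MemH2.memH1 (h : MemH2 U f) : MemH1 U f := h.1

theorem MemH2.memH1_weakPartial (hU : IsOpen U) (h : MemH2 U f) (i : Fin d) :
    MemH1 U (weakPartial U i f) := by
  obtain ⟨g, hg, hg1⟩ := h.2 i
  exact hg1.congr (IsWeakPartial.weakPartial_ae_eq hU hg).symm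

theorem MemH2.mono (h : MemH2 U f) (hVU : V ⊆ U) : MemH2 V f :=
  ⟨h.1.mono hVU, fun i => by
    obtain ⟨g, hg, hg1⟩ := h.2 i
    exact ⟨g, hg.mono hVU, hg1.mono hVU⟩⟩

theorem memLp_of_continuous_hull {g : E d → ℝ} (hg : Continuous g) (K : Finset (E d)) :
    MemLp g 2 (volume.restrict (openHull K)) := by
  obtain ⟨C, hC⟩ := (isCompact_hull K).exists_bound_of_continuousOn hg.continuousOn
  refine MemLp.of_bound hg.aestronglyMeasurable C ?_
  rw [restrict_openHull]
  filter_upwards [ae_restrict_mem (measurableSet_hull K)] with x hx using hC x hx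

/-- The compact support of ψ allows integration by parts over the whole space, without boundary
terms. -/
theorem isWeakPartial_of_contDiff {φ : E d → ℝ} (hφ : ContDiff ℝ 1 φ) (K : Finset (E d))
    (i : Fin d) : IsWeakPartial (openHull K) i φ (partialDeriv i φ) := by
  refine ⟨memLp_of_continuous_hull (continuous_partialDeriv hφ one_ne_zero i) K, fun ψ hψ => ?_⟩
  have hc := continuous_partialDeriv hφ one_ne_zero i
  rw [setIntegral_eq_integral_of_forall_compl_eq_zero
      (fun x hx => by rw [hψ.partialDeriv_eq_zero i hx, mul_zero]),
    setIntegral_eq_integral_of_forall_compl_eq_zero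
      (fun x hx => by rw [hψ.eq_zero hx, mul_zero])]
  refine integral_mul_fderiv_eq_neg_fderiv_mul_of_integrable ?_ ?_ ?_
    (fun x _ => hφ.differentiable one_ne_zero x) (fun x _ => hψ.1.differentiable (by simp) x)
  · exact (hc.mul hψ.continuous).integrable_of_hasCompactSupport hψ.2.1.mul_left
  · exact (hφ.continuous.mul (hψ.continuous_partialDeriv i)).integrable_of_hasCompactSupport
      (hψ.partialDeriv_hasCompactSupport i).mul_left
  · exact (hφ.continuous.mul hψ.continuous).integrable_of_hasCompactSupport hψ.2.1.mul_left

theorem memH1_of_contDiff {φ : E d → ℝ} (hφ : ContDiff ℝ 1 φ) (K : Finset (E d)) :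
    MemH1 (openHull K) φ :=
  ⟨memLp_of_continuous_hull hφ.continuous K, fun i => ⟨_, isWeakPartial_of_contDiff hφ K i⟩⟩

theorem weakPartial_of_contDiff {φ : E d → ℝ} (hφ : ContDiff ℝ 1 φ) (K : Finset (E d))
    (i : Fin d) :
    weakPartial (openHull K) i φ =ᵐ[volume.restrict (openHull K)] partialDeriv i φ :=
  IsWeakPartial.weakPartial_ae_eq (isOpen_openHull K) (isWeakPartial_of_contDiff hφ K i)

/-! ### Weak divergence -/

variable {w w' : E d → E d}

theorem weakDiv_spec (h : ∃ g, IsWeakDiv U w g) : IsWeakDiv U w (weakDiv U w) := by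
  rw [weakDiv, dif_pos h]
  exact h.choose_spec

theorem IsWeakDiv.ae_unique (hU : IsOpen U) (h : IsWeakDiv U w g) (h' : IsWeakDiv U w g') :
    g =ᵐ[volume.restrict U] g' :=
  ae_eq_of_forall_test hU h.1 h'.1 fun φ hφ => by
    rw [← neg_inj, ← h.2 φ hφ, ← h'.2 φ hφ]

theorem IsWeakDiv.weakDiv_ae_eq (hU : IsOpen U) (h : IsWeakDiv U w g) :
    weakDiv U w =ᵐ[volume.restrict U] g :=
  IsWeakDiv.ae_unique hU (weakDiv_spec ⟨g, h⟩) h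

theorem IsWeakDiv.congr (h : IsWeakDiv U w g) (hw : w =ᵐ[volume.restrict U] w') :
    IsWeakDiv U w' g := by
  refine ⟨h.1, fun φ hφ => ?_⟩
  rw [← h.2 φ hφ]
  refine integral_congr_ae ?_
  filter_upwards [hw] with x hx
  rw [hx]

theorem IsWeakDiv.mono (h : IsWeakDiv U w g) (hVU : V ⊆ U) : IsWeakDiv V w g := by
  refine ⟨h.1.mono_measure (Measure.restrict_mono hVU le_rfl), fun φ hφ => ?_⟩
  have h1 := h.2 φ (hφ.mono hVU)
  rw [setIntegral_eq_integral_of_forall_compl_eq_zero (fun x hx => Finset.sum_eq_zero fun i _ => by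
      rw [hφ.partialDeriv_eq_zero i (fun h' => hx (hVU h')), mul_zero]),
    setIntegral_eq_integral_of_forall_compl_eq_zero
      (fun x hx => by rw [hφ.eq_zero (fun h' => hx (hVU h')), mul_zero])] at h1
  rwa [setIntegral_eq_integral_of_forall_compl_eq_zero (fun x hx => Finset.sum_eq_zero fun i _ => by
      rw [hφ.partialDeriv_eq_zero i hx, mul_zero]),
    setIntegral_eq_integral_of_forall_compl_eq_zero
      (fun x hx => by rw [hφ.eq_zero hx, mul_zero])]

theorem isWeakDiv_of_memH1 (h : ∀ i, MemH1 U (fun x => w x i)) :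
    IsWeakDiv U w (fun x => ∑ i, weakPartial U i (fun x => w x i) x) := by
  refine ⟨memLp_finsetSum _ fun i _ => (h i).memLp_weakPartial i, fun φ hφ => ?_⟩
  simp only [Finset.sum_mul]
  rw [integral_finsetSum _ fun i _ =>
      MemLp.integrable_mul_two (h i).memLp (hφ.memLp_partialDeriv i _),
    integral_finsetSum _ fun i _ =>
      MemLp.integrable_mul_two ((h i).memLp_weakPartial i) (hφ.memLp _), ← Finset.sum_neg_distrib]
  exact Finset.sum_congr rfl fun i _ => ((h i).isWeakPartial i).2 φ hφ

theorem weakDiv_ae_eq_sum (hU : IsOpen U) (h : ∀ i, MemH1 U (fun x => w x i)) :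
    weakDiv U w =ᵐ[volume.restrict U] fun x => ∑ i, weakPartial U i (fun x => w x i) x :=
  IsWeakDiv.weakDiv_ae_eq hU (isWeakDiv_of_memH1 h)

end

end FSI

namespace FSI

noncomputable section

open scoped Convolution

variable {d : ℕ} {K K' F : Finset (E d)}

/-! ### Density of smooth functions in `H¹` of a simplex -/

/-- Schur's test for integral operators with a continuous nonnegative kernel. -/
theorem eLpNorm_kernel_le {k : E d → E d → ℝ} (hk : Continuous (fun p : E d × E d => k p.1 p.2))
    (hk0 : ∀ x t, 0 ≤ k x t) (h1 : ∀ x, ∫⁻ t, ENNReal.ofReal (k x t) ≤ 1) {C : ENNReal}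
    (h2 : ∀ t, ∫⁻ x, ENNReal.ofReal (k x t) ≤ C) {g : E d → ℝ}
    (hg : AEStronglyMeasurable g volume) :
    eLpNorm (fun x => ∫ t, g t * k x t) 2 volume ≤ C ^ (1 / (2 : ℝ)) * eLpNorm g 2 volume := by
  have hkx : ∀ x, Measurable fun t => ENNReal.ofReal (k x t) := fun x =>
    ENNReal.measurable_ofReal.comp (hk.comp (Continuous.prodMk_right x)).measurable
  have hkp : Measurable fun p : E d × E d => ENNReal.ofReal (k p.1 p.2) :=
    ENNReal.measurable_ofReal.comp hk.measurable
  have hge : AEMeasurable (fun t => ‖g t‖ₑ) volume := hg.enorm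
  -- Cauchy–Schwarz with k split as k^(1/2) · k^(1/2): the last factor has L² norm at most 1 by
  -- `h1`. The bound `h2` enters after the order of integration is exchanged.
  have hpt : ∀ x, ‖∫ t, g t * k x t‖ₑ ^ (2 : ℝ) ≤ ∫⁻ t, ‖g t‖ₑ ^ (2 : ℝ) * ENNReal.ofReal (k x t) := by
    intro x
    have e1 : ‖∫ t, g t * k x t‖ₑ ≤ ∫⁻ t, ((fun t => ‖g t‖ₑ * ENNReal.ofReal (k x t) ^ (1 / (2 : ℝ))) *
        fun t => ENNReal.ofReal (k x t) ^ (1 / (2 : ℝ))) t := by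
      refine (enorm_integral_le_lintegral_enorm _).trans (le_of_eq (lintegral_congr fun t => ?_))
      simp only [Pi.mul_apply]
      rw [enorm_mul, Real.enorm_of_nonneg (hk0 x t), mul_assoc, ← ENNReal.rpow_add_of_nonneg _ _
        (by norm_num) (by norm_num)]
      norm_num
    have e2 := e1.trans (ENNReal.lintegral_mul_le_Lp_mul_Lq volume Real.HolderConjugate.two_two
      (hge.mul ((hkx x).pow_const _).aemeasurable) ((hkx x).pow_const _).aemeasurable)
    have e3 : ∀ t, (ENNReal.ofReal (k x t) ^ (1 / (2 : ℝ))) ^ (2 : ℝ) = ENNReal.ofReal (k x t) :=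
      fun t => by rw [← ENNReal.rpow_mul]; norm_num
    have e4 : (∫⁻ t, (ENNReal.ofReal (k x t) ^ (1 / (2 : ℝ))) ^ (2 : ℝ)) ^ (1 / (2 : ℝ)) ≤ 1 := by
      simp only [e3]
      exact ENNReal.rpow_le_one (h1 x) (by norm_num)
    have e5 := e2.trans (mul_le_mul_right e4 _)
    rw [mul_one] at e5
    have e6 := ENNReal.rpow_le_rpow e5 (show (0 : ℝ) ≤ 2 by norm_num)
    rw [← ENNReal.rpow_mul, show (1 / (2 : ℝ)) * 2 = 1 by norm_num, ENNReal.rpow_one] at e6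
    refine e6.trans (le_of_eq (lintegral_congr fun t => ?_))
    rw [ENNReal.mul_rpow_of_nonneg _ _ (by norm_num), e3]
  have hge2 : AEMeasurable (fun t => ‖g t‖ₑ ^ (2 : ℝ)) volume := hge.pow_const _
  have hmain : ∫⁻ x, ‖∫ t, g t * k x t‖ₑ ^ (2 : ℝ) ≤ C * ∫⁻ t, ‖g t‖ₑ ^ (2 : ℝ) := by
    refine (lintegral_mono hpt).trans ?_
    rw [lintegral_lintegral_swap (f := fun x t => ‖g t‖ₑ ^ (2 : ℝ) * ENNReal.ofReal (k x t))
      ((hge2.comp_quasiMeasurePreserving Measure.quasiMeasurePreserving_snd).mul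
      hkp.aemeasurable), ← lintegral_const_mul'' _ hge2]
    refine lintegral_mono fun t => ?_
    simp only
    have hkt : Measurable fun x => ENNReal.ofReal (k x t) :=
      ENNReal.measurable_ofReal.comp (hk.comp (Continuous.prodMk_left t)).measurable
    rw [lintegral_const_mul _ hkt, mul_comm]
    exact mul_le_mul_left (h2 t) _
  rw [eLpNorm_eq_lintegral_rpow_enorm_toReal (by norm_num) (by norm_num),
    eLpNorm_eq_lintegral_rpow_enorm_toReal (by norm_num) (by norm_num)]
  simp only [ENNReal.toReal_ofNat]
  rw [← ENNReal.mul_rpow_of_nonneg _ _ (by norm_num)]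
  exact ENNReal.rpow_le_rpow hmain (by norm_num)

/-- The mollification of `g`, evaluated at the point `(1 - δ) x + δ x₀`. -/
def dilatedMollify (ρ : E d → ℝ) (δ : ℝ) (x₀ : E d) (g : E d → ℝ) (x : E d) : ℝ :=
  ∫ t, g t * ρ (x + δ • (x₀ - x) - t)

theorem dilatedMollify_eq (ρ : E d → ℝ) (δ : ℝ) (x₀ : E d) (g : E d → ℝ) :
    dilatedMollify ρ δ x₀ g =
      fun x => (g ⋆[ContinuousLinearMap.mul ℝ ℝ, volume] ρ) (x + δ • (x₀ - x)) := rfl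

theorem contDiff_dilatedMollify {ρ : E d → ℝ} (hρ : ContDiff ℝ ∞ ρ) (hc : HasCompactSupport ρ)
    (δ : ℝ) (x₀ : E d) {g : E d → ℝ} (hg : LocallyIntegrable g) :
    ContDiff ℝ ∞ (dilatedMollify ρ δ x₀ g) := by
  rw [dilatedMollify_eq]
  exact (hc.contDiff_convolution_right _ hg hρ).comp (by fun_prop)

theorem integrable_mul_mollifier {ρ : E d → ℝ} (hρ : Continuous ρ) (hc : HasCompactSupport ρ)
    {g : E d → ℝ} (hg : LocallyIntegrable g) (y : E d) :
    Integrable (fun t => g t * ρ (y - t)) :=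
  hc.convolutionExists_right (ContinuousLinearMap.mul ℝ ℝ) hg hρ y

/-- The derivative falls on the mollifier, and the chain rule for x ↦ (1 - δ) x + δ x₀ gives the
factor 1 - δ. -/
theorem partialDeriv_dilatedMollify {ρ : E d → ℝ} (hρ : ContDiff ℝ ∞ ρ)
    (hc : HasCompactSupport ρ) (δ : ℝ) (x₀ : E d) {g : E d → ℝ} (hg : LocallyIntegrable g)
    (i : Fin d) (x : E d) :
    partialDeriv i (dilatedMollify ρ δ x₀ g) x =
      (1 - δ) * ∫ t, g t * partialDeriv i ρ (x + δ • (x₀ - x) - t) := by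
  have hρ1 : ContDiff ℝ 1 ρ := hρ.of_le (by norm_cast)
  have h1 := hc.hasFDerivAt_convolution_right (ContinuousLinearMap.mul ℝ ℝ) hg hρ1
    (x + δ • (x₀ - x))
  have h2 : HasFDerivAt (fun x : E d => x + δ • (x₀ - x))
      ((1 - δ) • ContinuousLinearMap.id ℝ (E d)) x := by
    have := (hasFDerivAt_id (𝕜 := ℝ) x).add (((hasFDerivAt_id (𝕜 := ℝ) x).const_sub x₀).const_smul δ)
    refine this.congr_fderiv ?_
    ext v
    simp [sub_eq_add_neg, add_mul]
  have h3 := h1.comp x h2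
  rw [dilatedMollify_eq]
  change fderiv ℝ _ x _ = _
  rw [show (fun x => (g ⋆[ContinuousLinearMap.mul ℝ ℝ, volume] ρ) (x + δ • (x₀ - x))) =
    (g ⋆[ContinuousLinearMap.mul ℝ ℝ, volume] ρ) ∘ fun x => x + δ • (x₀ - x) from rfl, h3.fderiv]
  rw [ContinuousLinearMap.comp_apply, _root_.smul_apply, ContinuousLinearMap.id_apply,
    map_smul, convolution_precompR_apply _ hg (hc.fderiv ℝ) (hρ1.continuous_fderiv one_ne_zero)]
  rfl

/-- The reflected kernel t ↦ ρ(y - t) is a test function on U as soon as its support stays inside.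
The sign of the reflection cancels the one in the definition of the weak derivative. -/
theorem dilatedMollify_weak {U : Set (E d)} (hU : MeasurableSet U) {ρ : E d → ℝ}
    (hρ : ContDiff ℝ ∞ ρ)
    (hc : HasCompactSupport ρ) {i : Fin d} {f g : E d → ℝ} (h : IsWeakPartial U i f g) {y : E d}
    (hy : ∀ t, y - t ∈ tsupport ρ → t ∈ U) :
    ∫ t, U.indicator f t * partialDeriv i ρ (y - t) = ∫ t, U.indicator g t * ρ (y - t) := by
  have hsub : Continuous fun t : E d => y - t := by fun_prop
  have htest : IsTest U (fun t => ρ (y - t)) := by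
    refine ⟨hρ.comp (by fun_prop), hc.comp_homeomorph (Homeomorph.subLeft y), fun t ht => hy t ?_⟩
    exact tsupport_comp_subset_preimage ρ hsub ht
  have h1 := h.2 _ htest
  have h2 : ∀ t, partialDeriv i (fun t => ρ (y - t)) t = - partialDeriv i ρ (y - t) := fun t => by
    have e1 : HasFDerivAt (fun t : E d => y - t) (-ContinuousLinearMap.id ℝ (E d)) t :=
      (hasFDerivAt_id t).const_sub y
    have e2 := ((hρ.differentiable (by simp)) (y - t)).hasFDerivAt.comp t e1
    rw [partialDeriv]
    erw [e2.fderiv]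
    simp [partialDeriv]
  simp only [h2, mul_neg, integral_neg, neg_inj] at h1
  have h3 : ∀ u v : E d → ℝ, ∫ t, U.indicator u t * v t = ∫ t in U, u t * v t := fun u v => by
    rw [← integral_indicator hU]
    refine integral_congr_ae (Eventually.of_forall fun t => ?_)
    simp only [indicator_mul_left]
  rw [h3, h3, h1]

/-- Change of variables: the contraction by 1 - δ ≥ 1/2 costs a Jacobian factor (1 - δ)^(-d) ≤ 2^d.
-/
theorem lintegral_mollifier_comp (ρ : ContDiffBump (0 : E d)) {δ : ℝ} (hδ : δ ≤ 1 / 2)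
    (x₀ t : E d) : ∫⁻ x, ENNReal.ofReal (ρ.normed volume (x + δ • (x₀ - x) - t)) ≤
      ENNReal.ofReal (2 ^ d) := by
  set c := δ • x₀ - t with hc
  have hr : (1 - δ) ≠ 0 := by linarith
  have e1 : ∀ x, x + δ • (x₀ - x) - t = (1 - δ) • x + c := fun x => by
    rw [hc]; module
  simp only [e1]
  have hint : Integrable (fun x => ρ.normed volume (x + c)) := ρ.integrable_normed.comp_add_right c
  have hint' : Integrable (fun x => ρ.normed volume ((1 - δ) • x + c)) := hint.comp_smul hr
  rw [← ofReal_integral_eq_lintegral_ofReal hint' (Eventually.of_forall fun x => ρ.nonneg_normed _),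
    Measure.integral_comp_smul volume (fun x => ρ.normed volume (x + c)) (1 - δ),
    integral_add_right_eq_self, ρ.integral_normed, smul_eq_mul, mul_one, finrank_euclideanSpace_fin]
  refine ENNReal.ofReal_le_ofReal ?_
  rw [abs_of_nonneg (inv_nonneg.2 (pow_nonneg (by linarith) _)), ← inv_pow]
  refine pow_le_pow_left₀ (inv_nonneg.2 (by linarith)) ?_ _
  rw [inv_le_comm₀ (by linarith) (by norm_num)]
  linarith

theorem lintegral_mollifier (ρ : ContDiffBump (0 : E d)) (y : E d) :
    ∫⁻ t, ENNReal.ofReal (ρ.normed volume (y - t)) = 1 := by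
  have hint : Integrable (fun t => ρ.normed volume (y - t)) := ρ.integrable_normed.comp_sub_left y
  rw [← ofReal_integral_eq_lintegral_ofReal hint (Eventually.of_forall fun x => ρ.nonneg_normed _),
    integral_sub_left_eq_self, ρ.integral_normed, ENNReal.ofReal_one]

/-- Schur's test with the two preceding kernel integrals; the bound does not depend on δ or on the
radius of the bump. -/
theorem eLpNorm_dilatedMollify_le (ρ : ContDiffBump (0 : E d)) {δ : ℝ} (hδ : δ ≤ 1 / 2)
    (x₀ : E d) {g : E d → ℝ} (hg : AEStronglyMeasurable g volume) :
    eLpNorm (dilatedMollify (ρ.normed volume) δ x₀ g) 2 volume ≤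
      ENNReal.ofReal (2 ^ d) ^ (1 / (2 : ℝ)) * eLpNorm g 2 volume := by
  have hρ := ρ.continuous_normed (μ := volume)
  exact eLpNorm_kernel_le (k := fun x t => ρ.normed volume (x + δ • (x₀ - x) - t))
    (by fun_prop) (fun x t => ρ.nonneg_normed _) (fun x => (lintegral_mollifier ρ _).le)
    (fun t => lintegral_mollifier_comp ρ hδ x₀ t) hg

/-- The contraction moves x by less than η / 2, and the mollifier averages over a ball of radius
less than η / 2; each of the two moves changes g by at most κ. -/
theorem dist_dilatedMollify_le {ρ : ContDiffBump (0 : E d)} {δ : ℝ} {x₀ x : E d} {g : E d → ℝ}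
    (hg : Continuous g) {κ η R : ℝ} (hη : ∀ y z, dist y z < η → dist (g y) (g z) < κ)
    (hx : ‖x₀ - x‖ ≤ R) (hδ : |δ| * R < η / 2) (hρ : ρ.rOut < η / 2) :
    dist (dilatedMollify (ρ.normed volume) δ x₀ g x) (g x) ≤ 2 * κ := by
  set y := x + δ • (x₀ - x) with hy
  have hR : 0 ≤ R := (norm_nonneg _).trans hx
  have h1 : dist y x < η / 2 := by
    rw [hy, dist_eq_norm, add_sub_cancel_left, norm_smul, Real.norm_eq_abs]
    exact (mul_le_mul_of_nonneg_left hx (abs_nonneg δ)).trans_lt hδ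
  have hη0 : 0 < η := by linarith [ρ.rOut_pos]
  have h2 := ContDiffBump.dist_normed_convolution_le (φ := ρ) (μ := volume) (x₀ := y) (ε := κ)
    hg.aestronglyMeasurable fun z hz => (hη z y (by
      rw [Metric.mem_ball] at hz; linarith)).le
  rw [convolution_lsmul_swap] at h2
  have h3 : dilatedMollify (ρ.normed volume) δ x₀ g x =
      ∫ t, ρ.normed volume (y - t) • g t := by
    refine integral_congr_ae (Eventually.of_forall fun t => ?_)
    simp only [smul_eq_mul, mul_comm, hy]
  rw [h3]
  have h4 := (hη y x (by linarith)).le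
  linarith [dist_triangle (∫ t, ρ.normed volume (y - t) • g t) (g y) (g x)]

/-- The operators are uniformly bounded on L² and converge uniformly on the bounded set U for
continuous compactly supported functions, which are dense. -/
theorem tendsto_dilatedMollify {ρ : ℕ → ContDiffBump (0 : E d)} {δ : ℕ → ℝ}
    (hδ : ∀ m, δ m ≤ 1 / 2) (hδ0 : Tendsto δ atTop (𝓝 0))
    (hρ : Tendsto (fun m => (ρ m).rOut) atTop (𝓝 0)) (x₀ : E d) {U : Set (E d)}
    (hU : Bornology.IsBounded U) (hUm : MeasurableSet U) {g : E d → ℝ} (hg : MemLp g 2 volume) :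
    Tendsto (fun m => eLpNorm (fun x => dilatedMollify ((ρ m).normed volume) (δ m) x₀ g x - g x) 2
      (volume.restrict U)) atTop (𝓝 0) := by
  rw [ENNReal.tendsto_nhds_zero]
  intro ε hε
  set C := ENNReal.ofReal (2 ^ d) ^ (1 / (2 : ℝ)) with hC
  have hCt : C ≠ ⊤ := ENNReal.rpow_ne_top_of_nonneg (by norm_num) ENNReal.ofReal_ne_top
  have hε2 : ε / 2 ≠ 0 := (ENNReal.half_pos hε.ne').ne'
  -- Error budget: replacing g by g₀ costs η₁ twice, once multiplied by the operator bound C. The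
  -- uniform error κ for g₀ costs κ M with M = |U|^(1/2).
  obtain ⟨η₁, hη₁, hη₁'⟩ := ENNReal.exists_nnreal_pos_mul_lt
    (show C + 1 ≠ ⊤ from ENNReal.add_ne_top.2 ⟨hCt, ENNReal.one_ne_top⟩) hε2
  set M := (volume.restrict U) univ ^ (2 : ENNReal).toReal⁻¹ with hM
  have hUfin : (volume.restrict U) univ ≠ ⊤ := by
    rw [Measure.restrict_apply_univ]
    exact hU.measure_lt_top.ne
  have hMt : M ≠ ⊤ := ENNReal.rpow_ne_top_of_nonneg (by norm_num) hUfin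
  obtain ⟨κ, hκ, hκ'⟩ := ENNReal.exists_nnreal_pos_mul_lt hMt hε2
  obtain ⟨g₀, hg₀c, hg₀n, hg₀, hg₀L⟩ := hg.exists_hasCompactSupport_eLpNorm_sub_le
    (by norm_num) (show (η₁ : ENNReal) ≠ 0 by exact_mod_cast hη₁.ne')
  obtain ⟨η, hη, hη'⟩ := Metric.uniformContinuous_iff.1 (hg₀c.uniformContinuous_of_continuous hg₀)
    (κ / 2) (by positivity)
  obtain ⟨R, hR⟩ := hU.subset_closedBall x₀
  have hev1 : ∀ᶠ m in atTop, |δ m| * R < η / 2 := by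
    have : Tendsto (fun m => |δ m| * R) atTop (𝓝 (|0| * R)) := hδ0.abs.mul_const R
    rw [abs_zero, zero_mul] at this
    exact this.eventually_lt_const (by positivity)
  have hev2 : ∀ᶠ m in atTop, (ρ m).rOut < η / 2 := hρ.eventually_lt_const (by positivity)
  filter_upwards [hev1, hev2] with m hm1 hm2
  set T := dilatedMollify ((ρ m).normed volume) (δ m) x₀ with hT
  have hρc := (ρ m).contDiff_normed (μ := volume) (n := ⊤)
  have hρs := (ρ m).hasCompactSupport_normed (μ := volume)
  have hgl : LocallyIntegrable g := hg.locallyIntegrable (by norm_num)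
  have hg₀l : LocallyIntegrable g₀ := hg₀L.locallyIntegrable (by norm_num)
  have hsub : MemLp (g - g₀) 2 volume := hg.sub hg₀L
  have hlin : ∀ x, T g x = T (g - g₀) x + T g₀ x := fun x => by
    simp only [hT, dilatedMollify, Pi.sub_apply, sub_mul]
    rw [integral_sub (integrable_mul_mollifier hρc.continuous hρs hgl _)
      (integrable_mul_mollifier hρc.continuous hρs hg₀l _)]
    ring
  have hsplit : (fun x => T g x - g x) =
      T (g - g₀) + ((fun x => T g₀ x - g₀ x) + (fun x => -(g - g₀) x)) := by
    ext x
    simp only [Pi.add_apply, hlin x, Pi.sub_apply]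
    ring
  have hTc : ∀ {u : E d → ℝ}, LocallyIntegrable u → Continuous (T u) := fun hu =>
    (contDiff_dilatedMollify hρc hρs (δ m) x₀ hu).continuous
  have hTm := (hTc (hsub.locallyIntegrable (by norm_num))).aestronglyMeasurable
    (μ := volume.restrict U)
  have hTm₀ := ((hTc hg₀l).sub hg₀).aestronglyMeasurable (μ := volume.restrict U)
  have hsm := (hsub.1.neg).mono_measure (Measure.restrict_le_self (s := U))
  have b1 : eLpNorm (T (g - g₀)) 2 (volume.restrict U) ≤ C * η₁ :=
    (eLpNorm_mono_measure _ Measure.restrict_le_self).trans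
      ((eLpNorm_dilatedMollify_le (ρ m) (hδ m) x₀ hsub.1).trans (mul_le_mul_right hg₀n _))
  have b2 : eLpNorm (fun x => T g₀ x - g₀ x) 2 (volume.restrict U) ≤ κ * M := by
    rw [mul_comm]
    refine (eLpNorm_le_of_ae_bound (C := κ) ?_).trans (by rw [ENNReal.ofReal_coe_nnreal])
    filter_upwards [ae_restrict_mem hUm] with x hx
    have hxR : ‖x₀ - x‖ ≤ R := by
      have := hR hx
      rwa [Metric.mem_closedBall, dist_comm, dist_eq_norm] at this
    have := dist_dilatedMollify_le (ρ := ρ m) (x₀ := x₀) hg₀ (fun y z h => hη' h) hxR hm1 hm2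
    rw [dist_eq_norm] at this
    linarith
  have b3 : eLpNorm (fun x => -(g - g₀) x) 2 (volume.restrict U) ≤ η₁ := by
    change eLpNorm (-(g - g₀)) 2 _ ≤ _
    rw [eLpNorm_neg]
    exact (eLpNorm_mono_measure _ Measure.restrict_le_self).trans hg₀n
  rw [hsplit]
  refine (eLpNorm_add_le hTm (hTm₀.add hsm) (by norm_num)).trans ?_
  refine (add_le_add b1 ((eLpNorm_add_le hTm₀ hsm (by norm_num)).trans (add_le_add b2 b3))).trans ?_
  calc C * η₁ + (κ * M + η₁) = η₁ * (C + 1) + κ * M := by ring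
    _ ≤ ε / 2 + ε / 2 := add_le_add hη₁'.le hκ'.le
    _ = ε := ENNReal.add_halves ε

end

end FSI

/-! ### Smooth approximation on a simplex by contraction and mollification -/

namespace FSI

noncomputable section

variable {d : ℕ} {K K' F : Finset (E d)} {f : E d → ℝ}

/-- The functions `φ m` are smooth up to the boundary and converge to `f` in `H¹(K)`. -/
structure IsSmoothApprox (K : Finset (E d)) (f : E d → ℝ) (φ : ℕ → E d → ℝ) : Prop where
  contDiff : ∀ m, ContDiff ℝ ∞ (φ m)
  tendsto : Tendsto (fun m => eLpNorm (fun x => φ m x - f x) 2 (volume.restrict (openHull K)))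
    atTop (𝓝 0)
  tendsto_partialDeriv : ∀ i, Tendsto (fun m => eLpNorm
    (fun x => partialDeriv i (φ m) x - weakPartial (openHull K) i f x) 2
    (volume.restrict (openHull K))) atTop (𝓝 0)

/-- Smooth functions are dense in `H¹` of a simplex. -/
theorem exists_isSmoothApprox (hK : IsSimplex K) (hf : MemH1 (openHull K) f) :
    ∃ φ, IsSmoothApprox K f φ := by
  set U := openHull K with hU
  have hUo : IsOpen U := isOpen_openHull K
  have hUm := hUo.measurableSet
  have hUb : Bornology.IsBounded U := (isCompact_hull K).isBounded.subset (openHull_subset_hull K)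
  have hUc : Convex ℝ U := (convex_hull K).interior
  obtain ⟨x₀, hx₀⟩ := hK.openHull_nonempty
  obtain ⟨r, hr, hrU⟩ := Metric.nhds_basis_closedBall.mem_iff.1 (hUo.mem_nhds hx₀)
  -- The shift of the index keeps δ m ≤ 1 / 2, as the uniform operator bound requires.
  set δ : ℕ → ℝ := fun m => 1 / ((m + 1 : ℕ) + 1 : ℝ) with hδdef
  have hδpos : ∀ m, 0 < δ m := fun m => by positivity
  have hδhalf : ∀ m, δ m ≤ 1 / 2 := fun m => by
    rw [hδdef]
    refine one_div_le_one_div_of_le (by norm_num) ?_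
    push_cast
    linarith [(Nat.cast_nonneg m : (0 : ℝ) ≤ m)]
  have hδ0 : Tendsto δ atTop (𝓝 0) :=
    (tendsto_add_atTop_iff_nat 1).2 (tendsto_one_div_add_atTop_nhds_zero_nat (𝕜 := ℝ))
  -- The outer radius δ m * r fits the contraction: by convexity of U the ball of this radius around
  -- (1 - δ m) x + δ m x₀ lies in U whenever x does.
  let ρ : ℕ → ContDiffBump (0 : E d) := fun m =>
    ⟨δ m * r / 2, δ m * r, by have := hδpos m; positivity, by have := hδpos m; nlinarith⟩
  have hρ0 : Tendsto (fun m => (ρ m).rOut) atTop (𝓝 0) := by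
    have := hδ0.mul_const r
    rwa [zero_mul] at this
  have hind : ∀ {u : E d → ℝ}, MemLp u 2 (volume.restrict U) → MemLp (U.indicator u) 2 volume :=
    fun hu => (memLp_indicator_iff_restrict hUm).2 hu
  have hcongr : ∀ (u : E d → ℝ), U.indicator u =ᵐ[volume.restrict U] u := fun u =>
    indicator_ae_eq_restrict hUm
  have hfl : LocallyIntegrable (U.indicator f) := (hind hf.memLp).locallyIntegrable (by norm_num)
  have hsmooth : ∀ m, ContDiff ℝ ∞ ((ρ m).normed volume) := fun m =>
    (ρ m).contDiff_normed (n := ⊤)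
  have hsupp : ∀ m, HasCompactSupport ((ρ m).normed volume) := fun m =>
    (ρ m).hasCompactSupport_normed
  have hconv : ∀ {u : E d → ℝ}, MemLp u 2 (volume.restrict U) →
      Tendsto (fun m => eLpNorm (fun x => dilatedMollify ((ρ m).normed volume) (δ m) x₀
        (U.indicator u) x - u x) 2 (volume.restrict U)) atTop (𝓝 0) := fun {u} hu => by
    refine (tendsto_dilatedMollify hδhalf hδ0 hρ0 x₀ hUb hUm (hind hu)).congr fun m => ?_
    refine eLpNorm_congr_ae ?_
    filter_upwards [hcongr u] with x hx
    rw [hx]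
  refine ⟨fun m => dilatedMollify ((ρ m).normed volume) (δ m) x₀ (U.indicator f),
    fun m => contDiff_dilatedMollify (hsmooth m) (hsupp m) _ _ hfl, hconv hf.memLp, fun i => ?_⟩
  set g := weakPartial U i f with hg
  have hgL := hf.memLp_weakPartial i
  have hgl : LocallyIntegrable (U.indicator g) := (hind hgL).locallyIntegrable (by norm_num)
  have hder : ∀ m, ∀ x ∈ U,
      partialDeriv i (dilatedMollify ((ρ m).normed volume) (δ m) x₀ (U.indicator f)) x =
      (1 - δ m) * dilatedMollify ((ρ m).normed volume) (δ m) x₀ (U.indicator g) x := by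
    intro m x hx
    rw [partialDeriv_dilatedMollify (hsmooth m) (hsupp m) _ _ hfl]
    congr 1
    refine dilatedMollify_weak hUm (hsmooth m) (hsupp m) (hf.isWeakPartial i) fun t ht => ?_
    rw [(ρ m).tsupport_normed_eq, mem_closedBall_zero_iff] at ht
    change _ ≤ δ m * r at ht
    have hδm := hδpos m
    -- The point t is (1 - δ m) x + δ m y with this y, which lies in the ball of radius r around x₀.
    have hy : x₀ + (δ m)⁻¹ • (t - (x + δ m • (x₀ - x))) ∈ U := by
      apply hrU
      rw [mem_closedBall_iff_norm, add_sub_cancel_left, norm_smul, norm_inv,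
        Real.norm_of_nonneg hδm.le, norm_sub_rev, inv_mul_le_iff₀ hδm]
      exact ht
    have := hUc.add_smul_sub_mem hx hy (t := δ m) ⟨hδm.le, (hδhalf m).trans (by norm_num)⟩
    convert this using 1
    rw [smul_sub, smul_add, smul_smul, mul_inv_cancel₀ hδm.ne']
    module
  have hlim : Tendsto (fun m => eLpNorm (fun x => dilatedMollify ((ρ m).normed volume) (δ m) x₀
        (U.indicator g) x - g x) 2 (volume.restrict U) +
        ENNReal.ofReal (δ m) * eLpNorm g 2 (volume.restrict U)) atTop (𝓝 0) := by
    have h1 : Tendsto (fun m => ENNReal.ofReal (δ m) * eLpNorm g 2 (volume.restrict U)) atTop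
        (𝓝 (0 * eLpNorm g 2 (volume.restrict U))) := by
      refine ENNReal.Tendsto.mul_const ?_ (Or.inr hgL.eLpNorm_ne_top)
      rw [← ENNReal.ofReal_zero]
      exact (ENNReal.continuous_ofReal.tendsto 0).comp hδ0
    have h2 := (hconv hgL).add h1
    rwa [zero_mul, add_zero] at h2
  refine tendsto_of_tendsto_of_tendsto_of_le_of_le tendsto_const_nhds hlim (fun _ => zero_le)
    fun m => ?_
  have hTm : AEStronglyMeasurable (dilatedMollify ((ρ m).normed volume) (δ m) x₀ (U.indicator g))
      (volume.restrict U) :=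
    (contDiff_dilatedMollify (hsmooth m) (hsupp m) _ _ hgl).continuous.aestronglyMeasurable
  -- From (1 - δ) G - g = (1 - δ)(G - g) - δ g, where G is the contracted mollification of g: the
  -- chain rule factor is harmless in the limit.
  have hsplit : (fun x => partialDeriv i (dilatedMollify ((ρ m).normed volume) (δ m) x₀
      (U.indicator f)) x - g x) =ᵐ[volume.restrict U]
      (1 - δ m) • (fun x => dilatedMollify ((ρ m).normed volume) (δ m) x₀ (U.indicator g) x - g x)
        - (δ m) • g := by
    filter_upwards [ae_restrict_mem hUm] with x hx
    simp only [hder m x hx, Pi.sub_apply, Pi.smul_apply, smul_eq_mul]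
    ring
  have hδm := hδpos m
  have hδm' := hδhalf m
  simp only
  rw [eLpNorm_congr_ae hsplit]
  refine (eLpNorm_sub_le ((hTm.sub hgL.1).const_smul _) (hgL.1.const_smul _) (by norm_num)).trans ?_
  rw [eLpNorm_const_smul, eLpNorm_const_smul, Real.enorm_of_nonneg (by linarith),
    Real.enorm_of_nonneg hδm.le]
  refine add_le_add (mul_le_of_le_one_left zero_le ?_) le_rfl
  rw [ENNReal.ofReal_le_one]
  linarith

end

end FSI

namespace FSI

noncomputable section

variable {d : ℕ} {K K' F : Finset (E d)} {f f' g : E d → ℝ}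

/-! ### Limits in `L²` -/

/-- By Hölder's inequality the products converge in L¹. -/
theorem tendsto_integral_mul_of_eLpNorm {ι : Type*} {l : Filter ι} {μ : Measure (E d)}
    {φ : ι → E d → ℝ} (hφ : ∀ m, MemLp (φ m) 2 μ) (hf : MemLp f 2 μ) (hg : MemLp g 2 μ)
    (h : Tendsto (fun m => eLpNorm (fun x => φ m x - f x) 2 μ) l (𝓝 0)) :
    Tendsto (fun m => ∫ x, φ m x * g x ∂μ) l (𝓝 (∫ x, f x * g x ∂μ)) := by
  refine tendsto_integral_of_L1' _ (MemLp.integrable_mul_two hf hg).1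
    (Eventually.of_forall fun m => MemLp.integrable_mul_two (hφ m) hg) ?_
  have h1 : Tendsto (fun m => eLpNorm (fun x => φ m x - f x) 2 μ * eLpNorm g 2 μ) l
      (𝓝 (0 * eLpNorm g 2 μ)) := ENNReal.Tendsto.mul_const h (Or.inr hg.eLpNorm_ne_top)
  rw [zero_mul] at h1
  refine tendsto_of_tendsto_of_tendsto_of_le_of_le tendsto_const_nhds h1 (fun _ => zero_le)
    fun m => ?_
  have h2 := eLpNorm_smul_le_mul_eLpNorm (p := 2) (q := 2) (r := 1) hg.1 ((hφ m).sub hf).1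
  refine le_trans (le_of_eq ?_) h2
  refine eLpNorm_congr_ae (Eventually.of_forall fun x => ?_)
  simp only [Pi.sub_apply, smul_eq_mul, Pi.smul_apply', sub_mul]

theorem toReal_eLpNorm_two_sq {μ : Measure (E d)} (hf : MemLp f 2 μ) :
    (eLpNorm f 2 μ).toReal ^ 2 = ∫ x, f x ^ 2 ∂μ := by
  have h0 : 0 ≤ ∫ x, f x ^ 2 ∂μ := integral_nonneg fun x => sq_nonneg _
  rw [hf.eLpNorm_eq_integral_rpow_norm (by norm_num) (by norm_num)]
  simp only [ENNReal.toReal_ofNat, Real.rpow_two, Real.norm_eq_abs, sq_abs]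
  rw [ENNReal.toReal_ofReal (by positivity), ← Real.rpow_natCast, ← Real.rpow_mul h0]
  norm_num

theorem memLp_surf_of_continuous (hd : 0 < d) (hK : IsSimplex K) (hF : F ∈ facets K)
    (hf : Continuous f) : MemLp f 2 (surf F) := by
  have := isFiniteMeasure_surf hd hK hF
  obtain ⟨C, hC⟩ := (isCompact_hull F).exists_bound_of_continuousOn hf.continuousOn
  refine MemLp.of_bound hf.aestronglyMeasurable C ?_
  have h5 : ∀ᵐ x ∂(surf F), x ∈ hull F := ae_restrict_mem (measurableSet_hull F)
  filter_upwards [h5] with x hx using hC x hx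

/-! ### The trace operator -/

/-- The norm of `H¹(K)`. -/
def sobNorm (K : Finset (E d)) (f : E d → ℝ) : ENNReal :=
  eLpNorm f 2 (volume.restrict (openHull K)) +
    ∑ i, eLpNorm (weakPartial (openHull K) i f) 2 (volume.restrict (openHull K))

theorem sobNorm_sub_le (hf : MemH1 (openHull K) f) (hg : MemH1 (openHull K) g) :
    sobNorm K (fun x => f x - g x) ≤ sobNorm K f + sobNorm K g := by
  rw [sobNorm, sobNorm, sobNorm, add_add_add_comm, ← Finset.sum_add_distrib]
  refine add_le_add (eLpNorm_sub_le hf.1.1 hg.1.1 (by norm_num)) (Finset.sum_le_sum fun i _ => ?_)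
  rw [eLpNorm_congr_ae (weakPartial_sub (isOpen_openHull K) hf hg i)]
  exact eLpNorm_sub_le (hf.memLp_weakPartial i).1 (hg.memLp_weakPartial i).1 (by norm_num)

theorem contDiff_one_of_smooth {φ : E d → ℝ} (h : ContDiff ℝ ∞ φ) : ContDiff ℝ 1 φ :=
  h.of_le (by norm_cast)

theorem memH1_of_smooth {φ : E d → ℝ} (h : ContDiff ℝ ∞ φ) (K : Finset (E d)) :
    MemH1 (openHull K) φ := memH1_of_contDiff (contDiff_one_of_smooth h) K

/-- Passes from squared integrals to norms, using b² + ∑ cᵢ² ≤ (b + ∑ cᵢ)² for nonnegative numbers.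
-/
theorem exists_trace_bound_sobNorm (hd : 0 < d) (hK : IsSimplex K) (hF : F ∈ facets K) :
    ∃ C : ENNReal, C ≠ ⊤ ∧ ∀ φ : E d → ℝ, ContDiff ℝ ∞ φ →
      eLpNorm φ 2 (surf F) ≤ C * sobNorm K φ := by
  obtain ⟨C, hC0, hC⟩ := exists_trace_bound_smooth hd hK hF
  refine ⟨ENNReal.ofReal (Real.sqrt C), ENNReal.ofReal_ne_top, fun φ hφ => ?_⟩
  have hφ1 := contDiff_one_of_smooth hφ
  have hm := memLp_of_continuous_hull hφ.continuous K
  have hmp := fun i => memLp_of_continuous_hull (continuous_partialDeriv hφ1 one_ne_zero i) K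
  have hms := memLp_surf_of_continuous hd hK hF hφ.continuous
  have h1 := hC φ hφ
  have h2 : ∀ i, eLpNorm (weakPartial (openHull K) i φ) 2 (volume.restrict (openHull K)) =
      eLpNorm (partialDeriv i φ) 2 (volume.restrict (openHull K)) := fun i =>
    eLpNorm_congr_ae (weakPartial_of_contDiff hφ1 K i)
  rw [← toReal_eLpNorm_two_sq hms, ← toReal_eLpNorm_two_sq hm,
    Finset.sum_congr rfl fun i _ => (toReal_eLpNorm_two_sq (hmp i)).symm] at h1
  rw [sobNorm, Finset.sum_congr rfl fun i _ => h2 i]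
  set a := eLpNorm φ 2 (surf F)
  set b := eLpNorm φ 2 (volume.restrict (openHull K))
  set c := fun i => eLpNorm (partialDeriv i φ) 2 (volume.restrict (openHull K))
  have ha : a ≠ ⊤ := hms.eLpNorm_ne_top
  have hb : b ≠ ⊤ := hm.eLpNorm_ne_top
  have hc : ∀ i, c i ≠ ⊤ := fun i => (hmp i).eLpNorm_ne_top
  have h3 : a.toReal ≤ Real.sqrt C * (b.toReal + ∑ i, (c i).toReal) := by
    have hs : 0 ≤ ∑ i, (c i).toReal := Finset.sum_nonneg fun i _ => ENNReal.toReal_nonneg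
    have hb0 : 0 ≤ b.toReal := ENNReal.toReal_nonneg
    refine (sq_le_sq₀ ENNReal.toReal_nonneg
      (mul_nonneg (Real.sqrt_nonneg C) (add_nonneg hb0 hs))).1 ?_
    rw [mul_pow, Real.sq_sqrt hC0]
    refine h1.trans (mul_le_mul_of_nonneg_left ?_ hC0)
    have h4 : ∑ i, (c i).toReal ^ 2 ≤ (∑ i, (c i).toReal) ^ 2 :=
      Finset.sum_sq_le_sq_sum_of_nonneg fun i _ => ENNReal.toReal_nonneg
    nlinarith [mul_nonneg hb0 hs]
  rw [← ENNReal.ofReal_toReal ha]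
  refine (ENNReal.ofReal_le_ofReal h3).trans (le_of_eq ?_)
  rw [ENNReal.ofReal_mul (Real.sqrt_nonneg C), ENNReal.ofReal_add ENNReal.toReal_nonneg
    (Finset.sum_nonneg fun i _ => ENNReal.toReal_nonneg), ENNReal.ofReal_toReal hb,
    ENNReal.ofReal_sum_of_nonneg fun i _ => ENNReal.toReal_nonneg]
  simp only [ENNReal.ofReal_toReal (hc _)]

theorem IsSmoothApprox.tendsto_sobNorm {φ : ℕ → E d → ℝ} (h : IsSmoothApprox K f φ)
    (hf : MemH1 (openHull K) f) :
    Tendsto (fun m => sobNorm K (fun x => φ m x - f x)) atTop (𝓝 0) := by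
  have h1 : ∀ i, Tendsto (fun m => eLpNorm (weakPartial (openHull K) i (fun x => φ m x - f x)) 2
      (volume.restrict (openHull K))) atTop (𝓝 0) := fun i => by
    refine (h.tendsto_partialDeriv i).congr fun m => eLpNorm_congr_ae ?_
    have hm1 := contDiff_one_of_smooth (h.contDiff m)
    filter_upwards [weakPartial_sub (isOpen_openHull K) (memH1_of_contDiff hm1 K) hf i,
      weakPartial_of_contDiff hm1 K i] with x hx hx'
    rw [hx, hx']
  have h2 := h.tendsto.add (tendsto_finsetSum Finset.univ fun i _ => h1 i)
  simpa [sobNorm] using h2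

theorem tendsto_surf_of_tendsto_sobNorm (hd : 0 < d) (hK : IsSimplex K) (hF : F ∈ facets K)
    {ι : Type*} {l : Filter ι} {φ : ι → E d → ℝ} (hφ : ∀ m, ContDiff ℝ ∞ (φ m))
    (h : Tendsto (fun m => sobNorm K (φ m)) l (𝓝 0)) :
    Tendsto (fun m => eLpNorm (φ m) 2 (surf F)) l (𝓝 0) := by
  obtain ⟨C, hC, hb⟩ := exists_trace_bound_sobNorm hd hK hF
  have h1 : Tendsto (fun m => C * sobNorm K (φ m)) l (𝓝 (C * 0)) :=
    ENNReal.Tendsto.const_mul h (Or.inr hC)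
  rw [mul_zero] at h1
  exact tendsto_of_tendsto_of_tendsto_of_le_of_le tendsto_const_nhds h1 (fun _ => zero_le)
    fun m => hb _ (hφ m)

/-- The two independent index maps serve both the Cauchy property of one approximating sequence and
the comparison of two sequences. -/
theorem IsSmoothApprox.tendsto_sub {φ ψ : ℕ → E d → ℝ} (hf : MemH1 (openHull K) f)
    (h : IsSmoothApprox K f φ) (h' : IsSmoothApprox K f ψ) {ι : Type*} {l : Filter ι}
    {a b : ι → ℕ} (ha : Tendsto a l atTop) (hb : Tendsto b l atTop) :
    Tendsto (fun m => sobNorm K (fun x => φ (a m) x - ψ (b m) x)) l (𝓝 0) := by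
  have h1 := ((h.tendsto_sobNorm hf).comp ha).add ((h'.tendsto_sobNorm hf).comp hb)
  rw [add_zero] at h1
  refine tendsto_of_tendsto_of_tendsto_of_le_of_le tendsto_const_nhds h1 (fun _ => zero_le)
    fun m => ?_
  have h2 := sobNorm_sub_le ((memH1_of_smooth (h.contDiff (a m)) K).sub hf)
    ((memH1_of_smooth (h'.contDiff (b m)) K).sub hf)
  refine le_trans (le_of_eq ?_) h2
  simp only [sub_sub_sub_cancel_right]

/-- Smooth approximations in `H¹(K)` converge in `L²` of the facets. -/
theorem IsSmoothApprox.exists_isTrace (hd : 0 < d) (hK : IsSimplex K) (hF : F ∈ facets K)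
    (hf : MemH1 (openHull K) f) {φ : ℕ → E d → ℝ} (h : IsSmoothApprox K f φ) :
    ∃ g, IsTrace K F f g := by
  have hL : ∀ m, MemLp (φ m) 2 (surf F) := fun m =>
    memLp_surf_of_continuous hd hK hF (h.contDiff m).continuous
  have hcau : CauchySeq fun m => (hL m).toLp (φ m) := by
    rw [Lp.cauchySeq_Lp_iff_cauchySeq_eLpNorm]
    have h1 : Tendsto (fun n : ℕ × ℕ => sobNorm K (fun x => φ n.1 x - φ n.2 x)) atTop (𝓝 0) := by
      rw [← prod_atTop_atTop_eq]
      exact IsSmoothApprox.tendsto_sub hf h h tendsto_fst tendsto_snd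
    refine (tendsto_surf_of_tendsto_sobNorm hd hK hF
      (fun n : ℕ × ℕ => (h.contDiff n.1).sub (h.contDiff n.2)) h1).congr fun n => ?_
    exact eLpNorm_congr_ae (((hL n.1).coeFn_toLp.sub (hL n.2).coeFn_toLp).symm)
  obtain ⟨g, hg⟩ := cauchySeq_tendsto_of_complete hcau
  refine ⟨g, Lp.memLp g, φ, h.contDiff, h.tendsto, h.tendsto_partialDeriv, ?_⟩
  have h2 := (Lp.tendsto_Lp_iff_tendsto_eLpNorm'' φ hL g (Lp.memLp g)).1 (by
    rwa [Lp.toLp_coeFn])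
  exact h2

/-- Density of smooth functions shows that the default value of `trace` does not occur on H¹. -/
theorem trace_spec (hd : 0 < d) (hK : IsSimplex K) (hF : F ∈ facets K)
    (hf : MemH1 (openHull K) f) : IsTrace K F f (trace K F f) := by
  obtain ⟨φ, hφ⟩ := exists_isSmoothApprox hK hf
  have h : MemH1 (openHull K) f ∧ ∃ g, IsTrace K F f g :=
    ⟨hf, hφ.exists_isTrace hd hK hF hf⟩
  rw [trace, dif_pos h]
  exact h.2.choose_spec

theorem memLp_trace (hd : 0 < d) (hK : IsSimplex K) (hF : F ∈ facets K)
    (hf : MemH1 (openHull K) f) : MemLp (trace K F f) 2 (surf F) := (trace_spec hd hK hF hf).1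

/-- Every smooth approximation converges to the trace. -/
theorem IsSmoothApprox.tendsto_trace (hd : 0 < d) (hK : IsSimplex K) (hF : F ∈ facets K)
    (hf : MemH1 (openHull K) f) {φ : ℕ → E d → ℝ} (h : IsSmoothApprox K f φ) :
    Tendsto (fun m => eLpNorm (fun x => φ m x - trace K F f x) 2 (surf F)) atTop (𝓝 0) := by
  obtain ⟨hL, ψ, h1, h2, h3, h4⟩ := trace_spec hd hK hF hf
  have hψ : IsSmoothApprox K f ψ := ⟨h1, h2, h3⟩
  have h5 := (tendsto_surf_of_tendsto_sobNorm hd hK hF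
    (fun n : ℕ => (h.contDiff n).sub (h1 n))
    (IsSmoothApprox.tendsto_sub hf h hψ tendsto_id tendsto_id)).add h4
  rw [add_zero] at h5
  refine tendsto_of_tendsto_of_tendsto_of_le_of_le tendsto_const_nhds h5 (fun _ => zero_le)
    fun m => ?_
  have h6 := eLpNorm_add_le (μ := surf F) (p := 2) (f := fun x => φ m x - ψ m x)
    (g := fun x => ψ m x - trace K F f x)
    ((h.contDiff m).continuous.sub (h1 m).continuous).aestronglyMeasurable
    ((h1 m).continuous.aestronglyMeasurable.sub hL.1) (by norm_num)
  refine le_trans (le_of_eq (eLpNorm_congr_ae (Eventually.of_forall fun x => ?_))) h6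
  simp

/-- Limits in L²(F) are unique, so a trace can be computed from any one approximating sequence. The
algebraic rules for traces are all obtained in this way. -/
theorem IsSmoothApprox.trace_ae_eq (hd : 0 < d) (hK : IsSimplex K) (hF : F ∈ facets K)
    (hf : MemH1 (openHull K) f) {φ : ℕ → E d → ℝ} (h : IsSmoothApprox K f φ)
    (hg : MemLp g 2 (surf F))
    (h' : Tendsto (fun m => eLpNorm (fun x => φ m x - g x) 2 (surf F)) atTop (𝓝 0)) :
    trace K F f =ᵐ[surf F] g := by
  have hL := memLp_trace hd hK hF hf
  have hm : ∀ m, AEStronglyMeasurable (φ m) (surf F) := fun m =>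
    (h.contDiff m).continuous.aestronglyMeasurable
  have h1 := (h.tendsto_trace hd hK hF hf).add h'
  rw [add_zero] at h1
  have h2 : eLpNorm (trace K F f - g) 2 (surf F) ≤ 0 := by
    refine ge_of_tendsto' h1 fun m => ?_
    have h6 := eLpNorm_sub_le (μ := surf F) (p := 2) ((hm m).sub hg.1) ((hm m).sub hL.1)
      (by norm_num)
    rw [add_comm]
    refine le_trans (le_of_eq (eLpNorm_congr_ae (Eventually.of_forall fun x => ?_))) h6
    simp
  have h3 := (eLpNorm_eq_zero_iff (hL.1.sub hg.1) (by norm_num)).1 (le_antisymm h2 zero_le)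
  filter_upwards [h3] with x hx
  exact sub_eq_zero.1 hx

theorem IsSmoothApprox.congr {φ : ℕ → E d → ℝ} (h : IsSmoothApprox K f φ)
    (hf : MemH1 (openHull K) f) (hff : f =ᵐ[volume.restrict (openHull K)] f') :
    IsSmoothApprox K f' φ := by
  refine ⟨h.contDiff, h.tendsto.congr fun m => eLpNorm_congr_ae ?_, fun i =>
    (h.tendsto_partialDeriv i).congr fun m => eLpNorm_congr_ae ?_⟩
  · filter_upwards [hff] with x hx
    rw [hx]
  · filter_upwards [weakPartial_congr (isOpen_openHull K) hf hff i] with x hx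
    rw [hx]

theorem trace_congr (hd : 0 < d) (hK : IsSimplex K) (hF : F ∈ facets K)
    (hf : MemH1 (openHull K) f) (hff : f =ᵐ[volume.restrict (openHull K)] f') :
    trace K F f' =ᵐ[surf F] trace K F f := by
  obtain ⟨φ, hφ⟩ := exists_isSmoothApprox hK hf
  exact (hφ.congr hf hff).trace_ae_eq hd hK hF (hf.congr hff) (memLp_trace hd hK hF hf)
    (hφ.tendsto_trace hd hK hF hf)

theorem tendsto_eLpNorm_of_sobNorm {ψ : ℕ → E d → ℝ} (hψ : ∀ m, ContDiff ℝ ∞ (ψ m))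
    (hf : MemH1 (openHull K) f)
    (h : Tendsto (fun m => sobNorm K (fun x => ψ m x - f x)) atTop (𝓝 0)) :
    IsSmoothApprox K f ψ := by
  refine ⟨hψ, tendsto_of_tendsto_of_tendsto_of_le_of_le tendsto_const_nhds h (fun _ => zero_le)
    fun m => le_self_add, fun i => ?_⟩
  refine tendsto_of_tendsto_of_tendsto_of_le_of_le tendsto_const_nhds h (fun _ => zero_le)
    fun m => ?_
  have hm1 := contDiff_one_of_smooth (hψ m)
  have h1 : (fun x => partialDeriv i (ψ m) x - weakPartial (openHull K) i f x)
      =ᵐ[volume.restrict (openHull K)] weakPartial (openHull K) i (fun x => ψ m x - f x) := by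
    filter_upwards [weakPartial_sub (isOpen_openHull K) (memH1_of_contDiff hm1 K) hf i,
      weakPartial_of_contDiff hm1 K i] with x hx hx'
    rw [hx, hx']
  simp only
  rw [eLpNorm_congr_ae h1]
  exact (Finset.single_le_sum (f := fun i => eLpNorm (weakPartial (openHull K) i
    (fun x => ψ m x - f x)) 2 (volume.restrict (openHull K))) (fun _ _ => zero_le)
    (Finset.mem_univ i)).trans le_add_self

theorem trace_sub (hd : 0 < d) (hK : IsSimplex K) (hF : F ∈ facets K)
    (hf : MemH1 (openHull K) f) (hf' : MemH1 (openHull K) f') :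
    trace K F (fun x => f x - f' x) =ᵐ[surf F] fun x => trace K F f x - trace K F f' x := by
  obtain ⟨φ, hφ⟩ := exists_isSmoothApprox hK hf
  obtain ⟨φ', hφ'⟩ := exists_isSmoothApprox hK hf'
  have happ : IsSmoothApprox K (fun x => f x - f' x) (fun m x => φ m x - φ' m x) := by
    refine tendsto_eLpNorm_of_sobNorm (fun m => (hφ.contDiff m).sub (hφ'.contDiff m))
      (hf.sub hf') ?_
    have h1 := (hφ.tendsto_sobNorm hf).add (hφ'.tendsto_sobNorm hf')
    rw [add_zero] at h1
    refine tendsto_of_tendsto_of_tendsto_of_le_of_le tendsto_const_nhds h1 (fun _ => zero_le)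
      fun m => ?_
    have h2 := sobNorm_sub_le ((memH1_of_smooth (hφ.contDiff m) K).sub hf)
      ((memH1_of_smooth (hφ'.contDiff m) K).sub hf')
    refine le_trans (le_of_eq ?_) h2
    simp only [sub_sub_sub_comm]
  have hL := memLp_trace hd hK hF hf
  have hL' := memLp_trace hd hK hF hf'
  refine happ.trace_ae_eq hd hK hF (hf.sub hf') (hL.sub hL') ?_
  have h1 := (hφ.tendsto_trace hd hK hF hf).add (hφ'.tendsto_trace hd hK hF hf')
  rw [add_zero] at h1
  refine tendsto_of_tendsto_of_tendsto_of_le_of_le tendsto_const_nhds h1 (fun _ => zero_le)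
    fun m => ?_
  have h2 := eLpNorm_sub_le (μ := surf F) (p := 2)
    (((hφ.contDiff m).continuous.aestronglyMeasurable).sub hL.1)
    (((hφ'.contDiff m).continuous.aestronglyMeasurable).sub hL'.1) (by norm_num)
  refine le_trans (le_of_eq (eLpNorm_congr_ae (Eventually.of_forall fun x => ?_))) h2
  simp only [Pi.sub_apply]
  ring

theorem sobNorm_const_mul (hf : MemH1 (openHull K) f) (c : ℝ) :
    sobNorm K (fun x => c * f x) = ‖c‖ₑ * sobNorm K f := by
  rw [sobNorm, sobNorm, mul_add, Finset.mul_sum]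
  congr 1
  · exact eLpNorm_const_smul c f 2 _
  · refine Finset.sum_congr rfl fun i _ => ?_
    rw [eLpNorm_congr_ae (weakPartial_const_mul (isOpen_openHull K) hf c i)]
    exact eLpNorm_const_smul c _ 2 _

theorem trace_const_mul (hd : 0 < d) (hK : IsSimplex K) (hF : F ∈ facets K)
    (hf : MemH1 (openHull K) f) (c : ℝ) :
    trace K F (fun x => c * f x) =ᵐ[surf F] fun x => c * trace K F f x := by
  obtain ⟨φ, hφ⟩ := exists_isSmoothApprox hK hf
  have happ : IsSmoothApprox K (fun x => c * f x) (fun m x => c * φ m x) := by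
    refine tendsto_eLpNorm_of_sobNorm (fun m => contDiff_const.mul (hφ.contDiff m))
      (hf.const_mul c) ?_
    have h1 := ENNReal.Tendsto.const_mul (a := ‖c‖ₑ) (hφ.tendsto_sobNorm hf) (Or.inr enorm_ne_top)
    rw [mul_zero] at h1
    refine h1.congr fun m => ?_
    rw [← sobNorm_const_mul ((memH1_of_smooth (hφ.contDiff m) K).sub hf)]
    simp only [mul_sub]
  have hL := memLp_trace hd hK hF hf
  refine happ.trace_ae_eq hd hK hF (hf.const_mul c) (hL.const_mul c) ?_
  have h1 := ENNReal.Tendsto.const_mul (a := ‖c‖ₑ) (hφ.tendsto_trace hd hK hF hf)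
    (Or.inr enorm_ne_top)
  rw [mul_zero] at h1
  refine h1.congr fun m => ?_
  rw [← eLpNorm_const_smul]
  refine eLpNorm_congr_ae (Eventually.of_forall fun x => ?_)
  simp only [Pi.smul_apply, smul_eq_mul, mul_sub]

theorem trace_add (hd : 0 < d) (hK : IsSimplex K) (hF : F ∈ facets K)
    (hf : MemH1 (openHull K) f) (hf' : MemH1 (openHull K) f') :
    trace K F (fun x => f x + f' x) =ᵐ[surf F] fun x => trace K F f x + trace K F f' x := by
  have h1 := trace_sub hd hK hF hf (hf'.const_mul (-1))
  have h2 := trace_const_mul hd hK hF hf' (-1)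
  have h3 : (fun x => f x + f' x) = fun x => f x - -1 * f' x := by
    ext x
    ring
  rw [h3]
  filter_upwards [h1, h2] with x hx hx'
  rw [hx, hx']
  ring

/-- The constant sequence is an approximation. -/
theorem trace_smooth (hd : 0 < d) (hK : IsSimplex K) (hF : F ∈ facets K) {φ : E d → ℝ}
    (hφ : ContDiff ℝ ∞ φ) : trace K F φ =ᵐ[surf F] φ := by
  have h0 := memH1_of_smooth hφ K
  have happ : IsSmoothApprox K φ (fun _ => φ) := by
    refine ⟨fun _ => hφ, by simp, fun i => ?_⟩
    have h1 := weakPartial_of_contDiff (contDiff_one_of_smooth hφ) K i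
    refine tendsto_const_nhds.congr fun m => ?_
    rw [eq_comm, eLpNorm_congr_ae (g := fun _ => (0 : ℝ)), eLpNorm_zero']
    filter_upwards [h1] with x hx
    rw [hx, sub_self]
  exact happ.trace_ae_eq hd hK hF h0 (memLp_surf_of_continuous hd hK hF hφ.continuous) (by simp)

/-- The trace inequality. -/
theorem exists_trace_bound (hd : 0 < d) (hK : IsSimplex K) (hF : F ∈ facets K) :
    ∃ C : ENNReal, C ≠ ⊤ ∧ ∀ f : E d → ℝ, MemH1 (openHull K) f →
      eLpNorm (trace K F f) 2 (surf F) ≤ C * sobNorm K f := by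
  obtain ⟨C, hC, hb⟩ := exists_trace_bound_sobNorm hd hK hF
  refine ⟨C, hC, fun f hf => ?_⟩
  obtain ⟨φ, hφ⟩ := exists_isSmoothApprox hK hf
  have hL := memLp_trace hd hK hF hf
  have h1 := (hφ.tendsto_trace hd hK hF hf).add
    ((ENNReal.Tendsto.const_mul (hφ.tendsto_sobNorm hf) (Or.inr hC)).add_const
      (C * sobNorm K f))
  rw [mul_zero, zero_add, zero_add] at h1
  refine ge_of_tendsto' h1 fun m => ?_
  have hm := (hφ.contDiff m).continuous.aestronglyMeasurable (μ := surf F)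
  have h2 : eLpNorm (trace K F f) 2 (surf F) ≤
      eLpNorm (φ m) 2 (surf F) + eLpNorm (fun x => φ m x - trace K F f x) 2 (surf F) := by
    refine le_trans (le_of_eq (eLpNorm_congr_ae (Eventually.of_forall fun x => ?_)))
      (eLpNorm_sub_le hm (hm.sub hL.1) (by norm_num))
    simp
  have h3 : sobNorm K (φ m) ≤ sobNorm K (fun x => φ m x - f x) + sobNorm K f := by
    have hmf := (memH1_of_smooth (hφ.contDiff m) K).sub hf
    have h4 := sobNorm_sub_le hmf (hf.const_mul (-1))
    rw [sobNorm_const_mul hf] at h4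
    simpa using h4
  rw [add_comm]
  rw [add_comm] at h2
  refine h2.trans ?_
  rw [add_comm, ← mul_add]
  exact add_le_add ((hb _ (hφ.contDiff m)).trans (mul_le_mul_right h3 _)) le_rfl

/-- Green's formula on a simplex. -/
theorem integral_weakPartial_mul (hd : 0 < d) (hK : IsSimplex K) (hf : MemH1 (openHull K) f)
    {ψ : E d → ℝ} (hψ : ContDiff ℝ ∞ ψ) (i : Fin d) :
    (∫ x in openHull K, weakPartial (openHull K) i f x * ψ x) +
      ∫ x in openHull K, f x * partialDeriv i ψ x =
      ∑ F ∈ facets K, outwardNormal K F i * ∫ x, trace K F f x * ψ x ∂(surf F) := by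
  obtain ⟨φ, hφ⟩ := exists_isSmoothApprox hK hf
  have hψ1 := contDiff_one_of_smooth hψ
  have hmψ := memLp_of_continuous_hull hψ.continuous K
  have hmψ' := memLp_of_continuous_hull (continuous_partialDeriv hψ1 one_ne_zero i) K
  have hφ1 := fun m => contDiff_one_of_smooth (hφ.contDiff m)
  have hmφ := fun m => memLp_of_continuous_hull (hφ.contDiff m).continuous K
  have hmφ' := fun m => memLp_of_continuous_hull (continuous_partialDeriv (hφ1 m) one_ne_zero i) K
  -- For smooth functions this is the divergence theorem for the product φ m * ψ. All terms then
  -- pass to the limit, those on the facets by convergence to the trace.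
  have hs : ∀ m, (∫ x in openHull K, partialDeriv i (φ m) x * ψ x) +
      ∫ x in openHull K, φ m x * partialDeriv i ψ x =
      ∑ F ∈ facets K, outwardNormal K F i * ∫ x, φ m x * ψ x ∂(surf F) := fun m => by
    rw [← integral_partialDeriv hd hK ((hφ1 m).mul hψ1), ← integral_add
      (MemLp.integrable_mul_two (hmφ' m) hmψ) (MemLp.integrable_mul_two (hmφ m) hmψ')]
    refine integral_congr_ae (Eventually.of_forall fun x => ?_)
    exact (partialDeriv_mul ((hφ1 m).differentiable one_ne_zero x)
      (hψ1.differentiable one_ne_zero x)).symm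
  have h1 := (tendsto_integral_mul_of_eLpNorm hmφ' (hf.memLp_weakPartial i) hmψ
    (hφ.tendsto_partialDeriv i)).add
    (tendsto_integral_mul_of_eLpNorm hmφ hf.memLp hmψ' hφ.tendsto)
  have h2 := tendsto_finsetSum (facets K) fun F hF =>
    (tendsto_integral_mul_of_eLpNorm
      (fun m => memLp_surf_of_continuous hd hK hF (hφ.contDiff m).continuous)
      (memLp_trace hd hK hF hf) (memLp_surf_of_continuous hd hK hF hψ.continuous)
      (hφ.tendsto_trace hd hK hF hf)).const_mul (outwardNormal K F i)
  exact tendsto_nhds_unique (h1.congr hs) h2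

end

end FSI

namespace FSI

noncomputable section

variable {d : ℕ} {K K₁ K₂ F : Finset (E d)} {a₁ a₂ : E d}

/-! ### Simplices sharing a facet -/

/-- The simplices `K₁` and `K₂` meet exactly in their common facet `F`. -/
structure IsNeighbour (K₁ K₂ F : Finset (E d)) : Prop where
  left : IsSimplex K₁
  right : IsSimplex K₂
  mem_left : F ∈ facets K₁
  mem_right : F ∈ facets K₂
  inter : hull K₁ ∩ hull K₂ = hull F

theorem IsNeighbour.symm (h : IsNeighbour K₁ K₂ F) : IsNeighbour K₂ K₁ F :=
  ⟨h.right, h.left, h.mem_right, h.mem_left, by rw [inter_comm, h.inter]⟩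

/-- The coordinate of K₂ at a₂ vanishes on F, so among the vertices of K₁ only a₁ contributes: the
two coordinates are proportional. -/
theorem IsNeighbour.coord_eq (h : IsNeighbour K₁ K₂ F) (ha₁ : IsOpposite K₁ F a₁)
    (ha₂ : IsOpposite K₂ F a₂) (x : E d) :
    h.right.coord a₂ x = h.left.coord a₁ x * h.right.coord a₂ a₁ := by
  rw [h.left.affineMap_apply (h.right.coord a₂) x, sum_eq_insert ha₁, Finset.sum_eq_zero, add_zero]
  intro b hb
  rw [h.right.coord_of_ne (ha₂.subset hb) (ha₂.ne_of_mem hb), mul_zero]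

theorem IsNeighbour.coord_mul (h : IsNeighbour K₁ K₂ F) (ha₁ : IsOpposite K₁ F a₁)
    (ha₂ : IsOpposite K₂ F a₂) : h.left.coord a₁ a₂ * h.right.coord a₂ a₁ = 1 := by
  rw [← h.coord_eq ha₁ ha₂, h.right.coord_self ha₂.mem]

/-- The opposite vertices lie on different sides of F. Otherwise a point slightly off the centroid
of F in the direction of a₂ would belong to both simplices but not to F. -/
theorem IsNeighbour.coord_neg (hd : 0 < d) (h : IsNeighbour K₁ K₂ F) (ha₁ : IsOpposite K₁ F a₁)
    (ha₂ : IsOpposite K₂ F a₂) : h.left.coord a₁ a₂ < 0 := by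
  have hne : h.left.coord a₁ a₂ ≠ 0 := left_ne_zero_of_mul_eq_one (h.coord_mul ha₁ ha₂)
  by_contra hcon
  have hpos : 0 < h.left.coord a₁ a₂ := lt_of_le_of_ne (not_lt.1 hcon) hne.symm
  have hFne := facets_card_pos hd h.mem_left
  have hcard : 0 < (F.card : ℝ) := by exact_mod_cast Finset.card_pos.2 hFne
  set x : E d := ∑ b ∈ F, (F.card : ℝ)⁻¹ • b with hx
  have hw : ∑ b ∈ F, (fun _ : E d => (F.card : ℝ)⁻¹) b = 1 := by
    rw [Finset.sum_const, nsmul_eq_mul, mul_inv_cancel₀ hcard.ne']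
  have hxF : x ∈ hull F := (convex_hull F).sum_mem (fun b _ => by positivity) hw
    fun b hb => subset_convexHull ℝ _ hb
  have hxc : ∀ b ∈ F, 0 < h.left.coord b x := fun b hb => by
    rw [hx, affineMap_apply_sum _ F _ hw, Finset.sum_eq_single b]
    · rw [h.left.coord_self (ha₁.subset hb), mul_one]
      positivity
    · intro b' hb' hne
      rw [h.left.coord_of_ne (ha₁.subset hb') hne.symm, mul_zero]
    · exact fun h' => absurd hb h'
  have hev : ∀ᶠ t in 𝓝[>] (0 : ℝ), ∀ b ∈ F, 0 < h.left.coord b (conePoint x t a₂) := by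
    rw [Finset.eventually_all]
    intro b hb
    have hc : Continuous fun t : ℝ => h.left.coord b (conePoint x t a₂) := by
      simp only [h.left.coord_conePoint]
      fun_prop
    have h0 : 0 < h.left.coord b (conePoint x 0 a₂) := by
      simpa [conePoint_eq] using hxc b hb
    exact (hc.continuousAt.eventually_const_lt h0).filter_mono nhdsWithin_le_nhds
  obtain ⟨t, ht, ht0, ht1⟩ := (hev.and (Ioo_mem_nhdsGT (zero_lt_one (α := ℝ)))).exists
  have hxa : h.left.coord a₁ x = 0 := ((ha₁.mem_hull_iff h.left).1 hxF).2
  have hy : h.left.coord a₁ (conePoint x t a₂) = t * h.left.coord a₁ a₂ := by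
    rw [h.left.coord_conePoint, hxa, mul_zero, zero_add]
  have hy1 : conePoint x t a₂ ∈ hull K₁ := by
    rw [h.left.mem_hull_iff]
    intro b hb
    by_cases hba : b = a₁
    · rw [hba, hy]
      positivity
    · exact (ht b (ha₁.mem_of_ne b hb hba)).le
  have hy2 : conePoint x t a₂ ∈ hull K₂ := by
    rw [conePoint_eq]
    exact (convex_hull K₂).add_smul_sub_mem (convexHull_mono (Finset.coe_subset.2 ha₂.subset) hxF)
      (subset_convexHull ℝ _ ha₂.mem) ⟨ht0.le, ht1.le⟩
  have hyF : conePoint x t a₂ ∈ hull F := h.inter ▸ ⟨hy1, hy2⟩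
  have := ((ha₁.mem_hull_iff h.left).1 hyF).2
  rw [hy] at this
  exact (mul_pos ht0 hpos).ne' this

/-- Each normal represents, up to a negative factor, the linear part of the coordinate at the
opposite vertex. These coordinates are proportional with negative ratio, and both normals are unit
vectors. -/
theorem IsNeighbour.outwardNormal_eq_neg (hd : 0 < d) (h : IsNeighbour K₁ K₂ F) :
    outwardNormal K₂ F = -outwardNormal K₁ F := by
  obtain ⟨a₁, ha₁⟩ := h.left.exists_isOpposite h.mem_left
  obtain ⟨a₂, ha₂⟩ := h.right.exists_isOpposite h.mem_right
  obtain ⟨h₁, hh₁, hn₁, hb₁⟩ := exists_height hd h.left h.mem_left ha₁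
  obtain ⟨h₂, hh₂, hn₂, hb₂⟩ := exists_height hd h.right h.mem_right ha₂
  have hneg := h.symm.coord_neg hd ha₂ ha₁
  change h.right.coord a₂ a₁ < 0 at hneg
  set n₁ := outwardNormal K₁ F
  set n₂ := outwardNormal K₂ F
  set c := h₂ * h.right.coord a₂ a₁ / h₁ with hc
  have hc0 : c < 0 := div_neg_of_neg_of_pos (mul_neg_of_pos_of_neg hh₂ hneg) hh₁
  have key : n₂ = c • n₁ := by
    refine ext_inner_right ℝ fun v => ?_
    have e1 : v = (a₁ + v - a₁) - (a₁ - a₁) := by abel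
    have e2 : v = (a₁ + v - a₂) - (a₁ - a₂) := by abel
    have i1 : ⟪n₁, v⟫ = -(h₁ * (h.left.coord a₁ (a₁ + v) - h.left.coord a₁ a₁)) := by
      conv_lhs => rw [e1, inner_sub_right, inner_outwardNormal_sub h.left ha₁ hb₁,
        inner_outwardNormal_sub h.left ha₁ hb₁]
      ring
    have i2 : ⟪n₂, v⟫ = -(h₂ * (h.right.coord a₂ (a₁ + v) - h.right.coord a₂ a₁)) := by
      conv_lhs => rw [e2, inner_sub_right, inner_outwardNormal_sub h.right ha₂ hb₂,
        inner_outwardNormal_sub h.right ha₂ hb₂]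
      ring
    rw [inner_smul_left, i1, i2, h.coord_eq ha₁ ha₂ (a₁ + v), h.left.coord_self ha₁.mem, hc]
    simp only [conj_trivial]
    field_simp
  have h1 : |c| = 1 := by
    have := congrArg norm key
    rw [norm_smul, hn₁, hn₂, mul_one, Real.norm_eq_abs] at this
    exact this.symm
  rw [abs_of_neg hc0] at h1
  rw [key, show c = -1 by linarith, neg_one_smul]

/-- An open set around the relative interior of the common facet of two simplices. -/
def IsNeighbour.patch (h : IsNeighbour K₁ K₂ F) : Set (E d) :=
  {y | (∀ b ∈ F, 0 < h.left.coord b y) ∧ ∀ b ∈ F, 0 < h.right.coord b y}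

theorem IsNeighbour.isOpen_patch (h : IsNeighbour K₁ K₂ F) : IsOpen h.patch := by
  have : h.patch = (⋂ b ∈ F, {y | 0 < h.left.coord b y}) ∩ ⋂ b ∈ F, {y | 0 < h.right.coord b y} := by
    ext y
    simp [IsNeighbour.patch]
  rw [this]
  exact (isOpen_biInter_finset fun b _ => isOpen_lt continuous_const (h.left.continuous_coord b)).inter
    (isOpen_biInter_finset fun b _ => isOpen_lt continuous_const (h.right.continuous_coord b))

/-- The coordinates at a₁ and a₂ have opposite signs, so the sign of the first decides which simplex
contains the point. -/
theorem IsNeighbour.patch_subset (hd : 0 < d) (h : IsNeighbour K₁ K₂ F) :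
    h.patch ⊆ hull K₁ ∪ hull K₂ := by
  obtain ⟨a₁, ha₁⟩ := h.left.exists_isOpposite h.mem_left
  obtain ⟨a₂, ha₂⟩ := h.right.exists_isOpposite h.mem_right
  have hneg := h.symm.coord_neg hd ha₂ ha₁
  change h.right.coord a₂ a₁ < 0 at hneg
  rintro y ⟨hy1, hy2⟩
  rcases le_total 0 (h.left.coord a₁ y) with h0 | h0
  · left
    rw [h.left.mem_hull_iff]
    intro b hb
    by_cases hba : b = a₁
    · rwa [hba]
    · exact (hy1 b (ha₁.mem_of_ne b hb hba)).le
  · right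
    rw [h.right.mem_hull_iff]
    intro b hb
    by_cases hba : b = a₂
    · rw [hba, h.coord_eq ha₁ ha₂]
      exact mul_nonneg_of_nonpos_of_nonpos h0 hneg.le
    · exact (hy2 b (ha₂.mem_of_ne b hb hba)).le

theorem IsNeighbour.ae_mem_patch (hd : 0 < d) (h : IsNeighbour K₁ K₂ F) :
    ∀ᵐ x ∂(surf F), x ∈ h.patch := by
  filter_upwards [ae_surf_coord_pos hd h.left h.mem_left,
    ae_surf_coord_pos hd h.right h.mem_right] with x h1 h2 using ⟨h1, h2⟩

theorem IsNeighbour.disjoint (h : IsNeighbour K₁ K₂ F) :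
    Disjoint (openHull K₁) (openHull K₂) := by
  obtain ⟨a₁, ha₁⟩ := h.left.exists_isOpposite h.mem_left
  rw [Set.disjoint_left]
  intro x h1 h2
  have hxF : x ∈ hull F := h.inter ▸ ⟨openHull_subset_hull _ h1, openHull_subset_hull _ h2⟩
  have h3 := ((ha₁.mem_hull_iff h.left).1 hxF).2
  exact (h.left.mem_openHull_iff.1 h1 a₁ ha₁.mem).ne' h3

theorem IsNeighbour.setIntegral_eq_add (hd : 0 < d) (h : IsNeighbour K₁ K₂ F) {U : Set (E d)}
    (hU : interior (hull K₁ ∪ hull K₂) ⊆ U) {q : E d → ℝ} (hq : ∀ x ∉ h.patch, q x = 0)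
    (h1 : IntegrableOn q (openHull K₁)) (h2 : IntegrableOn q (openHull K₂)) :
    ∫ x in U, q x = (∫ x in openHull K₁, q x) + ∫ x in openHull K₂, q x := by
  have hpU : h.patch ⊆ U := (interior_maximal (h.patch_subset hd) h.isOpen_patch).trans hU
  rw [← setIntegral_union h.disjoint (isOpen_openHull K₂).measurableSet h1 h2,
    setIntegral_congr_set ((openHull_ae_eq_hull K₁).union (openHull_ae_eq_hull K₂)),
    setIntegral_eq_integral_of_forall_compl_eq_zero fun x hx => hq x fun h' => hx (hpU h'),
    setIntegral_eq_integral_of_forall_compl_eq_zero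
      fun x hx => hq x fun h' => hx (h.patch_subset hd h')]

/-- Any other facet is opposite to a vertex of F, so the coordinate at that vertex, and hence ψ,
vanishes on it. -/
theorem sum_facets_eq_single (hK : IsSimplex K) (hF : F ∈ facets K) {ψ : E d → ℝ}
    (hψ : ∀ x, (∃ b ∈ F, hK.coord b x ≤ 0) → ψ x = 0) (u : Finset (E d) → E d → ℝ)
    (c : Finset (E d) → ℝ) :
    ∑ F' ∈ facets K, c F' * ∫ x, u F' x * ψ x ∂(surf F') = c F * ∫ x, u F x * ψ x ∂(surf F) := by
  refine Finset.sum_eq_single F (fun F' hF' hne => ?_) fun h => absurd hF h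
  obtain ⟨a', ha'⟩ := hK.exists_isOpposite hF'
  obtain ⟨a, ha⟩ := hK.exists_isOpposite hF
  have hmem : a' ∈ F := by
    by_contra hcon
    apply hne
    ext b
    have haa : a = a' := by
      by_contra h
      exact hcon (ha.mem_of_ne a' ha'.mem (Ne.symm h))
    constructor
    · intro hb
      refine ha.mem_of_ne b (ha'.subset hb) ?_
      rintro rfl
      exact ha'.notMem (haa ▸ hb)
    · intro hb
      refine ha'.mem_of_ne b (ha.subset hb) ?_
      rintro rfl
      exact hcon hb
  have h5 : ∀ᵐ x ∂(surf F'), x ∈ hull F' := ae_restrict_mem (measurableSet_hull F')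
  rw [integral_eq_zero_of_ae, mul_zero]
  filter_upwards [h5] with x hx
  rw [hψ x ⟨a', hmem, (((ha'.mem_hull_iff hK).1 hx).2).le⟩, mul_zero]
  rfl

/-- Green's formula for a vector field and a function that vanishes on all facets but `F`. -/
theorem integral_div_mul_single (hd : 0 < d) (hK : IsSimplex K) (hF : F ∈ facets K)
    {w : E d → E d} (hw : ∀ i, MemH1 (openHull K) (fun x => w x i)) {g : E d → ℝ}
    (hg : IsWeakDiv (openHull K) w g) {ψ : E d → ℝ} (hψs : ContDiff ℝ ∞ ψ)
    (hψ : ∀ x, (∃ b ∈ F, hK.coord b x ≤ 0) → ψ x = 0) :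
    (∫ x in openHull K, g x * ψ x) + (∫ x in openHull K, ∑ i, w x i * partialDeriv i ψ x) =
      ∑ i, outwardNormal K F i * ∫ x, trace K F (fun y => w y i) x * ψ x ∂(surf F) := by
  have hψ1 := contDiff_one_of_smooth hψs
  have hmψ := memLp_of_continuous_hull hψs.continuous K
  have hmψ' := fun i => memLp_of_continuous_hull (continuous_partialDeriv hψ1 one_ne_zero i) K
  have h1 : ∫ x in openHull K, g x * ψ x =
      ∑ i, ∫ x in openHull K, weakPartial (openHull K) i (fun y => w y i) x * ψ x := by
    rw [← integral_finsetSum _ fun i _ =>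
      MemLp.integrable_mul_two ((hw i).memLp_weakPartial i) hmψ]
    refine integral_congr_ae ?_
    filter_upwards [hg.ae_unique (isOpen_openHull K) (isWeakDiv_of_memH1 hw)] with x hx
    rw [hx, Finset.sum_mul]
  rw [h1, integral_finsetSum _ fun i _ => MemLp.integrable_mul_two (hw i).memLp (hmψ' i),
    ← Finset.sum_add_distrib]
  refine Finset.sum_congr rfl fun i _ => ?_
  rw [integral_weakPartial_mul hd hK (hw i) hψs i,
    sum_facets_eq_single hK hF hψ (fun F' => trace K F' fun y => w y i)
      fun F' => outwardNormal K F' i]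

/-- Normal continuity: a field in `H(div)` has no normal jump on a common facet. -/
theorem IsNeighbour.normal_jump_eq_zero (hd : 0 < d) (h : IsNeighbour K₁ K₂ F) {U : Set (E d)}
    (hU : interior (hull K₁ ∪ hull K₂) ⊆ U) {w : E d → E d} {g : E d → ℝ} (hg : IsWeakDiv U w g)
    (h₁ : ∀ i, MemH1 (openHull K₁) (fun x => w x i))
    (h₂ : ∀ i, MemH1 (openHull K₂) (fun x => w x i)) :
    ∀ᵐ x ∂(surf F), ∑ i, outwardNormal K₁ F i *
      (trace K₁ F (fun y => w y i) x - trace K₂ F (fun y => w y i) x) = 0 := by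
  have := isFiniteMeasure_surf hd h.left h.mem_left
  have hL₁ := fun i => memLp_trace hd h.left h.mem_left (h₁ i)
  have hL₂ := fun i => memLp_trace hd h.right h.mem_right (h₂ i)
  have hsub₁ : openHull K₁ ⊆ U := (interior_mono subset_union_left).trans hU
  have hsub₂ : openHull K₂ ⊆ U := (interior_mono subset_union_right).trans hU
  have hpU : h.patch ⊆ U := (interior_maximal (h.patch_subset hd) h.isOpen_patch).trans hU
  have hJ : MemLp (fun x => ∑ i, outwardNormal K₁ F i *
      (trace K₁ F (fun y => w y i) x - trace K₂ F (fun y => w y i) x)) 2 (surf F) :=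
    memLp_finsetSum _ fun i _ => ((hL₁ i).sub (hL₂ i)).const_mul _
  have hJl : LocallyIntegrableOn (fun x => ∑ i, outwardNormal K₁ F i *
      (trace K₁ F (fun y => w y i) x - trace K₂ F (fun y => w y i) x)) h.patch (surf F) :=
    (hJ.locallyIntegrable (by norm_num)).locallyIntegrableOn _
  have key := h.isOpen_patch.ae_eq_zero_of_integral_contDiff_smul_eq_zero hJl
    fun ψ hψs hψc hψp => by
      have htest : IsTest h.patch ψ := ⟨hψs, hψc, hψp⟩
      have hψ1 := contDiff_one_of_smooth hψs
      have hz₁ : ∀ x, (∃ b ∈ F, h.left.coord b x ≤ 0) → ψ x = 0 := fun x ⟨b, hb, hbx⟩ =>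
        htest.eq_zero fun hx => not_lt.2 hbx (hx.1 b hb)
      have hz₂ : ∀ x, (∃ b ∈ F, h.right.coord b x ≤ 0) → ψ x = 0 := fun x ⟨b, hb, hbx⟩ =>
        htest.eq_zero fun hx => not_lt.2 hbx (hx.2 b hb)
      have g₁ := integral_div_mul_single hd h.left h.mem_left h₁ (hg.mono hsub₁) hψs hz₁
      have g₂ := integral_div_mul_single hd h.right h.mem_right h₂ (hg.mono hsub₂) hψs hz₂
      have hdiv := hg.2 ψ (htest.mono hpU)
      -- The weak divergence identity on U splits into the two elements. Compared with the sum of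
      -- the Green formulas on each of them, it leaves the integral of the normal jump against ψ.
      rw [h.setIntegral_eq_add hd hU, h.setIntegral_eq_add hd hU] at hdiv
      rotate_left
      · exact fun x hx => by rw [htest.eq_zero hx, mul_zero]
      · exact MemLp.integrable_mul_two (hg.mono hsub₁).1 (htest.memLp _)
      · exact MemLp.integrable_mul_two (hg.mono hsub₂).1 (htest.memLp _)
      · exact fun x hx => Finset.sum_eq_zero fun i _ => by
          rw [htest.partialDeriv_eq_zero i hx, mul_zero]
      · exact integrable_finsetSum _ fun i _ =>
          MemLp.integrable_mul_two (h₁ i).memLp (htest.memLp_partialDeriv i _)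
      · exact integrable_finsetSum _ fun i _ =>
          MemLp.integrable_mul_two (h₂ i).memLp (htest.memLp_partialDeriv i _)
      have hψF := memLp_surf_of_continuous hd h.left h.mem_left hψs.continuous
      have hfin : ∫ x, ψ x • (∑ i, outwardNormal K₁ F i *
          (trace K₁ F (fun y => w y i) x - trace K₂ F (fun y => w y i) x)) ∂(surf F) =
          (∑ i, outwardNormal K₁ F i * ∫ x, trace K₁ F (fun y => w y i) x * ψ x ∂(surf F)) +
          ∑ i, outwardNormal K₂ F i * ∫ x, trace K₂ F (fun y => w y i) x * ψ x ∂(surf F) := by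
        rw [← Finset.sum_add_distrib]
        have e1 : ∀ i, outwardNormal K₁ F i *
            (∫ x, trace K₁ F (fun y => w y i) x * ψ x ∂(surf F)) + outwardNormal K₂ F i *
            (∫ x, trace K₂ F (fun y => w y i) x * ψ x ∂(surf F)) =
            ∫ x, outwardNormal K₁ F i * ((trace K₁ F (fun y => w y i) x -
              trace K₂ F (fun y => w y i) x) * ψ x) ∂(surf F) := fun i => by
          rw [h.outwardNormal_eq_neg hd, integral_const_mul]
          simp only [sub_mul]
          rw [integral_sub (MemLp.integrable_mul_two (hL₁ i) hψF)
            (MemLp.integrable_mul_two (hL₂ i) hψF)]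
          simp only [PiLp.neg_apply]
          ring
        have e2 : ∀ i, Integrable (fun x => outwardNormal K₁ F i * ((trace K₁ F (fun y => w y i) x -
              trace K₂ F (fun y => w y i) x) * ψ x)) (surf F) := fun i =>
          (MemLp.integrable_mul_two ((hL₁ i).sub (hL₂ i)) hψF).const_mul _
        rw [Finset.sum_congr rfl fun i _ => e1 i, ← integral_finsetSum _ fun i _ => e2 i]
        refine integral_congr_ae (Eventually.of_forall fun x => ?_)
        simp only [smul_eq_mul, Finset.mul_sum]
        exact Finset.sum_congr rfl fun i _ => by ring
      rw [hfin, ← g₁, ← g₂]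
      linarith
  filter_upwards [key, h.ae_mem_patch hd] with x hx hxp using hx hxp

/-- The traces of an `H¹` function from the two sides of a facet agree. -/
theorem IsNeighbour.trace_eq (hd : 0 < d) (h : IsNeighbour K₁ K₂ F) {U : Set (E d)}
    (hU : interior (hull K₁ ∪ hull K₂) ⊆ U) {f : E d → ℝ} (hf : MemH1 U f) :
    trace K₁ F f =ᵐ[surf F] trace K₂ F f := by
  have hsub₁ : openHull K₁ ⊆ U := (interior_mono subset_union_left).trans hU
  have hsub₂ : openHull K₂ ⊆ U := (interior_mono subset_union_right).trans hU
  have key : ∀ j : Fin d, ∀ᵐ x ∂(surf F), outwardNormal K₁ F j *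
      (trace K₁ F f x - trace K₂ F f x) = 0 := by
    intro j
    -- The field f eⱼ lies in H(div), and its normal jump is nⱼ times the jump of f. Some component
    -- nⱼ of the unit normal is not zero.
    set w : E d → E d := fun x => f x • EuclideanSpace.single j (1 : ℝ) with hw
    have hwi : ∀ i, (fun x => w x i) = if i = j then f else fun _ => 0 := fun i => by
      ext x
      by_cases hij : i = j
      · subst hij
        simp [hw]
      · simp [hw, hij]
    have hH : ∀ V, MemH1 V f → ∀ i, MemH1 V (fun x => w x i) := fun V hV i => by
      rw [hwi]
      split_ifs
      exacts [hV, memH1_zero V]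
    have h1 := h.normal_jump_eq_zero hd hU (isWeakDiv_of_memH1 (hH U hf))
      (hH _ (hf.mono hsub₁)) (hH _ (hf.mono hsub₂))
    have hz1 := trace_smooth hd h.left h.mem_left (φ := fun _ => (0 : ℝ)) contDiff_const
    have hz2 := trace_smooth hd h.right h.mem_right (φ := fun _ => (0 : ℝ)) contDiff_const
    filter_upwards [h1, hz1, hz2] with x hx hx1 hx2
    rw [Finset.sum_eq_single j] at hx
    · simpa only [hwi, if_true] using hx
    · intro i _ hij
      simp only [hwi, if_neg hij]
      rw [hx1, hx2, sub_self, mul_zero]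
    · exact fun h' => absurd (Finset.mem_univ j) h'
  obtain ⟨a₁, ha₁⟩ := h.left.exists_isOpposite h.mem_left
  obtain ⟨-, -, hn, -⟩ := exists_height hd h.left h.mem_left ha₁
  obtain ⟨j, hj⟩ : ∃ j, outwardNormal K₁ F j ≠ 0 := by
    by_contra hcon
    push Not at hcon
    have : outwardNormal K₁ F = 0 := by
      ext j
      exact hcon j
    rw [this, norm_zero] at hn
    exact zero_ne_one hn
  filter_upwards [key j] with x hx
  exact sub_eq_zero.1 ((mul_eq_zero.1 hx).resolve_left hj)

end

end FSI

namespace FSI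

noncomputable section

/-! ### Geometry of the mesh -/

variable {d : ℕ} {Ωf Ωs : Set (E d)} {Tf Ts : Finset (Finset (E d))} {K K' F : Finset (E d)}

theorem allElems_comm (Tf Ts : Finset (Finset (E d))) : allElems Tf Ts = allElems Ts Tf :=
  Finset.union_comm _ _

theorem mem_allElems : K ∈ allElems Tf Ts ↔ K ∈ Tf ∨ K ∈ Ts := Finset.mem_union

theorem mem_meshFacets : F ∈ meshFacets Tf ↔ ∃ K ∈ Tf, F ∈ facets K := Finset.mem_biUnion

theorem interface_comm (Ωf Ωs : Set (E d)) : interface Ωf Ωs = interface Ωs Ωf := inter_comm _ _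

theorem OnExterior.symm (h : OnExterior Ωf Ωs F) : OnExterior Ωs Ωf F := by
  rw [OnExterior, interface_comm Ωs Ωf]
  exact Or.symm h

/-- Moving a point of F slightly towards the centroid makes all its coordinates on F positive. -/
theorem hull_subset_closure_coord_pos (hd : 0 < d) (hK : IsSimplex K) (hF : F ∈ facets K) :
    hull F ⊆ closure {x | x ∈ hull F ∧ ∀ f ∈ F, 0 < hK.coord f x} := by
  classical
  intro x hx
  have hFn := facets_card_pos hd hF
  have hFK := (Finset.mem_powersetCard.1 hF).1
  have hcard : (0 : ℝ) < F.card := by exact_mod_cast Finset.card_pos.2 hFn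
  obtain ⟨a, ha⟩ := hK.exists_isOpposite hF
  set c : E d := F.centroid ℝ id with hc
  have hcF : c ∈ hull F := F.centroid_mem_convexHull hFn
  have hcpos : ∀ f ∈ F, 0 < hK.coord f c := by
    intro f hf
    have : c = ∑ b ∈ F, (F.card : ℝ)⁻¹ • b := by
      rw [hc, centroid_eq_smul_sum hFn, Finset.smul_sum]
    rw [this, affineMap_apply_sum _ F (fun _ => (F.card : ℝ)⁻¹) (by simp [hcard.ne']),
      Finset.sum_eq_single f (fun b hb hbf => by
        rw [hK.coord_of_ne (hFK hb) (Ne.symm hbf), mul_zero]) (fun h => absurd hf h),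
      hK.coord_self (hFK hf), mul_one]
    positivity
  have hlim : Tendsto (fun n : ℕ => AffineMap.lineMap x c (1 / ((n : ℝ) + 1))) atTop (𝓝 x) := by
    have h1 : Continuous (fun s : ℝ => AffineMap.lineMap x c s) := AffineMap.lineMap_continuous
    have := (h1.tendsto 0).comp tendsto_one_div_add_atTop_nhds_zero_nat
    simpa [Function.comp_def] using this
  refine mem_closure_of_tendsto hlim (Eventually.of_forall fun n => ?_)
  have hs0 : 0 < 1 / ((n : ℝ) + 1) := by positivity
  have hs1 : 1 / ((n : ℝ) + 1) ≤ 1 := by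
    rw [div_le_one (by positivity)]
    linarith [Nat.cast_nonneg (α := ℝ) n]
  refine ⟨(convex_hull F).lineMap_mem hx hcF ⟨hs0.le, hs1⟩, fun f hf => ?_⟩
  rw [AffineMap.apply_lineMap, AffineMap.lineMap_apply_module]
  have h0 := hK.mem_hull_iff.1 ((ha.mem_hull_iff hK).1 hx).1 f (hFK hf)
  have h1 := hcpos f hf
  simp only [smul_eq_mul]
  have := mul_nonneg (sub_nonneg.2 hs1) h0
  have := mul_pos hs0 h1
  linarith

theorem iUnion_openHull_ae_eq (T : Finset (Finset (E d))) :
    (⋃ K ∈ T, openHull K : Set (E d)) =ᵐ[volume] (⋃ K ∈ T, hull K : Set (E d)) :=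
  Filter.EventuallyEq.countable_bUnion T.countable_toSet fun K _ => openHull_ae_eq_hull K

namespace IsFittedMesh

variable (hm : IsFittedMesh Ωf Ωs Tf Ts)
include hm

/-- The hypotheses are symmetric in fluid and solid, so every fact about one side is transferred to
the other. -/
theorem symm : IsFittedMesh Ωs Ωf Ts Tf where
  regular_f := hm.regular_s
  regular_s := hm.regular_f
  disjoint_domains := hm.disjoint_domains.symm
  simplex := allElems_comm Tf Ts ▸ hm.simplex
  conforming := allElems_comm Tf Ts ▸ hm.conforming
  closure_f := hm.closure_s
  closure_s := hm.closure_f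
  interface_facets := by
    rw [allElems_comm Ts Tf, interface_comm]
    exact hm.interface_facets

theorem isOpen_f : IsOpen Ωf := hm.regular_f ▸ isOpen_interior

theorem isOpen_s : IsOpen Ωs := hm.symm.isOpen_f

theorem simplex_f (hK : K ∈ Tf) : IsSimplex K := hm.simplex K (mem_allElems.2 (Or.inl hK))

theorem simplex_s (hK : K ∈ Ts) : IsSimplex K := hm.symm.simplex_f hK

theorem hull_subset_f (hK : K ∈ Tf) : hull K ⊆ closure Ωf :=
  hm.closure_f ▸ subset_biUnion_of_mem (u := fun K : Finset (E d) => hull K) hK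

theorem hull_subset_s (hK : K ∈ Ts) : hull K ⊆ closure Ωs := hm.symm.hull_subset_f hK

theorem openHull_subset_f (hK : K ∈ Tf) : openHull K ⊆ Ωf := by
  rw [← hm.regular_f]
  exact interior_mono (hm.hull_subset_f hK)

theorem openHull_subset_s (hK : K ∈ Ts) : openHull K ⊆ Ωs := hm.symm.openHull_subset_f hK

theorem interior_union_subset_f (hK : K ∈ Tf) (hK' : K' ∈ Tf) :
    interior (hull K ∪ hull K') ⊆ Ωf := by
  rw [← hm.regular_f]
  exact interior_mono (union_subset (hm.hull_subset_f hK) (hm.hull_subset_f hK'))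

theorem hull_subset (hK : K ∈ allElems Tf Ts) : hull K ⊆ closure Ωf ∪ closure Ωs := by
  rcases mem_allElems.1 hK with h | h
  · exact (hm.hull_subset_f h).trans subset_union_left
  · exact (hm.hull_subset_s h).trans subset_union_right

theorem interior_union_subset (hK : K ∈ allElems Tf Ts) (hK' : K' ∈ allElems Tf Ts) :
    interior (hull K ∪ hull K') ⊆ wholeDomain Ωf Ωs :=
  interior_mono (union_subset (hm.hull_subset hK) (hm.hull_subset hK'))

theorem f_subset : Ωf ⊆ wholeDomain Ωf Ωs :=
  interior_maximal (subset_closure.trans subset_union_left) hm.isOpen_f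

theorem s_subset : Ωs ⊆ wholeDomain Ωf Ωs :=
  interior_maximal (subset_closure.trans subset_union_right) hm.isOpen_s

/-- By conformity a common point lies in the face of the shared vertices, so its coordinate at a
vertex missing from K' is zero; inside K all coordinates are positive. -/
theorem disjoint_openHull_hull (hK : K ∈ allElems Tf Ts) (hK' : K' ∈ allElems Tf Ts)
    (hne : K ≠ K') : Disjoint (openHull K) (hull K') := by
  have hS := hm.simplex K hK
  obtain ⟨a, haK, haK'⟩ : ∃ a ∈ K, a ∉ K' := by
    by_contra! h
    exact hne (Finset.eq_of_subset_of_card_le h (by rw [hS.1, (hm.simplex K' hK').1]))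
  rw [Set.disjoint_left]
  intro x h1 h2
  have h3 : x ∈ hull K ∩ hull K' := ⟨openHull_subset_hull _ h1, h2⟩
  rw [hm.conforming K hK K' hK', hS.mem_convexHull_iff inter_subset_left] at h3
  exact (hS.mem_openHull_iff.1 h1 a haK).ne' (h3.2 a haK fun h => haK' h.2)

theorem notMem_s (hK : K ∈ Tf) : K ∉ Ts := by
  intro h
  obtain ⟨x, hx⟩ := (hm.simplex_f hK).openHull_nonempty
  exact Set.disjoint_left.1 hm.disjoint_domains (hm.openHull_subset_f hK hx)
    (hm.openHull_subset_s h hx)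

theorem disjoint_elems : Disjoint Tf Ts := Finset.disjoint_left.2 fun _ h => hm.notMem_s h

theorem pairwise_disjoint_openHull :
    Set.Pairwise (allElems Tf Ts : Set (Finset (E d))) (Function.onFun Disjoint openHull) :=
  fun _ hK _ hK' hne =>
    (hm.disjoint_openHull_hull hK hK' hne).mono_right (openHull_subset_hull _)

/-- Two different simplices share at most d vertices, so the d vertices of F are all the shared
ones. -/
theorem isNeighbour (hK : K ∈ allElems Tf Ts) (hK' : K' ∈ allElems Tf Ts) (hne : K ≠ K')
    (hF : F ∈ facets K) (hF' : F ∈ facets K') : IsNeighbour K K' F := by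
  classical
  refine ⟨hm.simplex K hK, hm.simplex K' hK', hF, hF', ?_⟩
  rw [hm.conforming K hK K' hK', hull, ← Finset.coe_inter]
  obtain ⟨h1, h2⟩ := Finset.mem_powersetCard.1 hF
  have h3 := (Finset.mem_powersetCard.1 hF').1
  have hle : (K ∩ K').card ≤ d := by
    by_contra! hlt
    have hc := (hm.simplex K hK).1
    have hc' := (hm.simplex K' hK').1
    have e1 := Finset.eq_of_subset_of_card_le (Finset.inter_subset_left (s₁ := K) (s₂ := K'))
      (by omega)
    have e2 := Finset.eq_of_subset_of_card_le (Finset.inter_subset_right (s₁ := K) (s₂ := K'))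
      (by omega)
    exact hne (e1.symm.trans e2)
  rw [Finset.eq_of_subset_of_card_le (Finset.subset_inter h1 h3) (by omega)]

theorem f_ae_eq : (⋃ K ∈ Tf, openHull K : Set (E d)) =ᵐ[volume] Ωf := by
  have h1 : (⋃ K ∈ Tf, openHull K : Set (E d)) ⊆ Ωf :=
    iUnion₂_subset fun K hK => hm.openHull_subset_f hK
  have h2 : Ωf ⊆ ⋃ K ∈ Tf, hull K := hm.closure_f ▸ subset_closure
  have h3 : (⋃ K ∈ Tf, openHull K : Set (E d)) =ᵐ[volume] (⋃ K ∈ Tf, hull K : Set (E d)) :=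
    iUnion_openHull_ae_eq Tf
  exact h1.eventuallyLE.antisymm (h2.eventuallyLE.trans h3.symm.le)

theorem setIntegral_f {g : E d → ℝ} (hg : IntegrableOn g Ωf) :
    ∫ x in Ωf, g x = ∑ K ∈ Tf, ∫ x in openHull K, g x := by
  rw [← setIntegral_congr_set hm.f_ae_eq]
  refine integral_biUnion_finset _ (fun K _ => (isOpen_openHull K).measurableSet) ?_ ?_
  · exact hm.pairwise_disjoint_openHull.mono fun K hK => mem_allElems.2 (Or.inl hK)
  · exact fun K hK => hg.mono_set (hm.openHull_subset_f hK)

theorem restrict_wholeDomain :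
    (volume : Measure (E d)).restrict (wholeDomain Ωf Ωs) =
      volume.restrict Ωf + volume.restrict Ωs := by
  rw [← Measure.restrict_union hm.disjoint_domains hm.isOpen_s.measurableSet]
  refine (Measure.restrict_congr_set ?_).symm
  have h1 : Ωf ∪ Ωs ⊆ wholeDomain Ωf Ωs := union_subset hm.f_subset hm.s_subset
  have h2 : wholeDomain Ωf Ωs ⊆ (⋃ K ∈ Tf, hull K) ∪ ⋃ K ∈ Ts, hull K := by
    rw [← hm.closure_f, ← hm.closure_s]
    exact interior_subset
  have h3 : (Ωf ∪ Ωs : Set (E d)) =ᵐ[volume]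
      ((⋃ K ∈ Tf, hull K) ∪ ⋃ K ∈ Ts, hull K : Set (E d)) :=
    (hm.f_ae_eq.symm.trans (iUnion_openHull_ae_eq Tf)).union
      (hm.symm.f_ae_eq.symm.trans
        (iUnion_openHull_ae_eq Ts))
  exact h1.eventuallyLE.antisymm (h2.eventuallyLE.trans h3.symm.le)

/-- A relatively interior point x of F lies in no element but K. If x were in Ωᶠ, a neighbourhood of
x would be covered by K alone and x would be interior to K; if x were in the closure of Ωˢ, some
solid element would contain x. So x is in ∂Ωᶠ \ Γ, and the rest of F follows by closure. -/
theorem onExterior_f (hd : 0 < d) (hK : K ∈ Tf) (hF : F ∈ facets K)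
    (hsingle : ∀ K' ∈ allElems Tf Ts, F ∈ facets K' → K' = K) : OnExterior Ωf Ωs F := by
  classical
  have hKa : K ∈ allElems Tf Ts := mem_allElems.2 (Or.inl hK)
  have hS := hm.simplex_f hK
  obtain ⟨a, ha⟩ := hS.exists_isOpposite hF
  -- If K' contains x, conformity puts every vertex with positive coordinate, hence all of F, into
  -- K', and F is a facet of K'.
  have key : ∀ x, (x ∈ hull F ∧ ∀ f ∈ F, 0 < hS.coord f x) →
      ∀ K' ∈ allElems Tf Ts, x ∈ hull K' → K' = K := by
    rintro x ⟨hxF, hpos⟩ K' hK' hx'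
    refine hsingle K' hK' ?_
    have h3 : x ∈ hull K ∩ hull K' := ⟨((ha.mem_hull_iff hS).1 hxF).1, hx'⟩
    rw [hm.conforming K hKa K' hK', hS.mem_convexHull_iff inter_subset_left] at h3
    refine Finset.mem_powersetCard.2 ⟨fun f hf => ?_, (Finset.mem_powersetCard.1 hF).2⟩
    by_contra hfK'
    exact (hpos f hf).ne' (h3.2 f (ha.subset hf) fun h => hfK' h.2)
  refine Or.inl ((hull_subset_closure_coord_pos hd hS hF).trans (closure_mono fun x hx => ?_))
  have hxK := (ha.mem_hull_iff hS).1 hx.1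
  refine ⟨⟨hm.hull_subset_f hK hxK.1, fun hint => ?_⟩, fun hint => ?_⟩
  · have hcl : IsClosed (⋃ K' ∈ Tf.erase K, hull K') :=
      (Tf.erase K).finite_toSet.isClosed_biUnion fun K' _ => isClosed_hull K'
    have hnot : x ∉ ⋃ K' ∈ Tf.erase K, hull K' := by
      simp only [mem_iUnion, not_exists]
      intro K' hK' hx'
      exact (Finset.mem_erase.1 hK').1
        (key x hx K' (mem_allElems.2 (Or.inl (Finset.mem_erase.1 hK').2)) hx')
    have hsub : Ωf ∩ (⋃ K' ∈ Tf.erase K, hull K')ᶜ ⊆ hull K := by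
      rintro y ⟨hy, hy'⟩
      have := hm.closure_f ▸ subset_closure hy
      simp only [mem_iUnion, exists_prop] at this
      obtain ⟨K', hK', hyK'⟩ := this
      by_cases he : K' = K
      · rwa [← he]
      · exact absurd (mem_biUnion (Finset.mem_erase.2 ⟨he, hK'⟩) hyK') hy'
    have hxo : x ∈ openHull K := interior_maximal hsub (hm.isOpen_f.inter hcl.isOpen_compl)
      ⟨hm.isOpen_f.interior_eq ▸ hint, hnot⟩
    exact (hS.mem_openHull_iff.1 hxo a ha.mem).ne' hxK.2
  · have := hint.2
    rw [hm.closure_s] at this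
    simp only [mem_iUnion, exists_prop] at this
    obtain ⟨K', hK', hxK'⟩ := this
    exact hm.notMem_s hK (key x hx K' (mem_allElems.2 (Or.inr hK')) hxK' ▸ hK')

theorem onExterior (hd : 0 < d) (hK : K ∈ allElems Tf Ts) (hF : F ∈ facets K)
    (hsingle : ∀ K' ∈ allElems Tf Ts, F ∈ facets K' → K' = K) : OnExterior Ωf Ωs F := by
  rcases mem_allElems.1 hK with h | h
  · exact hm.onExterior_f hd h hF hsingle
  · exact (hm.symm.onExterior_f hd h hF (allElems_comm Tf Ts ▸ hsingle)).symm

end IsFittedMesh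

/-- With three or more indices the pairwise relations force every term to be zero. This dispenses
with showing that at most two elements share a facet. -/
theorem sum_eq_zero_of_pairwise_add {ι : Type*} (s : Finset ι) (B : ι → ℝ)
    (hpair : ∀ i ∈ s, ∀ j ∈ s, i ≠ j → B i + B j = 0)
    (hsingle : ∀ i ∈ s, (∀ j ∈ s, j = i) → B i = 0) : ∑ i ∈ s, B i = 0 := by
  classical
  rcases s.eq_empty_or_nonempty with rfl | ⟨i, hi⟩
  · simp
  by_cases h1 : ∀ j ∈ s, j = i
  · rw [Finset.sum_eq_single_of_mem i hi fun j hj hji => absurd (h1 j hj) hji]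
    exact hsingle i hi h1
  push Not at h1
  obtain ⟨j, hj, hji⟩ := h1
  by_cases h2 : ∀ l ∈ s, l = i ∨ l = j
  · have : s = {i, j} := by
      ext l
      simp only [Finset.mem_insert, Finset.mem_singleton]
      exact ⟨h2 l, by rintro (rfl | rfl) <;> assumption⟩
    rw [this, Finset.sum_pair hji.symm]
    exact hpair i hi j hj hji.symm
  push Not at h2
  obtain ⟨l, hl, hli, hlj⟩ := h2
  have h12 := hpair i hi j hj hji.symm
  have h13 := hpair i hi l hl hli.symm
  have h23 := hpair j hj l hl hlj.symm
  refine Finset.sum_eq_zero fun m hm => ?_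
  by_cases hmi : m = i
  · rw [hmi]; linarith
  · have := hpair m hm i hi hmi
    linarith

theorem sum_facets_eq_zero (T : Finset (Finset (E d))) (B : Finset (E d) → Finset (E d) → ℝ)
    (hpair : ∀ K ∈ T, ∀ K' ∈ T, K ≠ K' → ∀ F, F ∈ facets K → F ∈ facets K' →
      B K F + B K' F = 0)
    (hsingle : ∀ K ∈ T, ∀ F ∈ facets K, (∀ K' ∈ T, F ∈ facets K' → K' = K) → B K F = 0) :
    ∑ K ∈ T, ∑ F ∈ facets K, B K F = 0 := by
  classical
  rw [Finset.sum_comm' (t' := meshFacets T) (s' := fun F => T.filter (F ∈ facets ·))]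
  · refine Finset.sum_eq_zero fun F _ => sum_eq_zero_of_pairwise_add _ _ ?_ ?_
    · intro K hK K' hK' hne
      rw [Finset.mem_filter] at hK hK'
      exact hpair K hK.1 K' hK'.1 hne F hK.2 hK'.2
    · intro K hK h
      rw [Finset.mem_filter] at hK
      exact hsingle K hK.1 F hK.2 fun K' h1 h2 => h K' (Finset.mem_filter.2 ⟨h1, h2⟩)
  · intro K F
    rw [Finset.mem_filter, mem_meshFacets]
    exact ⟨fun h => ⟨h, K, h⟩, fun h => h.1⟩

end

end FSI

namespace FSI

noncomputable section

/-! ### Time derivatives -/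

variable {d : ℕ} {μ ν : Measure (E d)} {T t : ℝ}

theorem glue_eqOn_left {V : Type*} (Ωf : Set (E d)) (a b : E d → V) : EqOn (glue Ωf a b) a Ωf :=
  fun _ hx => if_pos hx

theorem glue_eqOn_right {V : Type*} {Ωf Ωs : Set (E d)} (h : Disjoint Ωf Ωs) (a b : E d → V) :
    EqOn (glue Ωf a b) b Ωs :=
  fun _ hx => if_neg fun hx' => Set.disjoint_left.1 h hx' hx

variable {V : Type*} [NormedAddCommGroup V]

/-- Subadditivity of the square root. -/
theorem eLpNorm_two_add_measure_le (f : E d → V) :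
    eLpNorm f 2 (μ + ν) ≤ eLpNorm f 2 μ + eLpNorm f 2 ν := by
  simp only [eLpNorm_eq_lintegral_rpow_enorm_toReal two_ne_zero ENNReal.ofNat_ne_top,
    lintegral_add_measure]
  exact ENNReal.rpow_add_le_add_rpow _ _ (by norm_num) (by norm_num)

theorem memLp_two_add_measure {f : E d → V} (hμ : MemLp f 2 μ) (hν : MemLp f 2 ν) :
    MemLp f 2 (μ + ν) :=
  ⟨hμ.1.add_measure hν.1, (eLpNorm_two_add_measure_le f).trans_lt (ENNReal.add_lt_top.2
    ⟨hμ.2, hν.2⟩)⟩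

variable [NormedSpace ℝ V]

theorem HasL2TimeDeriv.congr {f f' : ℝ → E d → V} {g g' : E d → V}
    (h : HasL2TimeDeriv μ T f g t) (ht : t ∈ Icc 0 T) (hf : ∀ s ∈ Icc 0 T, f s =ᵐ[μ] f' s)
    (hg : g =ᵐ[μ] g') : HasL2TimeDeriv μ T f' g' t := by
  refine ⟨h.1.ae_eq hg, h.2.congr' ?_⟩
  filter_upwards [self_mem_nhdsWithin] with s hs
  refine eLpNorm_congr_ae ?_
  filter_upwards [hf s hs.1, hf t ht, hg] with x h1 h2 h3
  rw [h1, h2, h3]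

theorem HasL2TimeDeriv.add_measure {f : ℝ → E d → V} {g : E d → V}
    (hμ : HasL2TimeDeriv μ T f g t) (hν : HasL2TimeDeriv ν T f g t) :
    HasL2TimeDeriv (μ + ν) T f g t := by
  refine ⟨memLp_two_add_measure hμ.1 hν.1, ?_⟩
  have := hμ.2.add hν.2
  rw [add_zero] at this
  exact tendsto_of_tendsto_of_tendsto_of_le_of_le tendsto_const_nhds this (fun _ => zero_le)
    fun s => eLpNorm_two_add_measure_le _

variable {Ωf Ωs : Set (E d)} {Tf Ts : Finset (Finset (E d))} {K F : Finset (E d)}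

theorem IsFittedMesh.glue_ae_eq_f (hm : IsFittedMesh Ωf Ωs Tf Ts) (a b : E d → V) :
    glue Ωf a b =ᵐ[volume.restrict Ωf] a :=
  ae_restrict_of_forall_mem hm.isOpen_f.measurableSet (glue_eqOn_left Ωf a b)

theorem IsFittedMesh.glue_ae_eq_s (hm : IsFittedMesh Ωf Ωs Tf Ts) (a b : E d → V) :
    glue Ωf a b =ᵐ[volume.restrict Ωs] b :=
  ae_restrict_of_forall_mem hm.isOpen_s.measurableSet (glue_eqOn_right hm.disjoint_domains a b)

theorem IsFittedMesh.hasL2TimeDeriv_glue (hm : IsFittedMesh Ωf Ωs Tf Ts) (ht : t ∈ Icc 0 T)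
    {a b : ℝ → E d → V} {a' b' : E d → V}
    (ha : HasL2TimeDeriv (volume.restrict Ωf) T a a' t)
    (hb : HasL2TimeDeriv (volume.restrict Ωs) T b b' t) :
    HasL2TimeDeriv (volume.restrict (wholeDomain Ωf Ωs)) T (fun s => glue Ωf (a s) (b s))
      (glue Ωf a' b') t := by
  rw [hm.restrict_wholeDomain]
  exact (ha.congr ht (fun s _ => (hm.glue_ae_eq_f _ _).symm) (hm.glue_ae_eq_f _ _).symm).add_measure
    (hb.congr ht (fun s _ => (hm.glue_ae_eq_s _ _).symm) (hm.glue_ae_eq_s _ _).symm)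

theorem norm_le_sum_norm_apply (x : E d) : ‖x‖ ≤ ∑ i, ‖x i‖ := by
  have h := (EuclideanSpace.basisFun (Fin d) ℝ).sum_repr x
  calc ‖x‖ = ‖∑ i, (EuclideanSpace.basisFun (Fin d) ℝ).repr x i •
        (EuclideanSpace.basisFun (Fin d) ℝ) i‖ := by rw [h]
    _ ≤ ∑ i, ‖(EuclideanSpace.basisFun (Fin d) ℝ).repr x i •
        (EuclideanSpace.basisFun (Fin d) ℝ) i‖ := norm_sum_le _ _
    _ = ∑ i, ‖x i‖ := by simp [norm_smul]

theorem eLpNorm_le_sum_apply {w : E d → E d}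
    (hw : ∀ i, AEStronglyMeasurable (fun x => w x i) μ) :
    eLpNorm w 2 μ ≤ ∑ i, eLpNorm (fun x => w x i) 2 μ := by
  calc eLpNorm w 2 μ ≤ eLpNorm (∑ i, fun x => ‖w x i‖) 2 μ := by
        refine eLpNorm_mono_real fun x => ?_
        simpa using norm_le_sum_norm_apply (w x)
    _ ≤ ∑ i, eLpNorm (fun x => ‖w x i‖) 2 μ :=
        eLpNorm_sum_le (fun i _ => (hw i).norm) (by norm_num)
    _ = ∑ i, eLpNorm (fun x => w x i) 2 μ := by simp only [eLpNorm_norm]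

theorem eLpNorm_apply_le (w : E d → E d) (i : Fin d) :
    eLpNorm (fun x => w x i) 2 μ ≤ eLpNorm w 2 μ :=
  eLpNorm_mono fun x => PiLp.norm_apply_le (w x) i

theorem memLp_toLp {w : Fin d → E d → ℝ} (hw : ∀ i, MemLp (w i) 2 μ) :
    MemLp (fun x => (WithLp.toLp 2 (fun i => w i x) : E d)) 2 μ :=
  memLp_piLp_iff.2 hw

theorem memLp_traceVec (hd : 0 < d) (hK : IsSimplex K) (hF : F ∈ facets K) {w : E d → E d}
    (hw : ∀ i, MemH1 (openHull K) (fun x => w x i)) : MemLp (traceVec K F w) 2 (surf F) :=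
  memLp_toLp fun i => memLp_trace hd hK hF (hw i)

theorem traceVec_ae_eq_of_forall {w : E d → E d} {g : E d → E d}
    (h : ∀ i, trace K F (fun x => w x i) =ᵐ[surf F] fun x => g x i) :
    traceVec K F w =ᵐ[surf F] g := by
  filter_upwards [ae_all_iff.2 h] with x hx
  ext i
  exact hx i

theorem traceVec_congr (hd : 0 < d) (hK : IsSimplex K) (hF : F ∈ facets K) {w w' : E d → E d}
    (hw : ∀ i, MemH1 (openHull K) (fun x => w x i))
    (h : w =ᵐ[volume.restrict (openHull K)] w') :
    traceVec K F w' =ᵐ[surf F] traceVec K F w :=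
  traceVec_ae_eq_of_forall fun i => trace_congr hd hK hF (hw i) <| by
    filter_upwards [h] with x hx
    rw [hx]

/-- The trace is linear and bounded by the norm of H¹(K), so it maps convergent difference quotients
to convergent ones. -/
theorem HasH1TimeDeriv.hasL2TimeDeriv_traceVec (hd : 0 < d) (hK : IsSimplex K) (hF : F ∈ facets K)
    {U : Set (E d)} (hU : IsOpen U) (hKU : openHull K ⊆ U) {η : ℝ → E d → E d} {w : E d → E d}
    (h : HasH1TimeDeriv U T η w t) (ht : t ∈ Icc 0 T)
    (hη : ∀ s ∈ Icc 0 T, ∀ i, MemH1 U (fun x => η s x i)) :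
    HasL2TimeDeriv (surf F) T (fun s => traceVec K F (η s)) (traceVec K F w) t := by
  obtain ⟨hw, h0, h1⟩ := h
  have hwK := fun i => (hw i).mono hKU
  have hηK := fun s hs i => (hη s hs i).mono hKU
  have hle : ∀ f : E d → ℝ, eLpNorm f 2 (volume.restrict (openHull K)) ≤
      eLpNorm f 2 (volume.restrict U) := fun f =>
    eLpNorm_mono_measure f (Measure.restrict_mono hKU le_rfl)
  refine ⟨memLp_traceVec hd hK hF hwK, ?_⟩
  obtain ⟨C, hC, hb⟩ := exists_trace_bound hd hK hF
  -- The components of the error of the difference quotient; the hypothesis says that D tends to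
  -- zero in H¹ as s tends to t.
  set D : ℝ → Fin d → E d → ℝ := fun s i x => (s - t)⁻¹ * (η s x i - η t x i) - w x i with hD
  have hDU : ∀ s ∈ Icc 0 T, ∀ i, MemH1 U (D s i) := fun s hs i =>
    (((hη s hs i).sub (hη t ht i)).const_mul _).sub (hw i)
  have hsob : ∀ i, Tendsto (fun s => sobNorm K (D s i)) (𝓝[Icc 0 T \ {t}] t) (𝓝 0) := by
    intro i
    have hz : (0 : ENNReal) = 0 + ∑ _j : Fin d, 0 := by simp
    rw [hz]
    refine Tendsto.add ?_ (tendsto_finsetSum _ fun j _ => ?_)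
    · refine tendsto_of_tendsto_of_tendsto_of_le_of_le tendsto_const_nhds h0.2 (fun _ => zero_le)
        fun s => (hle _).trans ?_
      exact eLpNorm_apply_le (fun x => (s - t)⁻¹ • (η s x - η t x) - w x) i
    · refine tendsto_of_tendsto_of_tendsto_of_le_of_le' tendsto_const_nhds (h1 i j).2
        (Eventually.of_forall fun _ => zero_le) ?_
      filter_upwards [self_mem_nhdsWithin] with s hs
      rw [eLpNorm_congr_ae (weakPartial_mono (isOpen_openHull K) (hDU s hs.1 i) hKU j)]
      refine (hle _).trans (eLpNorm_congr_ae ?_).le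
      have e1 := (hη s hs.1 i).sub (hη t ht i)
      filter_upwards [weakPartial_sub hU (e1.const_mul (s - t)⁻¹) (hw i) j,
        weakPartial_const_mul hU e1 (s - t)⁻¹ j,
        weakPartial_sub hU (hη s hs.1 i) (hη t ht i) j] with x h2 h3 h4
      rw [h2, h3, h4, smul_eq_mul]
  have htr : ∀ s ∈ Icc 0 T, ∀ i, (fun x => ((s - t)⁻¹ • (traceVec K F (η s) x -
      traceVec K F (η t) x) - traceVec K F w x) i) =ᵐ[surf F] trace K F (D s i) := by
    intro s hs i
    have e1 := (hηK s hs i).sub (hηK t ht i)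
    filter_upwards [trace_sub hd hK hF (e1.const_mul (s - t)⁻¹) (hwK i),
      trace_const_mul hd hK hF e1 (s - t)⁻¹, trace_sub hd hK hF (hηK s hs i) (hηK t ht i)]
      with x h2 h3 h4
    rw [h2, h3, h4]
    simp [traceVec]
  have hlim : Tendsto (fun s => ∑ i, C * sobNorm K (D s i)) (𝓝[Icc 0 T \ {t}] t) (𝓝 0) := by
    have hz : (0 : ENNReal) = ∑ _j : Fin d, C * 0 := by simp
    rw [hz]
    exact tendsto_finsetSum _ fun i _ => ENNReal.Tendsto.const_mul (hsob i) (Or.inr hC)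
  refine tendsto_of_tendsto_of_tendsto_of_le_of_le' tendsto_const_nhds hlim
    (Eventually.of_forall fun _ => zero_le) ?_
  filter_upwards [self_mem_nhdsWithin] with s hs
  refine (eLpNorm_le_sum_apply fun i => ?_).trans (Finset.sum_le_sum fun i _ => ?_)
  · exact (memLp_trace hd hK hF ((hDU s hs.1 i).mono hKU)).1.congr (htr s hs.1 i).symm
  · rw [eLpNorm_congr_ae (htr s hs.1 i)]
    exact hb _ ((hDU s hs.1 i).mono hKU)

/-! ### Traces on the skeleton -/

theorem skeletonTrace_eq {Th : Finset (Finset (E d))} (hF : F ∈ meshFacets Th) :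
    ∃ K ∈ Th, F ∈ facets K ∧ ∀ w, skeletonTrace Th w F = traceVec K F w := by
  have h : ∃ K ∈ Th, F ∈ facets K := mem_meshFacets.1 hF
  exact ⟨h.choose, h.choose_spec.1, h.choose_spec.2, fun w => by rw [skeletonTrace, dif_pos h]⟩

/-- Makes the choice of an element in `skeletonTrace` immaterial. -/
theorem IsFittedMesh.traceVec_eq (hm : IsFittedMesh Ωf Ωs Tf Ts) (hd : 0 < d) {K K' : Finset (E d)}
    (hK : K ∈ allElems Tf Ts) (hK' : K' ∈ allElems Tf Ts) (hF : F ∈ facets K)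
    (hF' : F ∈ facets K') {U : Set (E d)} (hU : interior (hull K ∪ hull K') ⊆ U)
    {w : E d → E d} (hw : ∀ i, MemH1 U (fun x => w x i)) :
    traceVec K F w =ᵐ[surf F] traceVec K' F w := by
  by_cases hne : K = K'
  · rw [hne]
  · exact traceVec_ae_eq_of_forall fun i =>
      (hm.isNeighbour hK hK' hne hF hF').trace_eq hd hU (hw i)

theorem IsFittedMesh.skeletonTrace_ae_eq_s (hm : IsFittedMesh Ωf Ωs Tf Ts) (hd : 0 < d)
    (hK : K ∈ Ts) (hF : F ∈ facets K) {w : E d → E d} (hw : ∀ i, MemH1 Ωs (fun x => w x i)) :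
    skeletonTrace Ts w F =ᵐ[surf F] traceVec K F w := by
  obtain ⟨K', hK', hF', h⟩ := skeletonTrace_eq (mem_meshFacets.2 ⟨K, hK, hF⟩)
  rw [h w]
  exact hm.traceVec_eq hd (mem_allElems.2 (Or.inr hK')) (mem_allElems.2 (Or.inr hK)) hF' hF
    (hm.symm.interior_union_subset_f hK' hK) hw

theorem IsFittedMesh.skeletonTrace_ae_eq (hm : IsFittedMesh Ωf Ωs Tf Ts) (hd : 0 < d)
    (hK : K ∈ allElems Tf Ts) (hF : F ∈ facets K) {w : E d → E d}
    (hw : ∀ i, MemH1 (wholeDomain Ωf Ωs) (fun x => w x i)) :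
    skeletonTrace (allElems Tf Ts) w F =ᵐ[surf F] traceVec K F w := by
  obtain ⟨K', hK', hF', h⟩ := skeletonTrace_eq (mem_meshFacets.2 ⟨K, hK, hF⟩)
  rw [h w]
  exact hm.traceVec_eq hd hK' hK hF' hF (hm.interior_union_subset hK' hK) hw

/-- The trace of ∂ₜη is taken from a solid element, where ∂ₜη = u. As u is in H¹ of the whole
domain, û is the same from this element even on Γ. -/
theorem IsFittedMesh.exists_hasL2TimeDeriv_skeletonTrace (hm : IsFittedMesh Ωf Ωs Tf Ts)
    (hd : 0 < d) (ht : t ∈ Icc 0 T) {u : E d → E d} {us : E d → E d} {η : ℝ → E d → E d}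
    {w : E d → E d}
    (hu : ∀ i, MemH1 (wholeDomain Ωf Ωs) (fun x => u x i))
    (hus : u =ᵐ[volume.restrict Ωs] us)
    (hη : ∀ s ∈ Icc 0 T, ∀ i, MemH1 Ωs (fun x => η s x i))
    (hw : HasH1TimeDeriv Ωs T η w t) (hwu : ∀ᵐ x ∂(volume.restrict Ωs), w x - us x = 0)
    (hF : F ∈ meshFacets Ts) :
    HasL2TimeDeriv (surf F) T (fun s => skeletonTrace Ts (η s) F)
      (skeletonTrace (allElems Tf Ts) u F) t := by
  obtain ⟨K, hK, hFK, h⟩ := skeletonTrace_eq hF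
  have hS := hm.simplex_s hK
  have hKU := hm.openHull_subset_s hK
  refine (hw.hasL2TimeDeriv_traceVec hd hS hFK hm.isOpen_s hKU ht hη).congr ht
    (fun s _ => by rw [h]) ?_
  have h1 := hm.skeletonTrace_ae_eq hd (mem_allElems.2 (Or.inr hK)) hFK hu
  refine EventuallyEq.trans ?_ h1.symm
  refine traceVec_congr hd hS hFK (fun i => (hu i).mono (hKU.trans hm.s_subset)) ?_
  refine ae_restrict_of_ae_restrict_of_subset hKU ?_
  filter_upwards [hus, hwu] with x h2 h3
  rw [h2, sub_eq_zero.1 h3]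

end

end FSI

namespace FSI

noncomputable section

/-! ### Integration by parts on an element -/

variable {d : ℕ} {K F : Finset (E d)} {μ : Measure (E d)}

theorem integrable_inner_two {f g : E d → E d} (hf : MemLp f 2 μ) (hg : MemLp g 2 μ) :
    Integrable (fun x => ⟪f x, g x⟫) μ := by
  refine (L2.integrable_inner (𝕜 := ℝ) (hf.toLp f) (hg.toLp g)).congr ?_
  filter_upwards [hf.coeFn_toLp, hg.coeFn_toLp] with x h1 h2
  rw [h1, h2]

theorem inner_eq_sum (v w : E d) : ⟪v, w⟫ = ∑ i, v i * w i := by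
  simp [PiLp.inner_apply, mul_comm]

theorem memLp_apply {f : E d → E d} (hf : MemLp f 2 μ) (i : Fin d) :
    MemLp (fun x => f x i) 2 μ := memLp_piLp_iff.1 hf i

theorem memLp_smul_normal {f : E d → E d} (hf : MemLp f 2 μ) (n : E d) :
    MemLp (fun x => ⟪f x, n⟫ • n) 2 μ := by
  have := (memLp_toLp (μ := μ) fun i => (hf.inner_const n).mul_const (n i))
  refine this.ae_eq (Eventually.of_forall fun x => ?_)
  ext i
  simp

theorem memLp_tang {f : E d → E d} (hf : MemLp f 2 μ) (n : E d) :
    MemLp (fun x => tang n (f x)) 2 μ := hf.sub (memLp_smul_normal hf n)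

theorem tang_sub (n v w : E d) : tang n (v - w) = tang n v - tang n w := by
  rw [tang, tang, tang, inner_sub_left, sub_smul]
  abel

theorem tang_neg_normal (n v : E d) : tang (-n) v = tang n v := by
  simp [tang]

theorem tang_zero (n : E d) : tang n 0 = 0 := by simp [tang]

theorem inner_normal_tang {n : E d} (hn : ‖n‖ = 1) (v : E d) : ⟪n, tang n v⟫ = 0 := by
  rw [tang, inner_sub_right, inner_smul_right, real_inner_self_eq_norm_sq, hn, real_inner_comm]
  ring

theorem norm_outwardNormal (hd : 0 < d) (hK : IsSimplex K) (hF : F ∈ facets K) :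
    ‖outwardNormal K F‖ = 1 := by
  obtain ⟨a, ha⟩ := hK.exists_isOpposite hF
  obtain ⟨_, _, h, _⟩ := exists_height hd hK hF ha
  exact h

theorem memLp_traceNormal (hd : 0 < d) (hK : IsSimplex K) (hF : F ∈ facets K)
    {σ : Fin d → Fin d → E d → ℝ} (hσ : ∀ i j, MemH1 (openHull K) (σ i j)) :
    MemLp (traceNormal K F σ) 2 (surf F) :=
  memLp_toLp fun i => memLp_finsetSum _ fun j _ => (memLp_trace hd hK hF (hσ i j)).mul_const _

theorem sum_integral_weakPartial_mul (hd : 0 < d) (hK : IsSimplex K)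
    {σ : Fin d → Fin d → E d → ℝ} (hσ : ∀ i j, MemH1 (openHull K) (σ i j))
    {φ : Fin d → E d → ℝ} (hφ : ∀ i, ContDiff ℝ ∞ (φ i)) :
    (∫ x in openHull K, ∑ i, (∑ j, weakPartial (openHull K) j (σ i j) x) * φ i x) +
      ∫ x in openHull K, ∑ i, ∑ j, σ i j x * partialDeriv j (φ i) x =
      ∑ F ∈ facets K, ∫ x, ⟪traceNormal K F σ x, WithLp.toLp 2 (fun i => φ i x)⟫ ∂(surf F) := by
  have hm := fun i => memLp_of_continuous_hull (hφ i).continuous K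
  have hmp := fun i j => memLp_of_continuous_hull (continuous_partialDeriv (hφ i) (by simp) j) K
  have h1 : ∀ i j, Integrable (fun x => weakPartial (openHull K) j (σ i j) x * φ i x)
      (volume.restrict (openHull K)) := fun i j =>
    MemLp.integrable_mul_two ((hσ i j).memLp_weakPartial j) (hm i)
  have h2 : ∀ i j, Integrable (fun x => σ i j x * partialDeriv j (φ i) x)
      (volume.restrict (openHull K)) := fun i j =>
    MemLp.integrable_mul_two (hσ i j).memLp (hmp i j)
  simp only [Finset.sum_mul]
  rw [integral_finsetSum _ fun i _ => integrable_finsetSum _ fun j _ => h1 i j,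
    integral_finsetSum _ fun i _ => integrable_finsetSum _ fun j _ => h2 i j,
    Finset.sum_congr rfl fun i _ => integral_finsetSum _ fun j _ => h1 i j,
    Finset.sum_congr rfl fun i _ => integral_finsetSum _ fun j _ => h2 i j]
  simp only [← Finset.sum_add_distrib]
  simp only [fun i j => integral_weakPartial_mul hd hK (hσ i j) (hφ i) j]
  have h3 : ∀ F ∈ facets K, ∫ x, ⟪traceNormal K F σ x, WithLp.toLp 2 (fun i => φ i x)⟫ ∂(surf F) =
      ∑ i, ∑ j, outwardNormal K F j * ∫ x, trace K F (σ i j) x * φ i x ∂(surf F) := by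
    intro F hF
    have h4 : ∀ i j, Integrable (fun x => outwardNormal K F j * (trace K F (σ i j) x * φ i x))
        (surf F) := fun i j =>
      (MemLp.integrable_mul_two (memLp_trace hd hK hF (hσ i j))
        (memLp_surf_of_continuous hd hK hF (hφ i).continuous)).const_mul _
    simp only [← integral_const_mul]
    rw [Finset.sum_congr rfl fun i _ => (integral_finsetSum _ fun j _ => h4 i j).symm,
      ← integral_finsetSum _ fun i _ => integrable_finsetSum _ fun j _ => h4 i j]
    refine integral_congr_ae (Eventually.of_forall fun x => ?_)
    simp only [inner_eq_sum, traceNormal, Finset.sum_mul]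
    exact Finset.sum_congr rfl fun i _ => Finset.sum_congr rfl fun j _ => by ring
  rw [Finset.sum_congr rfl h3, Finset.sum_comm (s := facets K)]
  refine Finset.sum_congr rfl fun i _ => ?_
  rw [Finset.sum_comm (s := facets K)]

theorem symGrad_symm (U : Set (E d)) (w : E d → E d) (i j : Fin d) :
    symGrad U w i j = symGrad U w j i := by
  ext x
  rw [symGrad, symGrad, add_comm]

theorem traceVec_ae_eq_smooth (hd : 0 < d) (hK : IsSimplex K) (hF : F ∈ facets K)
    {φ : Fin d → E d → ℝ} (hφ : ∀ i, ContDiff ℝ ∞ (φ i)) {v : E d → E d}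
    (hv : ∀ i, φ i =ᵐ[volume.restrict (openHull K)] fun x => v x i) :
    traceVec K F v =ᵐ[surf F] fun x => WithLp.toLp 2 (fun i => φ i x) :=
  traceVec_ae_eq_of_forall fun i =>
    (trace_congr hd hK hF (memH1_of_smooth (hφ i) K) (hv i)).trans (trace_smooth hd hK hF (hφ i))

/-- The trace is linear, and the isotropic part q I contributes the purely normal vector q n. -/
theorem traceNormal_ae_eq (hd : 0 < d) (hK : IsSimplex K) (hF : F ∈ facets K) {c : ℝ}
    {σ S : Fin d → Fin d → E d → ℝ} {q : E d → ℝ}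
    (hS : ∀ i j, MemH1 (openHull K) (S i j)) (hq : MemH1 (openHull K) q)
    (hσ : ∀ i j, (fun x => (if i = j then q x else 0) + c * S i j x)
      =ᵐ[volume.restrict (openHull K)] σ i j) :
    traceNormal K F σ =ᵐ[surf F]
      fun x => trace K F q x • outwardNormal K F + c • traceNormal K F S x := by
  have hite : ∀ i j : Fin d, MemH1 (openHull K) (fun x => if i = j then q x else 0) := by
    intro i j
    by_cases h : i = j
    · simpa [h] using hq
    · simpa [h] using memH1_zero _
  have htr : ∀ i j : Fin d, trace K F (fun x => if i = j then q x else 0) =ᵐ[surf F]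
      fun x => if i = j then trace K F q x else 0 := by
    intro i j
    by_cases h : i = j
    · simp [h]
    · simpa [h] using trace_smooth hd hK hF (contDiff_const (c := (0 : ℝ)))
  have h : ∀ i j, ∀ᵐ x ∂(surf F), trace K F (σ i j) x =
      (if i = j then trace K F q x else 0) + c * trace K F (S i j) x := fun i j => by
    filter_upwards [trace_congr hd hK hF ((hite i j).add ((hS i j).const_mul c)) (hσ i j),
      trace_add hd hK hF (hite i j) ((hS i j).const_mul c), htr i j,
      trace_const_mul hd hK hF (hS i j) c] with x h1 h2 h3 h4
    rw [h1, h2, h3, h4]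
  filter_upwards [ae_all_iff.2 fun i => ae_all_iff.2 (h i)] with x hx
  ext i
  simp only [traceNormal, hx, add_mul, Finset.sum_add_distrib, PiLp.add_apply, PiLp.smul_apply,
    smul_eq_mul, Finset.mul_sum, ite_mul, zero_mul, Finset.sum_ite_eq, Finset.mem_univ, if_true,
    mul_assoc]

/-- The part of the facet terms of an element that is single-valued on the mesh skeleton. -/
def skeletonTest (K F : Finset (E d)) (v : E d → E d) (vhat : Finset (E d) → E d → E d)
    (x : E d) : E d :=
  ⟪traceVec K F v x, outwardNormal K F⟫ • outwardNormal K F + tang (outwardNormal K F) (vhat F x)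

/-- The trace of v is its tangential jump plus `skeletonTest`. Against the jump, the normal part q n
of σn drops out. -/
theorem integral_traceNormal_inner (hd : 0 < d) (hK : IsSimplex K) (hF : F ∈ facets K) {c : ℝ}
    {σ S : Fin d → Fin d → E d → ℝ} {q : E d → ℝ}
    (hS : ∀ i j, MemH1 (openHull K) (S i j)) (hq : MemH1 (openHull K) q)
    (hσm : ∀ i j, MemH1 (openHull K) (σ i j))
    (hσ : ∀ i j, (fun x => (if i = j then q x else 0) + c * S i j x)
      =ᵐ[volume.restrict (openHull K)] σ i j)
    {v : E d → E d} (hv : ∀ i, MemH1 (openHull K) (fun x => v x i))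
    {vhat : Finset (E d) → E d → E d} (hvhat : MemLp (vhat F) 2 (surf F)) :
    ∫ x, ⟪traceNormal K F σ x, traceVec K F v x⟫ ∂(surf F) =
      c * (∫ x, ⟪traceNormal K F S x, tangJump K F v vhat x⟫ ∂(surf F)) +
        ∫ x, ⟪traceNormal K F σ x, skeletonTest K F v vhat x⟫ ∂(surf F) := by
  have hn := norm_outwardNormal hd hK hF
  have hvL := memLp_traceVec hd hK hF hv
  have hj : MemLp (tangJump K F v vhat) 2 (surf F) := memLp_tang (hvL.sub hvhat) _
  have hs : MemLp (skeletonTest K F v vhat) 2 (surf F) :=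
    (memLp_smul_normal hvL _).add (memLp_tang hvhat _)
  rw [← integral_const_mul, ← integral_add
    ((integrable_inner_two (memLp_traceNormal hd hK hF hS) hj).const_mul c)
    (integrable_inner_two (memLp_traceNormal hd hK hF hσm) hs)]
  refine integral_congr_ae ?_
  filter_upwards [traceNormal_ae_eq hd hK hF hS hq hσ] with x hx
  have h1 : traceVec K F v x = tangJump K F v vhat x + skeletonTest K F v vhat x := by
    rw [tangJump, tang_sub, skeletonTest, tang]
    abel
  have h2 : ⟪traceNormal K F σ x, tangJump K F v vhat x⟫ =
      c * ⟪traceNormal K F S x, tangJump K F v vhat x⟫ := by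
    rw [hx, inner_add_left, inner_smul_left, inner_smul_left, tangJump, inner_normal_tang hn]
    simp
  conv_lhs => rw [h1, inner_add_right, h2]

/-- Green's formula for the rows of σ, tested with a smooth representative of v, and then the
splitting of the facet terms. The term with `skeletonTest` is kept on the right because it cancels
only after summation over the mesh. -/
theorem element_integration_by_parts (hd : 0 < d) (hK : IsSimplex K) {c : ℝ}
    {σ S : Fin d → Fin d → E d → ℝ} {q : E d → ℝ}
    (hS : ∀ i j, MemH1 (openHull K) (S i j)) (hsymm : ∀ i j, S i j = S j i)
    (hq : MemH1 (openHull K) q) (hσm : ∀ i j, MemH1 (openHull K) (σ i j))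
    (hσ : ∀ i j, (fun x => (if i = j then q x else 0) + c * S i j x)
      =ᵐ[volume.restrict (openHull K)] σ i j)
    {φ : Fin d → E d → ℝ} (hφ : ∀ i, ContDiff ℝ ∞ (φ i)) {v : E d → E d}
    (hv : ∀ i, φ i =ᵐ[volume.restrict (openHull K)] fun x => v x i)
    {vhat : Finset (E d) → E d → E d} (hvhat : ∀ F ∈ facets K, MemLp (vhat F) 2 (surf F)) :
    c * ((∫ x in openHull K, ∑ i, ∑ j, S i j x * symGrad (openHull K) v i j x) -
        ∑ F ∈ facets K, ∫ x, ⟪traceNormal K F S x, tangJump K F v vhat x⟫ ∂(surf F)) +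
      (∫ x in openHull K, q x * weakDiv (openHull K) v x) =
    -(∫ x in openHull K, ∑ i, (∑ j, weakPartial (openHull K) j (σ i j) x) * v x i) +
      ∑ F ∈ facets K, ∫ x, ⟪traceNormal K F σ x, skeletonTest K F v vhat x⟫ ∂(surf F) := by
  have hvm : ∀ i, MemH1 (openHull K) (fun x => v x i) := fun i =>
    (memH1_of_smooth (hφ i) K).congr (hv i)
  have hpd : ∀ i j, weakPartial (openHull K) j (fun x => v x i)
      =ᵐ[volume.restrict (openHull K)] partialDeriv j (φ i) := fun i j =>
    (weakPartial_congr (isOpen_openHull K) (memH1_of_smooth (hφ i) K) (hv i) j).trans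
      (weakPartial_of_contDiff (contDiff_one_of_smooth (hφ i)) K j)
  have hpd' := ae_all_iff.2 fun i => ae_all_iff.2 (hpd i)
  have hv' := ae_all_iff.2 hv
  have hσ' := ae_all_iff.2 fun i => ae_all_iff.2 (hσ i)
  have hmp := fun i j => memLp_of_continuous_hull (continuous_partialDeriv (hφ i) (by simp) j) K
  have hgreen := sum_integral_weakPartial_mul hd hK hσm hφ
  have hfac : ∑ F ∈ facets K, ∫ x, ⟪traceNormal K F σ x, WithLp.toLp 2 (fun i => φ i x)⟫ ∂(surf F)
      = c * (∑ F ∈ facets K, ∫ x, ⟪traceNormal K F S x, tangJump K F v vhat x⟫ ∂(surf F)) +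
        ∑ F ∈ facets K, ∫ x, ⟪traceNormal K F σ x, skeletonTest K F v vhat x⟫ ∂(surf F) := by
    rw [Finset.mul_sum, ← Finset.sum_add_distrib]
    refine Finset.sum_congr rfl fun F hF => ?_
    rw [← integral_traceNormal_inner hd hK hF hS hq hσm hσ hvm (hvhat F hF)]
    refine integral_congr_ae ?_
    filter_upwards [traceVec_ae_eq_smooth hd hK hF hφ hv] with x hx
    rw [hx]
  have hvol1 : ∫ x in openHull K, ∑ i, (∑ j, weakPartial (openHull K) j (σ i j) x) * φ i x =
      ∫ x in openHull K, ∑ i, (∑ j, weakPartial (openHull K) j (σ i j) x) * v x i := by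
    refine integral_congr_ae ?_
    filter_upwards [hv'] with x hx
    simp only [hx]
  have hvol2 : ∫ x in openHull K, ∑ i, ∑ j, σ i j x * partialDeriv j (φ i) x =
      c * (∫ x in openHull K, ∑ i, ∑ j, S i j x * symGrad (openHull K) v i j x) +
        ∫ x in openHull K, q x * weakDiv (openHull K) v x := by
    have hsg : ∀ i j, MemLp (symGrad (openHull K) v i j) 2 (volume.restrict (openHull K)) :=
      fun i j => by
        refine ((((hvm i).memLp_weakPartial j).add ((hvm j).memLp_weakPartial i)).const_mul
          (2⁻¹ : ℝ)).ae_eq (Eventually.of_forall fun x => ?_)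
        simp only [symGrad, Pi.add_apply]
        ring
    have hdiv := weakDiv_ae_eq_sum (isOpen_openHull K) hvm
    rw [← integral_const_mul, ← integral_add
      ((integrable_finsetSum _ fun i _ => integrable_finsetSum _ fun j _ =>
        MemLp.integrable_mul_two (hS i j).memLp (hsg i j)).const_mul c)
      (MemLp.integrable_mul_two hq.memLp (weakDiv_spec ⟨_, isWeakDiv_of_memH1 hvm⟩).1)]
    refine integral_congr_ae ?_
    filter_upwards [hσ', hpd', hdiv] with x h1 h2 h3
    -- Contraction with the symmetric S does not see the antisymmetric part of ∇v.
    have h4 : ∑ i, ∑ j, S i j x * symGrad (openHull K) v i j x =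
        ∑ i, ∑ j, S i j x * partialDeriv j (φ i) x := by
      have e1 : ∑ i, ∑ j, S i j x * partialDeriv i (φ j) x =
          ∑ i, ∑ j, S i j x * partialDeriv j (φ i) x := by
        rw [Finset.sum_comm]
        exact Finset.sum_congr rfl fun i _ => Finset.sum_congr rfl fun j _ => by rw [hsymm j i]
      have e2 : ∀ i j, S i j x * symGrad (openHull K) v i j x =
          (S i j x * partialDeriv j (φ i) x + S i j x * partialDeriv i (φ j) x) / 2 := by
        intro i j
        rw [symGrad, h2, h2]
        ring
      simp only [e2, ← Finset.sum_div, Finset.sum_add_distrib]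
      rw [e1]
      ring
    rw [h4, h3]
    simp only [← h1, add_mul, Finset.sum_add_distrib, ite_mul, zero_mul, Finset.sum_ite_eq,
      Finset.mem_univ, if_true, h2, Finset.mul_sum, mul_assoc]
    exact add_comm _ _
  rw [hvol1, hvol2, hfac] at hgreen
  linear_combination hgreen

end

end FSI

namespace FSI

noncomputable section

/-! ### Piecewise polynomials -/

variable {d : ℕ} {K F : Finset (E d)} {r m : ℕ}

theorem contDiff_mvPolynomial (P : MvPolynomial (Fin d) ℝ) :
    ContDiff ℝ ∞ (fun x : E d => MvPolynomial.eval (fun i => x i) P) := by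
  induction P using MvPolynomial.induction_on with
  | C a => simpa using contDiff_const
  | add p q hp hq => simpa using hp.add hq
  | mul_X p i hp => simpa using hp.mul (contDiff_piLp_apply (p := 2))

theorem IsPolyOn.exists_contDiff {q : E d → ℝ} (h : IsPolyOn (volume.restrict (hull K)) r q) :
    ∃ φ : E d → ℝ, ContDiff ℝ ∞ φ ∧ φ =ᵐ[volume.restrict (openHull K)] q := by
  obtain ⟨P, _, hP⟩ := h
  rw [← restrict_openHull] at hP
  exact ⟨_, contDiff_mvPolynomial P, hP.mono fun x hx => hx.symm⟩

theorem IsFacetPoly.memLp (hd : 0 < d) (hK : IsSimplex K) (hF : F ∈ facets K) {q : E d → E d}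
    (h : IsFacetPoly F r q) : MemLp q 2 (surf F) := by
  refine memLp_piLp_iff.2 fun i => ?_
  obtain ⟨P, _, hP⟩ := h.1 i
  exact (memLp_surf_of_continuous hd hK hF (contDiff_mvPolynomial P).continuous).ae_eq
    (hP.mono fun x hx => hx.symm)

/-- The projection p of zero satisfies ∫ |p|² = 0 when tested with itself; if no projection exists,
the default value is zero anyway. -/
theorem facetProj_ae_eq_zero (hd : 0 < d) (hK : IsSimplex K) (hF : F ∈ facets K) {g : E d → E d}
    (hg : ∀ᵐ x ∂(surf F), g x = 0) : ∀ᵐ x ∂(surf F), facetProj F m g x = 0 := by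
  rw [facetProj]
  split_ifs with h
  · obtain ⟨hp, horth⟩ := h.choose_spec
    have hL := hp.memLp hd hK hF
    have h1 := horth _ hp
    have h2 : ∫ x, ⟪h.choose x, h.choose x⟫ ∂(surf F) = 0 := by
      rw [← neg_eq_zero, ← integral_neg, ← h1]
      refine integral_congr_ae ?_
      filter_upwards [hg] with x hx
      rw [hx, zero_sub, inner_neg_left]
    rw [integral_eq_zero_iff_of_nonneg (fun x => real_inner_self_nonneg)
      (integrable_inner_two hL hL)] at h2
    filter_upwards [h2] with x hx
    exact inner_self_eq_zero.1 hx
  · simp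

/-! ### The bilinear form at fields without tangential jumps -/

variable {Ωf Ωs : Set (E d)} {Tf Ts : Finset (Finset (E d))}

/-- When û is the trace of u the jump of u vanishes, and with it the symmetrizing and the
stabilizing term, whatever α and h are. -/
theorem hdgForm_eq_of_jump_eq_zero (hd : 0 < d) {Th : Finset (Finset (E d))}
    (hT : ∀ K ∈ Th, IsSimplex K) (k : ℕ) (α h : ℝ) {u v : E d → E d}
    {uhat vhat : Finset (E d) → E d → E d}
    (hu : ∀ K ∈ Th, ∀ F ∈ facets K, uhat F =ᵐ[surf F] traceVec K F u) :
    hdgForm Th k α h u uhat v vhat =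
      ∑ K ∈ Th, ((∫ x in openHull K, ∑ i, ∑ j,
          symGrad (openHull K) u i j x * symGrad (openHull K) v i j x) -
        ∑ F ∈ facets K, ∫ x, ⟪traceNormal K F (symGrad (openHull K) u) x,
          tangJump K F v vhat x⟫ ∂(surf F)) := by
  refine Finset.sum_congr rfl fun K hK => ?_
  have hj : ∀ F ∈ facets K, ∀ᵐ x ∂(surf F), tangJump K F u uhat x = 0 := fun F hF => by
    filter_upwards [hu K hK F hF] with x hx
    rw [tangJump, hx, sub_self, tang_zero]
  have h1 : ∑ F ∈ facets K, ∫ x, ⟪traceNormal K F (symGrad (openHull K) v) x,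
      tangJump K F u uhat x⟫ ∂(surf F) = 0 := Finset.sum_eq_zero fun F hF => by
    refine integral_eq_zero_of_ae ?_
    filter_upwards [hj F hF] with x hx
    rw [hx, inner_zero_right, Pi.zero_apply]
  have h2 : ∑ F ∈ facets K, ∫ x, α * (k : ℝ) ^ 2 / h *
      ⟪facetProj F (k - 1) (tangJump K F u uhat) x,
        facetProj F (k - 1) (tangJump K F v vhat) x⟫ ∂(surf F) = 0 :=
    Finset.sum_eq_zero fun F hF => by
      refine integral_eq_zero_of_ae ?_
      filter_upwards [facetProj_ae_eq_zero hd (hT K hK) hF (hj F hF)] with x hx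
      rw [hx, inner_zero_left, mul_zero, Pi.zero_apply]
  rw [h1, h2, sub_zero, add_zero]

/-- The place where H² regularity enters: it gives the stress traces on the facets. -/
theorem memH1_symGrad {U : Set (E d)} (hU : IsOpen U) {u : E d → E d}
    (hu : ∀ i, MemH2 U (fun x => u x i)) (i j : Fin d) : MemH1 U (symGrad U u i j) := by
  have h := (((hu i).memH1_weakPartial hU j).add ((hu j).memH1_weakPartial hU i)).const_mul 2⁻¹
  refine h.congr (Eventually.of_forall fun x => ?_)
  simp only [symGrad]
  ring

theorem memH1_ite {U : Set (E d)} {q : E d → ℝ} (hq : MemH1 U q) (i j : Fin d) :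
    MemH1 U (fun x => if i = j then q x else 0) := by
  by_cases h : i = j
  · simpa [h] using hq
  · simpa [h] using memH1_zero _

theorem memLp_rowDiv {U : Set (E d)} {σ : Fin d → Fin d → E d → ℝ}
    (hσ : ∀ i j, MemH1 U (σ i j)) (i : Fin d) : MemLp (rowDiv U σ i) 2 (volume.restrict U) :=
  memLp_finsetSum _ fun j _ => (hσ i j).memLp_weakPartial j

theorem integrable_rowDiv_mul {U : Set (E d)} {σ : Fin d → Fin d → E d → ℝ}
    (hσ : ∀ i j, MemH1 U (σ i j)) {v : E d → E d} (hv : MemLp v 2 (volume.restrict U)) :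
    IntegrableOn (fun x => ∑ i, rowDiv U σ i x * v x i) U :=
  integrable_finsetSum _ fun i _ => MemLp.integrable_mul_two (memLp_rowDiv hσ i) (memLp_apply hv i)

/-- Summation of the element identity over one subdomain. It serves the fluid with q = -p and, after
exchanging the roles of the subdomains, the solid with q = λˢ ∇·η. -/
theorem IsFittedMesh.hdgForm_add_integral (hm : IsFittedMesh Ωf Ωs Tf Ts) (hd : 0 < d)
    (k : ℕ) (α h μ : ℝ) {u v : E d → E d} {uhat vhat : Finset (E d) → E d → E d} {q : E d → ℝ}
    {σ : Fin d → Fin d → E d → ℝ} (hu : ∀ i, MemH2 Ωf (fun x => u x i)) (hq : MemH1 Ωf q)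
    (hσ : ∀ i j, (fun x => (if i = j then q x else 0) + 2 * μ * symGrad Ωf u i j x)
      =ᵐ[volume.restrict Ωf] σ i j)
    (huhat : ∀ K ∈ Tf, ∀ F ∈ facets K, uhat F =ᵐ[surf F] traceVec K F u)
    (hvL : MemLp v 2 (volume.restrict Ωf)) (hvdiv : ∃ g, IsWeakDiv Ωf v g)
    (hv : ∀ K ∈ Tf, ∀ i, ∃ φ : E d → ℝ, ContDiff ℝ ∞ φ ∧
      φ =ᵐ[volume.restrict (openHull K)] fun x => v x i)
    (hvhat : ∀ K ∈ Tf, ∀ F ∈ facets K, MemLp (vhat F) 2 (surf F)) :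
    2 * μ * hdgForm Tf k α h u uhat v vhat + ∫ x in Ωf, q x * weakDiv Ωf v x =
      -(∫ x in Ωf, ∑ i, rowDiv Ωf σ i x * v x i) +
        ∑ K ∈ Tf, ∑ F ∈ facets K,
          ∫ x, ⟪traceNormal K F σ x, skeletonTest K F v vhat x⟫ ∂(surf F) := by
  have hU := hm.isOpen_f
  have hS := memH1_symGrad hU hu
  have hσm : ∀ i j, MemH1 Ωf (σ i j) := fun i j =>
    ((memH1_ite hq i j).add ((hS i j).const_mul (2 * μ))).congr (hσ i j)
  rw [hdgForm_eq_of_jump_eq_zero hd (fun K hK => hm.simplex_f hK) k α h huhat,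
    hm.setIntegral_f (MemLp.integrable_mul_two hq.memLp (weakDiv_spec hvdiv).1),
    hm.setIntegral_f (integrable_rowDiv_mul hσm hvL), Finset.mul_sum, ← Finset.sum_add_distrib,
    ← Finset.sum_neg_distrib, ← Finset.sum_add_distrib]
  refine Finset.sum_congr rfl fun K hK => ?_
  have hKU := hm.openHull_subset_f hK
  have hSK : ∀ i j, symGrad Ωf u i j =ᵐ[volume.restrict (openHull K)]
      symGrad (openHull K) u i j := fun i j => by
    filter_upwards [weakPartial_mono (isOpen_openHull K) (hu i).memH1 hKU j,
      weakPartial_mono (isOpen_openHull K) (hu j).memH1 hKU i] with x h1 h2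
    rw [symGrad, symGrad, h1, h2]
  choose φ hφ hvφ using hv K hK
  have key := element_integration_by_parts hd (hm.simplex_f hK) (c := 2 * μ) (σ := σ)
    (S := symGrad (openHull K) u) (q := q)
    (fun i j => ((hS i j).mono hKU).congr (hSK i j)) (symGrad_symm _ _) (hq.mono hKU)
    (fun i j => (hσm i j).mono hKU)
    (fun i j => by
      filter_upwards [hSK i j, ae_restrict_of_ae_restrict_of_subset hKU (hσ i j)] with x h1 h2
      rw [← h1, h2])
    hφ hvφ (hvhat K hK)
  have e1 : ∫ x in openHull K, q x * weakDiv Ωf v x =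
      ∫ x in openHull K, q x * weakDiv (openHull K) v x := by
    refine integral_congr_ae ?_
    filter_upwards [((weakDiv_spec hvdiv).mono hKU).weakDiv_ae_eq (isOpen_openHull K)] with x hx
    rw [hx]
  have e2 : ∫ x in openHull K, ∑ i, rowDiv Ωf σ i x * v x i =
      ∫ x in openHull K, ∑ i, (∑ j, weakPartial (openHull K) j (σ i j) x) * v x i := by
    refine integral_congr_ae ?_
    filter_upwards [ae_all_iff.2 fun i => ae_all_iff.2 fun j =>
      weakPartial_mono (isOpen_openHull K) (hσm i j) hKU j] with x hx
    simp only [rowDiv, hx]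
  rw [e1, e2, key]

/-! ### Cancellation on the skeleton -/

/-- Inside a subdomain the stress has equal traces from both sides, while the normals are opposite.
-/
theorem IsFittedMesh.traceNormal_neg (hm : IsFittedMesh Ωf Ωs Tf Ts) (hd : 0 < d)
    {K K' : Finset (E d)} (hK : K ∈ Tf) (hK' : K' ∈ Tf) (hne : K ≠ K') (hF : F ∈ facets K)
    (hF' : F ∈ facets K') {σ : Fin d → Fin d → E d → ℝ} (hσ : ∀ i j, MemH1 Ωf (σ i j)) :
    ∀ᵐ x ∂(surf F), traceNormal K F σ x + traceNormal K' F σ x = 0 := by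
  have hN := hm.isNeighbour (mem_allElems.2 (Or.inl hK)) (mem_allElems.2 (Or.inl hK')) hne hF hF'
  filter_upwards [ae_all_iff.2 fun i => ae_all_iff.2 fun j =>
    hN.trace_eq hd (hm.interior_union_subset_f hK hK') (hσ i j)] with x hx
  ext i
  simp [traceNormal, hx, hN.outwardNormal_eq_neg hd]

/-- Both summands are even in n. The first has no jump because v is in H(div), and v̂ is a single
function on F. -/
theorem IsNeighbour.skeletonTest_ae_eq {K K' : Finset (E d)} (hd : 0 < d) (h : IsNeighbour K K' F)
    {U : Set (E d)} (hU : interior (hull K ∪ hull K') ⊆ U) {v : E d → E d}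
    (hdiv : ∃ g, IsWeakDiv U v g) (hv : ∀ i, MemH1 (openHull K) (fun x => v x i))
    (hv' : ∀ i, MemH1 (openHull K') (fun x => v x i)) (vhat : Finset (E d) → E d → E d) :
    skeletonTest K F v vhat =ᵐ[surf F] skeletonTest K' F v vhat := by
  obtain ⟨g, hg⟩ := hdiv
  filter_upwards [h.normal_jump_eq_zero hd hU hg hv hv'] with x hx
  have h1 : ⟪traceVec K F v x, outwardNormal K F⟫ = ⟪traceVec K' F v x, outwardNormal K F⟫ := by
    rw [inner_eq_sum, inner_eq_sum, ← sub_eq_zero, ← Finset.sum_sub_distrib, ← hx]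
    refine Finset.sum_congr rfl fun i _ => ?_
    simp only [traceVec]
    ring
  rw [skeletonTest, skeletonTest, h.outwardNormal_eq_neg hd, tang_neg_normal, inner_neg_right,
    neg_smul_neg, h1]

theorem IsFittedMesh.sum_skeleton_eq_zero (hm : IsFittedMesh Ωf Ωs Tf Ts) (hd : 0 < d)
    {σf σs : Fin d → Fin d → E d → ℝ} (hσf : ∀ i j, MemH1 Ωf (σf i j))
    (hσs : ∀ i j, MemH1 Ωs (σs i j))
    (hdyn : ∀ K ∈ Tf, ∀ K' ∈ Ts, ∀ F, F ∈ facets K → F ∈ facets K' →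
      ∀ᵐ x ∂(surf F), traceNormal K F σf x + traceNormal K' F σs x = 0)
    {v : E d → E d} {vhat : Finset (E d) → E d → E d}
    (hdiv : ∃ g, IsWeakDiv (wholeDomain Ωf Ωs) v g)
    (hv : ∀ K ∈ allElems Tf Ts, ∀ i, MemH1 (openHull K) (fun x => v x i))
    (hv0 : ∀ K ∈ allElems Tf Ts, ∀ F ∈ facets K, OnExterior Ωf Ωs F →
      ∀ᵐ x ∂(surf F), ⟪traceVec K F v x, outwardNormal K F⟫ = 0)
    (hvhat0 : ∀ K ∈ allElems Tf Ts, ∀ F ∈ facets K, OnExterior Ωf Ωs F →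
      ∀ᵐ x ∂(surf F), tang (outwardNormal K F) (vhat F x) = 0) :
    (∑ K ∈ Tf, ∑ F ∈ facets K,
        ∫ x, ⟪traceNormal K F σf x, skeletonTest K F v vhat x⟫ ∂(surf F)) +
      ∑ K ∈ Ts, ∑ F ∈ facets K,
        ∫ x, ⟪traceNormal K F σs x, skeletonTest K F v vhat x⟫ ∂(surf F) = 0 := by
  classical
  -- One stress per element, so that fluid facets, solid facets and interface facets are treated by
  -- a single cancellation.
  set σ : Finset (E d) → Fin d → Fin d → E d → ℝ := fun K => if K ∈ Tf then σf else σs with hσ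
  have hf : ∀ K ∈ Tf, σ K = σf := fun K hK => if_pos hK
  have hs : ∀ K ∈ Ts, σ K = σs := fun K hK => if_neg (hm.symm.notMem_s hK)
  have hstress : ∀ K ∈ allElems Tf Ts, ∀ K' ∈ allElems Tf Ts, K ≠ K' → ∀ F, F ∈ facets K →
      F ∈ facets K' → ∀ᵐ x ∂(surf F), traceNormal K F (σ K) x + traceNormal K' F (σ K') x = 0 := by
    intro K hK K' hK' hne F hF hF'
    rcases mem_allElems.1 hK with h | h <;> rcases mem_allElems.1 hK' with h' | h'
    · rw [hf K h, hf K' h']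
      exact hm.traceNormal_neg hd h h' hne hF hF' hσf
    · rw [hf K h, hs K' h']
      exact hdyn K h K' h' F hF hF'
    · rw [hs K h, hf K' h']
      filter_upwards [hdyn K' h' K h F hF' hF] with x hx
      rw [add_comm, hx]
    · rw [hs K h, hs K' h']
      exact hm.symm.traceNormal_neg hd h h' hne hF hF' hσs
  have key := sum_facets_eq_zero (allElems Tf Ts)
    (fun K F => ∫ x, ⟪traceNormal K F (σ K) x, skeletonTest K F v vhat x⟫ ∂(surf F)) ?_ ?_
  · rw [show allElems Tf Ts = Tf ∪ Ts from Finset.ext fun K => by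
      rw [mem_allElems, Finset.mem_union], Finset.sum_union hm.disjoint_elems] at key
    rw [← key]
    congr 1
    · exact Finset.sum_congr rfl fun K hK => by rw [hf K hK]
    · exact Finset.sum_congr rfl fun K hK => by rw [hs K hK]
  · intro K hK K' hK' hne F hF hF'
    have hN := hm.isNeighbour hK hK' hne hF hF'
    rw [← eq_neg_iff_add_eq_zero, ← integral_neg]
    refine integral_congr_ae ?_
    filter_upwards [hstress K hK K' hK' hne F hF hF', hN.skeletonTest_ae_eq hd
      (hm.interior_union_subset hK hK') hdiv (hv K hK) (hv K' hK') vhat] with x h1 h2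
    rw [h2, eq_neg_of_add_eq_zero_left h1, inner_neg_left]
  · intro K hK F hF hsingle
    have hext := hm.onExterior hd hK hF hsingle
    refine integral_eq_zero_of_ae ?_
    filter_upwards [hv0 K hK F hF hext, hvhat0 K hK F hF hext] with x h1 h2
    rw [skeletonTest, h1, h2, zero_smul, add_zero, inner_zero_right, Pi.zero_apply]

end

end FSI

namespace FSI

noncomputable section

/-! ### Consistency of the semi-discrete scheme -/

variable {d : ℕ} {Ωf Ωs : Set (E d)} {Tf Ts : Finset (Finset (E d))}

theorem IsFittedMesh.setIntegral_wholeDomain (hm : IsFittedMesh Ωf Ωs Tf Ts) {g a b : E d → ℝ}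
    (ha : g =ᵐ[volume.restrict Ωf] a) (hb : g =ᵐ[volume.restrict Ωs] b)
    (hai : IntegrableOn a Ωf) (hbi : IntegrableOn b Ωs) :
    ∫ x in wholeDomain Ωf Ωs, g x = (∫ x in Ωf, a x) + ∫ x in Ωs, b x := by
  rw [hm.restrict_wholeDomain, integral_add_measure (hai.congr ha.symm) (hbi.congr hb.symm),
    integral_congr_ae ha, integral_congr_ae hb]

theorem momentum_inner_ae_eq {U : Set (E d)} {ρ : ℝ} {w v f : E d → E d}
    {σ : Fin d → Fin d → E d → ℝ}
    (h : ∀ i, ∀ᵐ x ∂(volume.restrict U), ρ * w x i - rowDiv U σ i x = f x i) :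
    (fun x => ⟪f x, v x⟫) =ᵐ[volume.restrict U]
      fun x => ρ * ⟪w x, v x⟫ - ∑ i, rowDiv U σ i x * v x i := by
  filter_upwards [ae_all_iff.2 h] with x hx
  rw [inner_eq_sum, inner_eq_sum, Finset.mul_sum, ← Finset.sum_sub_distrib]
  refine Finset.sum_congr rfl fun i _ => ?_
  rw [← hx i]
  ring

theorem MemV0.exists_contDiff {k : ℕ} {v : E d → E d} (hv : MemV0 Ωf Ωs Tf Ts k v)
    {K : Finset (E d)} (hK : K ∈ allElems Tf Ts) (i : Fin d) :
    ∃ φ : E d → ℝ, ContDiff ℝ ∞ φ ∧ φ =ᵐ[volume.restrict (openHull K)] fun x => v x i :=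
  (hv.1.2 K hK i).exists_contDiff

theorem weakDiv_congr {U : Set (E d)} (hU : IsOpen U) {w w' : E d → E d}
    (hw : ∀ i, MemH1 U (fun x => w x i)) (h : w =ᵐ[volume.restrict U] w') :
    weakDiv U w' =ᵐ[volume.restrict U] weakDiv U w :=
  ((weakDiv_spec ⟨_, isWeakDiv_of_memH1 hw⟩).congr h).weakDiv_ae_eq hU

theorem symGrad_congr {U : Set (E d)} (hU : IsOpen U) {w w' : E d → E d}
    (hw : ∀ i, MemH1 U (fun x => w x i)) (h : w =ᵐ[volume.restrict U] w') (i j : Fin d) :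
    symGrad U w' i j =ᵐ[volume.restrict U] symGrad U w i j := by
  have hc : ∀ i, (fun x => w x i) =ᵐ[volume.restrict U] fun x => w' x i := fun i => by
    filter_upwards [h] with x hx
    rw [hx]
  filter_upwards [weakPartial_congr hU (hw i) (hc i) j, weakPartial_congr hU (hw j) (hc j) i]
    with x h1 h2
  rw [symGrad, symGrad, h1, h2]

/-- The momentum balances tested with v, the two subdomain identities and the cancellation on the
skeleton add up to the first equation. Writing q for the isotropic stress keeps fluid and solid
alike. -/
theorem momentum_equation (hd : 0 < d) (hm : IsFittedMesh Ωf Ωs Tf Ts) {k m : ℕ} {α h : ℝ}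
    {ρf ρs μf μs : ℝ} {u η wf ws ff fs : E d → E d} {p q : E d → ℝ}
    {uhat ηhat : Finset (E d) → E d → E d} {σf σs : Fin d → Fin d → E d → ℝ}
    (hwf : MemLp wf 2 (volume.restrict Ωf)) (hws : MemLp ws 2 (volume.restrict Ωs))
    (hf : ∀ i, ∀ᵐ x ∂(volume.restrict Ωf), ρf * wf x i - rowDiv Ωf σf i x = ff x i)
    (hs : ∀ i, ∀ᵐ x ∂(volume.restrict Ωs), ρs * ws x i - rowDiv Ωs σs i x = fs x i)
    (hu : ∀ i, MemH2 Ωf (fun x => u x i)) (hη : ∀ i, MemH2 Ωs (fun x => η x i))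
    (hp : MemH1 Ωf p) (hq : MemH1 Ωs q)
    (hσf : ∀ i j, (fun x => (if i = j then p x else 0) + 2 * μf * symGrad Ωf u i j x)
      =ᵐ[volume.restrict Ωf] σf i j)
    (hσs : ∀ i j, (fun x => (if i = j then q x else 0) + 2 * μs * symGrad Ωs η i j x)
      =ᵐ[volume.restrict Ωs] σs i j)
    (huhat : ∀ K ∈ Tf, ∀ F ∈ facets K, uhat F =ᵐ[surf F] traceVec K F u)
    (hηhat : ∀ K ∈ Ts, ∀ F ∈ facets K, ηhat F =ᵐ[surf F] traceVec K F η)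
    (hdyn : ∀ K ∈ Tf, ∀ K' ∈ Ts, ∀ F, F ∈ facets K → F ∈ facets K' →
      ∀ᵐ x ∂(surf F), traceNormal K F σf x + traceNormal K' F σs x = 0)
    {v : E d → E d} {vhat : Finset (E d) → E d → E d} (hv : MemV0 Ωf Ωs Tf Ts k v)
    (hvhat : MemVhat0 Ωf Ωs Tf Ts m vhat) :
    (∫ x in wholeDomain Ωf Ωs,
        glue Ωf (fun _ => ρf) (fun _ => ρs) x * ⟪glue Ωf wf ws x, v x⟫)
      + 2 * μf * hdgForm Tf k α h u uhat v vhat + (∫ x in Ωf, p x * weakDiv Ωf v x)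
      + 2 * μs * hdgForm Ts k α h η ηhat v vhat + (∫ x in Ωs, q x * weakDiv Ωs v x)
    = ∫ x in wholeDomain Ωf Ωs, ⟪glue Ωf ff fs x, v x⟫ := by
  obtain ⟨hvL, g, hg⟩ := hv.1.1
  have hvLf := hvL.mono_measure (Measure.restrict_mono hm.f_subset le_rfl)
  have hvLs := hvL.mono_measure (Measure.restrict_mono hm.s_subset le_rfl)
  have hσfm : ∀ i j, MemH1 Ωf (σf i j) := fun i j => ((memH1_ite hp i j).add
    ((memH1_symGrad hm.isOpen_f hu i j).const_mul (2 * μf))).congr (hσf i j)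
  have hσsm : ∀ i j, MemH1 Ωs (σs i j) := fun i j => ((memH1_ite hq i j).add
    ((memH1_symGrad hm.isOpen_s hη i j).const_mul (2 * μs))).congr (hσs i j)
  have hvhatL : ∀ K ∈ allElems Tf Ts, ∀ F ∈ facets K, MemLp (vhat F) 2 (surf F) :=
    fun K hK F hF => (hvhat.1 F (mem_meshFacets.2 ⟨K, hK, hF⟩)).memLp hd (hm.simplex K hK) hF
  have hvH : ∀ K ∈ allElems Tf Ts, ∀ i, MemH1 (openHull K) (fun x => v x i) := fun K hK i => by
    obtain ⟨φ, hφ, hφv⟩ := hv.exists_contDiff hK i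
    exact (memH1_of_smooth hφ K).congr hφv
  have keyf := hm.hdgForm_add_integral hd k α h μf hu hp hσf huhat hvLf ⟨g, hg.mono hm.f_subset⟩
    (fun K hK => hv.exists_contDiff (mem_allElems.2 (Or.inl hK)))
    (fun K hK => hvhatL K (mem_allElems.2 (Or.inl hK)))
  have keys := hm.symm.hdgForm_add_integral hd k α h μs hη hq hσs hηhat hvLs
    ⟨g, hg.mono hm.s_subset⟩ (fun K hK => hv.exists_contDiff (mem_allElems.2 (Or.inr hK)))
    (fun K hK => hvhatL K (mem_allElems.2 (Or.inr hK)))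
  have keyb := hm.sum_skeleton_eq_zero hd hσfm hσsm hdyn ⟨g, hg⟩ hvH hv.2 hvhat.2
  have hif : IntegrableOn (fun x => ρf * ⟪wf x, v x⟫) Ωf :=
    (integrable_inner_two hwf hvLf).const_mul ρf
  have his : IntegrableOn (fun x => ρs * ⟪ws x, v x⟫) Ωs :=
    (integrable_inner_two hws hvLs).const_mul ρs
  have hrf := integrable_rowDiv_mul hσfm hvLf
  have hrs := integrable_rowDiv_mul hσsm hvLs
  have e1 : ∫ x in wholeDomain Ωf Ωs,
      glue Ωf (fun _ => ρf) (fun _ => ρs) x * ⟪glue Ωf wf ws x, v x⟫ =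
      (∫ x in Ωf, ρf * ⟪wf x, v x⟫) + ∫ x in Ωs, ρs * ⟪ws x, v x⟫ := by
    refine hm.setIntegral_wholeDomain ?_ ?_ hif his
    · filter_upwards [hm.glue_ae_eq_f (fun _ => ρf) (fun _ => ρs), hm.glue_ae_eq_f wf ws]
        with x h1 h2
      rw [h1, h2]
    · filter_upwards [hm.glue_ae_eq_s (fun _ => ρf) (fun _ => ρs), hm.glue_ae_eq_s wf ws]
        with x h1 h2
      rw [h1, h2]
  have e2 : ∫ x in wholeDomain Ωf Ωs, ⟪glue Ωf ff fs x, v x⟫ =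
      (∫ x in Ωf, (ρf * ⟪wf x, v x⟫ - ∑ i, rowDiv Ωf σf i x * v x i)) +
        ∫ x in Ωs, (ρs * ⟪ws x, v x⟫ - ∑ i, rowDiv Ωs σs i x * v x i) := by
    refine hm.setIntegral_wholeDomain ?_ ?_ (hif.sub hrf) (his.sub hrs)
    · filter_upwards [momentum_inner_ae_eq (v := v) hf, hm.glue_ae_eq_f ff fs] with x h1 h2
      rw [h2, h1]
    · filter_upwards [momentum_inner_ae_eq (v := v) hs, hm.glue_ae_eq_s ff fs] with x h1 h2
      rw [h2, h1]
  rw [e1, e2, integral_sub hif hrf, integral_sub his hrs]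
  linear_combination keyf + keys + keyb

end

end FSI

/-! ### The exact solution satisfies the semi-discrete equations -/

theorem lemma2p1 {d : ℕ} (hd : d = 2 ∨ d = 3)
    (Ωf Ωs : Set (FSI.E d)) (Tf Ts : Finset (Finset (FSI.E d)))
    (hmesh : FSI.IsFittedMesh Ωf Ωs Tf Ts)
    (k : ℕ) (hk : 1 ≤ k) (α : ℝ) (hα : 0 < α)
    (T : ℝ) (hT : 0 < T) (ρf ρs μf μs lam : ℝ)
    (ff fs : ℝ → FSI.E d → FSI.E d) (u0f u0s η0 : FSI.E d → FSI.E d)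
    (uf us : ℝ → FSI.E d → FSI.E d) (pf : ℝ → FSI.E d → ℝ) (ηs : ℝ → FSI.E d → FSI.E d)
    (hsol : FSI.IsFSISolution Ωf Ωs T ρf ρs μf μs lam ff fs u0f u0s η0 uf us pf ηs)
    (hu : ∀ t ∈ Set.Icc 0 T, ∀ i,
      FSI.MemH2 (FSI.wholeDomain Ωf Ωs) (fun x => FSI.glue Ωf (uf t) (us t) x i))
    (hp : ∀ t ∈ Set.Icc 0 T, FSI.MemH1 Ωf (pf t))
    (hη : ∀ t ∈ Set.Icc 0 T, ∀ i, FSI.MemH2 Ωs (fun x => ηs t x i)) :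
    ∀ t ∈ Set.Icc 0 T,
      FSI.SemiDiscreteEqns Ωf Ωs Tf Ts k α T ρf ρs μf μs lam ff fs
        (fun s => FSI.glue Ωf (uf s) (us s))
        (fun s => FSI.skeletonTrace (FSI.allElems Tf Ts) (FSI.glue Ωf (uf s) (us s)))
        pf ηs (fun s => FSI.skeletonTrace Ts (ηs s)) t := by
  intro t ht
  have hd0 : 0 < d := by omega
  obtain ⟨wf, hwf, hmomf⟩ := hsol.fluid_momentum t ht
  obtain ⟨ws, hws, hmoms⟩ := hsol.solid_momentum t ht
  obtain ⟨w, hw, hwu⟩ := hsol.solid_velocity t ht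
  have hglf := hmesh.glue_ae_eq_f (uf t) (us t)
  have hgls := hmesh.glue_ae_eq_s (uf t) (us t)
  have huf := fun i => (hu t ht i).mono hmesh.f_subset
  have huH1 := fun i => (hu t ht i).memH1
  have hηdiv := FSI.weakDiv_ae_eq_sum hmesh.isOpen_s fun i => (hη t ht i).memH1
  -- As η is in H², its divergence is a sum of H¹ functions, so the isotropic part of the solid
  -- stress has traces.
  have hq : FSI.MemH1 Ωs (fun x => lam * FSI.weakDiv Ωs (ηs t) x) :=
    ((FSI.MemH1.finset_sum Finset.univ fun i _ =>
      (hη t ht i).memH1_weakPartial hmesh.isOpen_s i).congr hηdiv.symm).const_mul lam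
  have hpn : FSI.MemH1 Ωf (fun x => - pf t x) := by
    simpa using (hp t ht).const_mul (-1)
  -- The derivative of η̂ is taken to be û itself, which makes the last equation trivial.
  refine ⟨FSI.glue Ωf wf ws, w, FSI.skeletonTrace (FSI.allElems Tf Ts) (FSI.glue Ωf (uf t) (us t)),
    hmesh.hasL2TimeDeriv_glue ht hwf hws, hw.2.1, fun F hF =>
      hmesh.exists_hasL2TimeDeriv_skeletonTrace hd0 ht huH1 hgls
        (fun s hs i => (hη s hs i).memH1) hw hwu hF, ?_, ?_, ?_⟩
  · intro v vhat q hv hvhat _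
    have key := FSI.momentum_equation hd0 hmesh (α := α) (h := FSI.meshSize Tf Ts)
      hwf.1 hws.1 hmomf hmoms huf (hη t ht) hpn hq
      (uhat := FSI.skeletonTrace (FSI.allElems Tf Ts) (FSI.glue Ωf (uf t) (us t)))
      (ηhat := FSI.skeletonTrace Ts (ηs t))
      (fun i j => by
        filter_upwards [FSI.symGrad_congr hmesh.isOpen_f (fun i => (huf i).memH1) hglf i j]
          with x hx
        rw [FSI.fluidStress, hx])
      (fun i j => Filter.EventuallyEq.rfl)
      (fun K hK F hF => hmesh.skeletonTrace_ae_eq hd0 (FSI.mem_allElems.2 (Or.inl hK)) hF huH1)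
      (fun K hK F hF => hmesh.skeletonTrace_ae_eq_s hd0 hK hF fun i => (hη t ht i).memH1)
      (fun K hK K' hK' F hF hF' => hsol.dynamic t ht K K' F (hmesh.simplex_f hK)
        (hmesh.simplex_s hK') hF hF' (hmesh.hull_subset_f hK) (hmesh.hull_subset_s hK'))
      hv hvhat
    -- The incompressibility term is absent from `key`; it vanishes because ∇·u = 0 almost
    -- everywhere in Ωᶠ.
    have hdiv0 : ∫ x in Ωf, FSI.weakDiv Ωf (FSI.glue Ωf (uf t) (us t)) x * q x = 0 := by
      refine MeasureTheory.integral_eq_zero_of_ae ?_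
      filter_upwards [FSI.weakDiv_congr hmesh.isOpen_f (fun i => (huf i).memH1) hglf,
        hsol.fluid_div t ht] with x h1 h2
      rw [← h1, h2, zero_mul, Pi.zero_apply]
    simp only [neg_mul, mul_assoc lam, MeasureTheory.integral_neg,
      MeasureTheory.integral_const_mul] at key
    rw [hdiv0]
    linear_combination key
  · intro ξ _
    refine MeasureTheory.integral_eq_zero_of_ae ?_
    filter_upwards [hgls, hwu] with x h1 h2
    rw [h1, h2, inner_zero_left, Pi.zero_apply]
  · intro ξhat _
    simp
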